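/- \textbf{Integrals at infinity.} Let $\bar\Lambda=\mathbb C[p_0,p_1,p_2,\dots]$ be freely generated by $p_0,p_1,\dots$, put $p_{j}:=p_{|j|}$ for $j\in\mathbb Z$, $\partial_a=a\,\partial/\partial p_a$, and let $k,p,q\in\mathbb C$. On $\bar\Lambda[x,x^{-1}]$ let $\partial$ be the derivation over $\mathbb C$ with $\partial x=x$, $\partial p_l=l(x^l-x^{-l})$; let $t$ be the $\bar\Lambda$-linear automorphism $x\mapsto x^{-1}$; let $\Delta$ be the $\bar\Lambda$-linear map with $\Delta(1)=0$ and, for $l>0$, $$\Delta(x^l)=(p_0-2l-1)x^l-2\sum_{j=1}^{l-1}x^{l-2j}-x^{-l}+2\sum_{j=1}^{l-1}p_jx^{l-j}+p_l,\qquad \Delta(x^{-l})=-t(\Delta(x^l)).$$ Define the $BC$ Dunkl--Heckman operator at infinity $$D=\partial-\tfrac k2\Delta-\tfrac p2\,\frac{x+1}{x-1}(1-t)-q\,\frac{x^2+1}{x^2-1}(1-t),$$ the $\bar\Lambda$-linear map $E:\bar\Lambda[x,x^{-1}]\to\bar\Lambda$, $E(x^j)=p_{|j|}$, and $\mathcal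 L^{(2r)}=E\circ D^{2r}|_{\bar\Lambda}$ for $r\ge 0$. Let $N\ge 0$ and, in the variables $x_1,\dots,x_N$, put $\partial_i=x_i\partial/\partial x_i$ and $$D_{i,N}=\partial_i-\tfrac k2\sum_{j\ne i}\Big(\frac{x_i+x_j}{x_i-x_j}(1-s_{ij}^+)+\frac{x_ix_j+1}{x_ix_j-1}(1-s_{ij}^-)\Big)-\tfrac p2\frac{x_i+1}{x_i-1}(1-t_i)-q\frac{x_i^2+1}{x_i^2-1}(1-t_i),$$ where $s_{ij}^{\pm}(x_i,x_j)=(x_j^{\pm1},x_i^{\pm1})$, $t_i(x_i)=x_i^{-1}$; let $\Lambda_N^W$ be the algebra of Laurent polynomials invariant under all $s_{ij}^\pm$, $t_i$. Let $\varphi_N$ be the algebra homomorphism on $\bar\Lambda$ with $\varphi_N(p_l)=\sum_i(x_i^l+x_i^{-l})$, $l\ge0$, and $\varphi_{i,N}$ its extension to $\bar\Lambda[x,x^{-1}]$ with $\varphi_{i,N}(x)=x_i$. Then: (1) $\varphi_{i,N}\circ D=D_{i,N}\circ\varphi_{i,N}$. (2) $\varphi_N(\bar\Lambda)\subset\Lambda_N^W$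 and $\varphi_N\circ\mathcal L^{(2r)}=2\,\mathcal L^{(2r)}_N\circ\varphi_N$, where $\mathcal L_N^{(2r)}=\sum_iD_{i,N}^{2r}|_{\Lambda_N^W}$ are Heckman's integrals; moreover $\mathcal L_N^{(2)}$ is the $BC_N$ CMS operator $$\sum_i\partial_i^2-k\sum_{i<j}\frac{x_i+x_j}{x_i-x_j}(\partial_i-\partial_j)-k\sum_{i<j}\frac{x_ix_j+1}{x_ix_j-1}(\partial_i+\partial_j)-\sum_i\Big(p\frac{x_i+1}{x_i-1}+2q\frac{x_i^2+1}{x_i^2-1}\Big)\partial_i .$$ (3) $[\mathcal L^{(2r)},\mathcal L^{(2s)}]=0$ for all $r,s\ge 0$. (4) With $h=-kp_0-p-2q$, $$\mathcal L^{(2)}=2\sum_{a,b\ge1}(p_{a+b}-p_{a-b})\partial_a\partial_b+2\sum_{a\ge1}(ak+a+k+h)p_a\partial_a+2(k-2q)\sum_{a\ge2}\Big(\sum_{j=1}^{a-1}p_{a-2j}\Big)\partial_a-2p\sum_{a\ge1}\Big(\sum_{j=1}^{2a-1}p_{a-j}\Big)\partial_a-2k\sum_{a\ge2}\Big(\sum_{j=1}^{a-1}p_jp_{a-j}\Big)\partial_a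 .$$ \textbf{Deformed case.} Let $n,m\ge0$ and let $k,p,q,r,s\in\mathbb C$ satisfy $k\neq0$, $p=kr$, $2q+1=k(2s+1)$. Use variables $x_1,\dots,x_n$ and $y_j=x_{n+j}$ ($1\le j\le m$), $\partial_i=x_i\partial/\partial x_i$; put $p(i)=0,\ \mu(i)=p,\ \nu(i)=q$ for $i\le n$ and $p(i)=1,\ \mu(i)=r,\ \nu(i)=s$ for $i>n$. Let $$H_{n,m}=\sum_{i=1}^n\Big(x_i\frac{\partial}{\partial x_i}\Big)^2+k\sum_{j=1}^m\Big(y_j\frac{\partial}{\partial y_j}\Big)^2-2k(k+1)\sum_{i<j}^n\Big(\frac{x_ix_j}{(x_i-x_j)^2}+\frac{x_ix_j}{(x_ix_j-1)^2}\Big)-2(k^{-1}+1)\sum_{i<j}^m\Big(\frac{y_iy_j}{(y_i-y_j)^2}+\frac{y_iy_j}{(y_iy_j-1)^2}\Big)$$ $$-2(k+1)\sum_{i=1}^n\sum_{j=1}^m\Big(\frac{x_iy_j}{(x_i-y_j)^2}+\frac{x_iy_j}{(x_iy_j-1)^2}\Big)-\sum_{i=1}^n\Big(\frac{p(p+2q+1)x_i}{(x_i-1)^2}+\frac{4q(q+1)x_i^2}{(x_i^2-1)^2}\Big)-\sum_{j=1}^m\Big(\frac{kr(r+2s+1)y_j}{(y_j-1)^2}+\frac{4ks(s+1)y_j^2}{(y_j^2-1)^2}\Big),$$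 and let $L=\begin{pmatrix}A&B\\-B&-A\end{pmatrix}$ be the matrix of differential operators with $$A_{ii}=k^{p(i)}\partial_i,\quad A_{ij}=\frac{k^{1-p(j)}(x_i+x_j)}{2(x_i-x_j)},\quad B_{ii}=\frac{k^{p(i)}\mu(i)(x_i+1)}{2(x_i-1)}+\frac{k^{p(i)}\nu(i)(x_i^2+1)}{x_i^2-1},\quad B_{ij}=\frac{k^{1-p(j)}(x_ix_j+1)}{2(x_ix_j-1)}\quad(i\ne j).$$ Let $e=(1,\dots,1)^T$ and $e^*_i=e^*_{n+m+i}=k^{-p(i)}$. Then the operators $L^{(2l)}_{n,m}=e^*L^{2l}e$, $l\ge0$, are commuting quantum integrals of the deformed $BC_{n,m}$ system: $[L^{(2l)}_{n,m},H_{n,m}]=0$ and $[L^{(2l)}_{n,m},L^{(2l')}_{n,m}]=0$ for all $l,l'$. -/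

import Mathlib

open scoped LaurentPolynomial

noncomputable section

namespace BCCMS

/-! ### The algebra at infinity -/

/-- The polynomial algebra `Λ̄` freely generated over `ℂ` by `p₀, p₁, p₂, …`. -/
abbrev LambdaBar : Type := MvPolynomial ℕ ℂ

/-- The algebra `Λ̄[x, x⁻¹]`; here `x ^ l` is `T l`. -/
abbrev LambdaBarX : Type := LaurentPolynomial LambdaBar

/-- The generator `p_j` with the convention `p_j = p_{|j|}` for integer `j`. -/
def pgen (j : ℤ) : LambdaBar := MvPolynomial.X j.natAbs

/-- `∂_a = a ∂/∂p_a` on `Λ̄`. -/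
def partialP (a : ℕ) (f : LambdaBar) : LambdaBar := (a : ℂ) • MvPolynomial.pderiv a f

/-- The derivation `Λ̄ → Λ̄[x, x⁻¹]` over `ℂ` with `p_l ↦ l (x ^ l - x ^ (-l))`. -/
def derivP : Derivation ℂ LambdaBar LambdaBarX :=
  MvPolynomial.mkDerivation ℂ fun l : ℕ =>
    (l : ℂ) • (LaurentPolynomial.T (l : ℤ) - LaurentPolynomial.T (-(l : ℤ)))

/-- The linear map underlying `∂`: `c x ^ l ↦ (derivP c + l c) x ^ l` for `c ∈ Λ̄`. -/
def derivLin : LambdaBarX →ₗ[ℂ] LambdaBarX :=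
  (Finsupp.lsum ℂ fun l : ℤ =>
    (LinearMap.mulRight ℂ (LaurentPolynomial.T l : LambdaBarX)).comp
      (derivP.toLinearMap + (l : ℂ) • (Algebra.linearMap LambdaBar LambdaBarX).restrictScalars ℂ)).comp
    (AddMonoidAlgebra.coeffLinearEquiv ℂ).toLinearMap

theorem derivLin_single (l : ℤ) (c : LambdaBar) :
    derivLin (AddMonoidAlgebra.single l c) =
      (derivP c + (l : ℂ) • LaurentPolynomial.C c) * LaurentPolynomial.T l := by
  have h : AddMonoidAlgebra.coeffLinearEquiv ℂ (AddMonoidAlgebra.single l c) =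
      (Finsupp.single l c : ℤ →₀ LambdaBar) := rfl
  rw [derivLin, LinearMap.comp_apply, LinearEquiv.coe_coe, h, Finsupp.lsum_single]
  rfl

theorem derivLin_mul (F G : LambdaBarX) :
    derivLin (F * G) = F • derivLin G + G • derivLin F := by
  induction F using AddMonoidAlgebra.induction_linear with
  | zero => simp
  | add F F' h h' => rw [add_mul, map_add, h, h', map_add]; simp only [smul_eq_mul]; ring
  | single l c =>
    induction G using AddMonoidAlgebra.induction_linear with
    | zero => simp
    | add G G' h h' => rw [mul_add, map_add, h, h', map_add]; simp only [smul_eq_mul]; ring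
    | single l' c' =>
      rw [AddMonoidAlgebra.single_mul_single, derivLin_single, derivLin_single, derivLin_single,
        Derivation.leibniz, LaurentPolynomial.T_add, LaurentPolynomial.single_eq_C_mul_T,
        LaurentPolynomial.single_eq_C_mul_T, map_mul]
      have e : ∀ u : LambdaBar, algebraMap LambdaBar LambdaBarX u = LaurentPolynomial.C u :=
        fun _ => rfl
      simp only [smul_eq_mul, Int.cast_add, map_add, Algebra.smul_def, e]
      ring

/-- The derivation `∂` of `Λ̄[x, x⁻¹]` with `∂ x = x` and `∂ p_l = l (x ^ l - x ^ (-l))`. -/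
def derivInf : Derivation ℂ LambdaBarX LambdaBarX := Derivation.mk' derivLin derivLin_mul

theorem derivInf_x : derivInf (LaurentPolynomial.T 1) = LaurentPolynomial.T 1 := by
  change derivLin (AddMonoidAlgebra.single 1 1) = _
  rw [derivLin_single]; simp

theorem derivInf_p (l : ℕ) :
    derivInf (LaurentPolynomial.C (MvPolynomial.X l)) =
      (l : ℂ) • (LaurentPolynomial.T (l : ℤ) - LaurentPolynomial.T (-(l : ℤ))) := by
  change derivLin (AddMonoidAlgebra.single 0 (MvPolynomial.X l)) = _
  rw [derivLin_single]; simp [derivP]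

/-- The homomorphism of `Λ̄`-modules with `x ^ l ↦ g l`. -/
def onPowers {M : Type} [AddCommGroup M] [Module LambdaBar M] (g : ℤ → M) :
    LambdaBarX →ₗ[LambdaBar] M :=
  (Finsupp.linearCombination LambdaBar g).comp
    (AddMonoidAlgebra.coeffLinearEquiv LambdaBar).toLinearMap

theorem onPowers_single {M : Type} [AddCommGroup M] [Module LambdaBar M] (g : ℤ → M) (l : ℤ)
    (c : LambdaBar) : onPowers g (AddMonoidAlgebra.single l c) = c • g l := by
  have h : AddMonoidAlgebra.coeffLinearEquiv LambdaBar (AddMonoidAlgebra.single l c) =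
      (Finsupp.single l c : ℤ →₀ LambdaBar) := rfl
  rw [onPowers, LinearMap.comp_apply, LinearEquiv.coe_coe, h, Finsupp.linearCombination_single]

/-- `Δ(x ^ l)` for `l > 0`. -/
def deltaPos (l : ℕ) : LambdaBarX :=
  LaurentPolynomial.C (pgen 0 - 2 * (l : LambdaBar) - 1) * LaurentPolynomial.T (l : ℤ)
    - 2 * ∑ j ∈ Finset.Ico 1 l, LaurentPolynomial.T ((l : ℤ) - 2 * j)
    - LaurentPolynomial.T (-(l : ℤ))
    + 2 * ∑ j ∈ Finset.Ico 1 l,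
        LaurentPolynomial.C (pgen j) * LaurentPolynomial.T ((l : ℤ) - j)
    + LaurentPolynomial.C (pgen l)

/-- `Δ(x ^ (-l))` for `l > 0`. -/
def deltaNeg (l : ℕ) : LambdaBarX :=
  -(LaurentPolynomial.C (pgen 0 - 2 * (l : LambdaBar) - 1) * LaurentPolynomial.T (-(l : ℤ)))
    + 2 * ∑ j ∈ Finset.Ico 1 l, LaurentPolynomial.T ((l : ℤ) - 2 * j)
    + LaurentPolynomial.T (l : ℤ)
    - 2 * ∑ j ∈ Finset.Ico 1 l,
        LaurentPolynomial.C (pgen j) * LaurentPolynomial.T (-(l : ℤ) + j)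
    - LaurentPolynomial.C (pgen l)

/-- The homomorphism of `Λ̄`-modules `Δ` on `Λ̄[x, x⁻¹]`. -/
def Delta : LambdaBarX →ₗ[LambdaBar] LambdaBarX :=
  onPowers fun l =>
    if 0 < l then deltaPos l.natAbs else if l < 0 then deltaNeg l.natAbs else 0

/-- The operator `(x + 1) / (x - 1) (1 - t)` on `Λ̄[x, x⁻¹]`, where `t (x ^ l) = x ^ (-l)`;
see `reflOne_spec`. -/
def reflOne : LambdaBarX →ₗ[LambdaBar] LambdaBarX :=
  onPowers fun l => (l.sign : LambdaBarX) *
    (LaurentPolynomial.T l + LaurentPolynomial.T (-l)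
      + 2 * ∑ j ∈ Finset.Ico 1 (2 * l.natAbs), LaurentPolynomial.T ((l.natAbs : ℤ) - j))

/-- The operator `(x ^ 2 + 1) / (x ^ 2 - 1) (1 - t)` on `Λ̄[x, x⁻¹]`; see `reflTwo_spec`. -/
def reflTwo : LambdaBarX →ₗ[LambdaBar] LambdaBarX :=
  onPowers fun l => (l.sign : LambdaBarX) *
    (LaurentPolynomial.T l + LaurentPolynomial.T (-l)
      + 2 * ∑ j ∈ Finset.Ico 1 l.natAbs, LaurentPolynomial.T ((l.natAbs : ℤ) - 2 * j))

/-- The telescoping identity behind the two divisions below. -/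
theorem telescope (s : ℤ) (N : ℕ) (hN : 0 < N) (a : ℤ) :
    ((LaurentPolynomial.T s : LambdaBarX) - 1) *
      (LaurentPolynomial.T a + LaurentPolynomial.T (a - N * s)
        + 2 * ∑ j ∈ Finset.Ico 1 N, LaurentPolynomial.T (a - j * s)) =
      (LaurentPolynomial.T s + 1) * (LaurentPolynomial.T a - LaurentPolynomial.T (a - N * s)) := by
  induction N, hN using Nat.le_induction with
  | base =>
    have h : (LaurentPolynomial.T a : LambdaBarX) =
        LaurentPolynomial.T (a - s) * LaurentPolynomial.T s := by
      rw [← LaurentPolynomial.T_add]; congr 1; ring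
    simp only [Nat.cast_one, one_mul, Finset.Ico_self,
      Finset.sum_empty, mul_zero, add_zero]
    rw [h]; ring
  | succ N hN ih =>
    rw [Finset.sum_Ico_succ_top hN]
    have h : (LaurentPolynomial.T (a - N * s) : LambdaBarX) =
        LaurentPolynomial.T (a - (N + 1 : ℕ) * s) * LaurentPolynomial.T s := by
      rw [← LaurentPolynomial.T_add]; congr 1; push_cast; ring
    rw [h] at ih ⊢
    linear_combination ih

theorem reflOne_spec (F : LambdaBarX) :
    (LaurentPolynomial.T 1 - 1) * reflOne F =
      (LaurentPolynomial.T 1 + 1) * (F - LaurentPolynomial.invert F) := by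
  induction F using AddMonoidAlgebra.induction_linear with
  | zero => simp
  | add F G hF hG => rw [map_add, map_add, mul_add, hF, hG]; ring
  | single l c =>
    rw [reflOne, onPowers_single, LaurentPolynomial.single_eq_C_mul_T, map_mul,
      LaurentPolynomial.invert_C, LaurentPolynomial.invert_T, LaurentPolynomial.smul_eq_C_mul]
    rcases lt_trichotomy l 0 with h | rfl | h
    · have key := telescope 1 (2 * l.natAbs) (by omega) (l.natAbs : ℤ)
      have e1 : (l.natAbs : ℤ) = -l := by omega
      have e2 : (l.natAbs : ℤ) - ((2 * l.natAbs : ℕ) : ℤ) * 1 = l := by omega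
      rw [e2] at key
      simp only [mul_one] at key
      rw [Int.sign_eq_neg_one_of_neg h]
      rw [e1] at key ⊢
      push_cast
      linear_combination (-LaurentPolynomial.C c) * key
    · simp
    · have key := telescope 1 (2 * l.natAbs) (by omega) (l.natAbs : ℤ)
      have e1 : (l.natAbs : ℤ) = l := by omega
      have e2 : (l.natAbs : ℤ) - ((2 * l.natAbs : ℕ) : ℤ) * 1 = -l := by omega
      rw [e2] at key
      simp only [mul_one] at key
      rw [Int.sign_eq_one_of_pos h]
      rw [e1] at key ⊢
      push_cast
      linear_combination (LaurentPolynomial.C c) * key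

theorem reflTwo_spec (F : LambdaBarX) :
    (LaurentPolynomial.T 2 - 1) * reflTwo F =
      (LaurentPolynomial.T 2 + 1) * (F - LaurentPolynomial.invert F) := by
  induction F using AddMonoidAlgebra.induction_linear with
  | zero => simp
  | add F G hF hG => rw [map_add, map_add, mul_add, hF, hG]; ring
  | single l c =>
    rw [reflTwo, onPowers_single, LaurentPolynomial.single_eq_C_mul_T, map_mul,
      LaurentPolynomial.invert_C, LaurentPolynomial.invert_T, LaurentPolynomial.smul_eq_C_mul]
    rcases lt_trichotomy l 0 with h | rfl | h
    · have key := telescope 2 l.natAbs (by omega) (l.natAbs : ℤ)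
      have e1 : (l.natAbs : ℤ) = -l := by omega
      have e2 : (l.natAbs : ℤ) - (l.natAbs : ℤ) * 2 = l := by omega
      rw [e2] at key
      simp only [mul_comm _ (2 : ℤ)] at key
      rw [Int.sign_eq_neg_one_of_neg h]
      rw [e1] at key ⊢
      push_cast
      linear_combination (-LaurentPolynomial.C c) * key
    · simp
    · have key := telescope 2 l.natAbs (by omega) (l.natAbs : ℤ)
      have e1 : (l.natAbs : ℤ) = l := by omega
      have e2 : (l.natAbs : ℤ) - (l.natAbs : ℤ) * 2 = -l := by omega
      rw [e2] at key
      simp only [mul_comm _ (2 : ℤ)] at key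
      rw [Int.sign_eq_one_of_pos h]
      rw [e1] at key ⊢
      push_cast
      linear_combination (LaurentPolynomial.C c) * key

/-- The infinite-dimensional `BC` Dunkl–Heckman operator
`D = ∂ - (k/2) Δ - (p/2) (x+1)/(x-1) (1-t) - q (x²+1)/(x²-1) (1-t)` on `Λ̄[x, x⁻¹]`. -/
def dunklInf (k p q : ℂ) : Module.End ℂ LambdaBarX :=
  derivInf.toLinearMap - (k / 2) • Delta.restrictScalars ℂ
    - (p / 2) • reflOne.restrictScalars ℂ - q • reflTwo.restrictScalars ℂ

/-- The homomorphism of `Λ̄`-modules `E` with `E (x ^ j) = p_{|j|}`. -/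
def traceE : LambdaBarX →ₗ[LambdaBar] LambdaBar := onPowers pgen

/-- `𝓛^(2r) = E ∘ D ^ (2r)`, restricted to `Λ̄`. -/
def cmsInf (k p q : ℂ) (r : ℕ) : Module.End ℂ LambdaBar :=
  traceE.restrictScalars ℂ ∘ₗ (dunklInf k p q ^ (2 * r)) ∘ₗ
    (Algebra.linearMap LambdaBar LambdaBarX).restrictScalars ℂ

/-! ### Extension of derivations to fraction fields -/

section Extension

variable {A K : Type} [CommRing A] [Algebra ℂ A] [Field K] [Algebra A K]

/-- The ring homomorphism `a ↦ a + ε d a` into the dual numbers. -/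
def dualHom (d : Derivation ℂ A A) :
    A →+* TrivSqZeroExt K K where
  toFun a := TrivSqZeroExt.inl (algebraMap A K a) + TrivSqZeroExt.inr (algebraMap A K (d a))
  map_one' := by ext <;> simp
  map_mul' a b := by
    ext
    · simp
    · simp only [Derivation.leibniz, smul_eq_mul, map_add, map_mul, TrivSqZeroExt.snd_add,
        TrivSqZeroExt.snd_inl, TrivSqZeroExt.snd_inr, TrivSqZeroExt.snd_mul,
        TrivSqZeroExt.fst_add, TrivSqZeroExt.fst_inl, TrivSqZeroExt.fst_inr,
        MulOpposite.smul_eq_mul_unop, MulOpposite.unop_op]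
      ring
  map_zero' := by ext <;> simp
  map_add' a b := by
    ext
    · simp
    · simp only [map_add, TrivSqZeroExt.snd_add, TrivSqZeroExt.snd_inl, TrivSqZeroExt.snd_inr]
      ring

theorem dualHom_fst (d : Derivation ℂ A A) (a : A) :
    (dualHom (K := K) d a).fst = algebraMap A K a := by
  change (TrivSqZeroExt.inl (algebraMap A K a) + TrivSqZeroExt.inr (algebraMap A K (d a))).fst = _
  rw [TrivSqZeroExt.fst_add, TrivSqZeroExt.fst_inl, TrivSqZeroExt.fst_inr, add_zero]

theorem dualHom_snd (d : Derivation ℂ A A) (a : A) :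
    (dualHom (K := K) d a).snd = algebraMap A K (d a) := by
  change (TrivSqZeroExt.inl (algebraMap A K a) + TrivSqZeroExt.inr (algebraMap A K (d a))).snd = _
  rw [TrivSqZeroExt.snd_add, TrivSqZeroExt.snd_inl, TrivSqZeroExt.snd_inr, zero_add]

/-- The extension of `dualHom` to the fraction field. -/
def dualLift [IsFractionRing A K] (d : Derivation ℂ A A) :
    K →+* TrivSqZeroExt K K :=
  IsLocalization.lift (M := nonZeroDivisors A) (g := dualHom (K := K) d) fun y => by
    rw [TrivSqZeroExt.isUnit_iff_isUnit_fst, dualHom_fst]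
    exact IsLocalization.map_units K y

theorem dualLift_algebraMap [IsFractionRing A K] (d : Derivation ℂ A A) (a : A) :
    dualLift d (algebraMap A K a) = dualHom d a :=
  IsLocalization.lift_eq _ a

theorem dualLift_fst [IsFractionRing A K] (d : Derivation ℂ A A) (f : K) : (dualLift d f).fst = f := by
  have h : ((TrivSqZeroExt.fstHom K K K : TrivSqZeroExt K K →ₐ[K] K) :
      TrivSqZeroExt K K →+* K).comp (dualLift d) = RingHom.id K := by
    apply IsLocalization.ringHom_ext (nonZeroDivisors A)
    refine RingHom.ext fun a => ?_
    change (dualLift d (algebraMap A K a)).fst = algebraMap A K a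
    rw [dualLift_algebraMap, dualHom_fst]
  exact congrArg (fun g : K →+* K => g f) h

/-- The extension of a derivation from a domain to its fraction field (the quotient rule);
see `ratDeriv_algebraMap`. -/
def ratDeriv [IsFractionRing A K] [Algebra ℂ K] [IsScalarTower ℂ A K] (d : Derivation ℂ A A) :
    Derivation ℂ K K :=
  Derivation.mk'
    { toFun := fun f => (dualLift d f).snd
      map_add' := fun f g => by rw [map_add, TrivSqZeroExt.snd_add]
      map_smul' := fun c f => by
        have h1 : (dualLift d (algebraMap ℂ K c)).snd = 0 := by
          rw [IsScalarTower.algebraMap_apply ℂ A K, dualLift_algebraMap, dualHom_snd,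
            Derivation.map_algebraMap, map_zero]
        rw [Algebra.smul_def, map_mul, TrivSqZeroExt.snd_mul, h1, dualLift_fst]
        simp [Algebra.smul_def] }
    fun f g => by
      change (dualLift d (f * g)).snd = f • (dualLift d g).snd + g • (dualLift d f).snd
      rw [map_mul, TrivSqZeroExt.snd_mul, dualLift_fst, dualLift_fst]
      simp [mul_comm]

theorem ratDeriv_algebraMap [IsFractionRing A K] [Algebra ℂ K] [IsScalarTower ℂ A K]
    (d : Derivation ℂ A A) (a : A) : (ratDeriv d : Derivation ℂ K K) (algebraMap A K a) =
      algebraMap A K (d a) := by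
  change (dualLift d (algebraMap A K a)).snd = _
  rw [dualLift_algebraMap, dualHom_snd]

end Extension

/-! ### Rational functions in finitely many variables -/

section Rational

variable {ι : Type} [DecidableEq ι]

/-- Laurent polynomials over `ℂ` in the variables `x_i`, `i ∈ ι`. -/
abbrev LaurentRing (ι : Type) : Type := AddMonoidAlgebra ℂ (ι →₀ ℤ)

/-- The field of rational functions over `ℂ` in the variables `x_i`, `i ∈ ι`. -/
def RatField (ι : Type) : Type := FractionRing (LaurentRing ι)

instance (ι : Type) : Field (RatField ι) := inferInstanceAs (Field (FractionRing (LaurentRing ι)))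

instance (ι : Type) : Algebra (LaurentRing ι) (RatField ι) :=
  inferInstanceAs (Algebra (LaurentRing ι) (FractionRing (LaurentRing ι)))

instance (ι : Type) : IsFractionRing (LaurentRing ι) (RatField ι) :=
  inferInstanceAs (IsFractionRing (LaurentRing ι) (FractionRing (LaurentRing ι)))

instance (ι : Type) : Algebra ℂ (RatField ι) :=
  inferInstanceAs (Algebra ℂ (FractionRing (LaurentRing ι)))

instance (ι : Type) : IsScalarTower ℂ (LaurentRing ι) (RatField ι) :=
  inferInstanceAs (IsScalarTower ℂ (LaurentRing ι) (FractionRing (LaurentRing ι)))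

/-- The variable `x_i` as a Laurent polynomial. -/
def laurentVar (i : ι) : LaurentRing ι := AddMonoidAlgebra.single (Finsupp.single i 1) 1

/-- The variable `x_i` as a rational function. -/
def var (i : ι) : RatField ι := algebraMap (LaurentRing ι) (RatField ι) (laurentVar i)

theorem laurentVar_ne_zero {ι : Type} (i : ι) : laurentVar i ≠ 0 := by
  intro h
  have := congrArg (fun f : LaurentRing ι => f.coeff (Finsupp.single i 1)) h
  simp [laurentVar] at this

theorem var_ne_zero {ι : Type} (i : ι) : var i ≠ 0 := fun h =>
  laurentVar_ne_zero i ((IsFractionRing.to_map_eq_zero_iff (K := RatField ι)).1 h)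

/-- The linear map `x ^ m ↦ m_i x ^ m` on Laurent polynomials. -/
def eulerLin {ι : Type} (i : ι) : LaurentRing ι →ₗ[ℂ] LaurentRing ι :=
  (Finsupp.lsum ℂ fun m : ι →₀ ℤ =>
    (m i : ℂ) • (AddMonoidAlgebra.coeffLinearEquiv ℂ).symm.toLinearMap ∘ₗ Finsupp.lsingle m).comp
    (AddMonoidAlgebra.coeffLinearEquiv ℂ).toLinearMap

theorem eulerLin_single {ι : Type} (i : ι) (m : ι →₀ ℤ) (c : ℂ) :
    eulerLin i (AddMonoidAlgebra.single m c) = (m i : ℂ) • AddMonoidAlgebra.single m c := by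
  have h : AddMonoidAlgebra.coeffLinearEquiv ℂ (AddMonoidAlgebra.single m c) =
      (Finsupp.single m c : (ι →₀ ℤ) →₀ ℂ) := rfl
  rw [eulerLin, LinearMap.comp_apply, LinearEquiv.coe_coe, h, Finsupp.lsum_single]
  rfl

/-- The derivation `x_i ∂/∂x_i` of Laurent polynomials. -/
def euler {ι : Type} (i : ι) : Derivation ℂ (LaurentRing ι) (LaurentRing ι) :=
  Derivation.mk' (eulerLin i) fun F G => by
    induction F using AddMonoidAlgebra.induction_linear with
    | zero => simp
    | add F F' h h' => rw [add_mul, map_add, h, h', map_add]; simp only [smul_eq_mul]; ring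
    | single m c =>
      induction G using AddMonoidAlgebra.induction_linear with
      | zero => simp
      | add G G' h h' => rw [mul_add, map_add, h, h', map_add]; simp only [smul_eq_mul]; ring
      | single m' c' =>
        rw [AddMonoidAlgebra.single_mul_single, eulerLin_single, eulerLin_single, eulerLin_single,
          smul_eq_mul, smul_eq_mul, mul_smul_comm, mul_smul_comm,
          AddMonoidAlgebra.single_mul_single, AddMonoidAlgebra.single_mul_single,
          Finsupp.add_apply, Int.cast_add, add_smul, add_comm m' m, mul_comm c' c, add_comm]

/-- The derivation `∂_i = x_i ∂/∂x_i` of the field of rational functions. -/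
def theta {ι : Type} (i : ι) : Derivation ℂ (RatField ι) (RatField ι) := ratDeriv (euler i)

theorem theta_var (i j : ι) : theta i (var j) = if i = j then var j else 0 := by
  have h : euler i (laurentVar j) = if i = j then laurentVar j else 0 := by
    change eulerLin i (AddMonoidAlgebra.single (Finsupp.single j 1) 1) = _
    rw [eulerLin_single]
    by_cases hij : i = j
    · subst hij; simp [laurentVar]
    · simp [hij]
  rw [theta, var, ratDeriv_algebraMap, h]
  split_ifs <;> simp

/-- The automorphism of the field of rational functions induced by an automorphism of the lattice
of exponents. -/
def ratAut {ι : Type} (e : (ι →₀ ℤ) ≃+ (ι →₀ ℤ)) : RatField ι ≃ₐ[ℂ] RatField ι :=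
  IsFractionRing.algEquivOfAlgEquiv (AddMonoidAlgebra.domCongr ℂ ℂ e)

theorem ratAut_var {ι : Type} (e : (ι →₀ ℤ) ≃+ (ι →₀ ℤ)) (i : ι) :
    ratAut e (var i) =
      algebraMap (LaurentRing ι) (RatField ι)
        (AddMonoidAlgebra.single (e (Finsupp.single i 1)) 1) := by
  rw [ratAut, var, IsFractionRing.algEquivOfAlgEquiv_algebraMap, laurentVar]
  simp

/-- `s_{ij}^+`: the exchange of `x_i` and `x_j`. -/
def sPlus (i j : ι) : RatField ι ≃ₐ[ℂ] RatField ι :=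
  ratAut (Finsupp.domCongr (Equiv.swap i j))

/-- The change of sign of the `i`-th exponent. -/
def negExponent {ι : Type} (i : ι) : (ι →₀ ℤ) ≃+ (ι →₀ ℤ) where
  toFun m := m - Finsupp.single i (2 * m i)
  invFun m := m - Finsupp.single i (2 * m i)
  left_inv m := by
    ext j
    by_cases h : i = j
    · subst h; simp; ring
    · simp [h]
  right_inv m := by
    ext j
    by_cases h : i = j
    · subst h; simp; ring
    · simp [h]
  map_add' m m' := by
    ext j
    by_cases h : i = j
    · subst h; simp; ring
    · simp [h]

/-- `t_i`: the inversion `x_i ↦ x_i⁻¹`. -/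
def tInv {ι : Type} (i : ι) : RatField ι ≃ₐ[ℂ] RatField ι := ratAut (negExponent i)

/-- `s_{ij}^-`: the map `x_i ↦ x_j⁻¹`, `x_j ↦ x_i⁻¹` (for `i ≠ j`). -/
def sMinus (i j : ι) : RatField ι ≃ₐ[ℂ] RatField ι :=
  (sPlus i j).trans ((tInv i).trans (tInv j))

theorem sPlus_var (i j l : ι) : sPlus i j (var l) = var (Equiv.swap i j l) := by
  rw [sPlus, ratAut_var, var, laurentVar]
  simp

theorem tInv_var (i l : ι) : tInv i (var l) = if i = l then (var l)⁻¹ else var l := by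
  rw [tInv, ratAut_var]
  by_cases h : i = l
  · subst h
    rw [if_pos rfl]
    apply eq_inv_of_mul_eq_one_left
    rw [var, ← map_mul, laurentVar,
      AddMonoidAlgebra.single_mul_single]
    rw [show negExponent i (Finsupp.single i 1) + Finsupp.single i 1 = 0 by
      ext j
      by_cases h : i = j
      · subst h; simp [negExponent]
      · simp [negExponent, h]]
    rw [mul_one, ← AddMonoidAlgebra.one_def, map_one]
  · rw [if_neg h, var, laurentVar]
    rw [show negExponent i (Finsupp.single l 1) = Finsupp.single l 1 by
      simp [negExponent, Ne.symm h]]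

theorem sMinus_var_left (i j : ι) (h : i ≠ j) : sMinus i j (var i) = (var j)⁻¹ := by
  simp [sMinus, sPlus_var, tInv_var, h]

theorem sMinus_var_right (i j : ι) (h : i ≠ j) : sMinus i j (var j) = (var i)⁻¹ := by
  simp [sMinus, sPlus_var, tInv_var, h.symm]

/-- The operator of multiplication by a rational function. -/
def mulOp {ι : Type} (f : RatField ι) : Module.End ℂ (RatField ι) := LinearMap.mulLeft ℂ f

/-- `∂_i` as a linear operator. -/
def thetaOp {ι : Type} (i : ι) : Module.End ℂ (RatField ι) := (theta i).toLinearMap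

end Rational

/-! ### The `BC_N` system -/

/-- The `BC_N` Dunkl–Heckman operator `D_{i,N}`, as an operator on rational functions. -/
def dunkl (N : ℕ) (k p q : ℂ) (i : Fin N) : Module.End ℂ (RatField (Fin N)) :=
  thetaOp i
    - (k / 2) • ∑ j ∈ Finset.univ.erase i,
        (mulOp ((var i + var j) / (var i - var j)) * (1 - (sPlus i j).toLinearMap)
          + mulOp ((var i * var j + 1) / (var i * var j - 1)) * (1 - (sMinus i j).toLinearMap))
    - (p / 2) • (mulOp ((var i + 1) / (var i - 1)) * (1 - (tInv i).toLinearMap))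
    - q • (mulOp ((var i ^ 2 + 1) / (var i ^ 2 - 1)) * (1 - (tInv i).toLinearMap))

/-- The `BC_N` CMS operator `𝓗_N` in the gauged form. -/
def gaugedCMS (N : ℕ) (k p q : ℂ) : Module.End ℂ (RatField (Fin N)) :=
  ∑ i, thetaOp i ^ 2
    - k • ∑ i, ∑ j ∈ Finset.Ioi i,
        mulOp ((var i + var j) / (var i - var j)) * (thetaOp i - thetaOp j)
    - k • ∑ i, ∑ j ∈ Finset.Ioi i,
        mulOp ((var i * var j + 1) / (var i * var j - 1)) * (thetaOp i + thetaOp j)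
    - ∑ i, (p • mulOp ((var i + 1) / (var i - 1))
        + (2 * q) • mulOp ((var i ^ 2 + 1) / (var i ^ 2 - 1))) * thetaOp i

/-- `Λ_N^W`: the Laurent polynomials invariant under the Weyl group generated by
the `s_{ij}^±` and the `t_i`. -/
def invariants (N : ℕ) : Set (RatField (Fin N)) :=
  {g | g ∈ Set.range (algebraMap (LaurentRing (Fin N)) (RatField (Fin N))) ∧
    (∀ i j, i ≠ j → sPlus i j g = g ∧ sMinus i j g = g) ∧ ∀ i, tInv i g = g}

/-- Heckman's integral `𝓛_N^(2r) = ∑_i D_{i,N} ^ (2r)` (to be restricted to `Λ_N^W`). -/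
def heckman (N : ℕ) (k p q : ℂ) (r : ℕ) : Module.End ℂ (RatField (Fin N)) :=
  ∑ i, dunkl N k p q i ^ (2 * r)

/-- The homomorphism `φ_N` with `p_l ↦ ∑_i (x_i ^ l + x_i ^ (-l))`. -/
def phi (N : ℕ) : LambdaBar →ₐ[ℂ] RatField (Fin N) :=
  MvPolynomial.aeval fun l : ℕ => ∑ i : Fin N, (var i ^ l + (var i)⁻¹ ^ l)

/-- The homomorphism `φ_{i,N}` on `Λ̄[x, x⁻¹]` which extends `φ_N` by `x ↦ x_i`. -/
def phiX (N : ℕ) (i : Fin N) : LambdaBarX →+* RatField (Fin N) :=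
  LaurentPolynomial.eval₂ (phi N).toRingHom (Units.mk0 (var i) (var_ne_zero i))

/-! ### The deformed `BC_{n,m}` system -/

section Deformed

/-- The index set of the variables `x_1, …, x_n, x_{n+1} = y_1, …, x_{n+m} = y_m`. -/
abbrev Idx (n m : ℕ) : Type := Fin n ⊕ Fin m

/-- The parity function: `0` on the first `n` indices, `1` on the last `m` ones. -/
def parity {n m : ℕ} : Idx n m → ℕ := Sum.elim (fun _ => 0) (fun _ => 1)

/-- The deformed `BC_{n,m}` CMS operator `H_{n,m}` in exponential coordinates. -/
def deformedCMS (n m : ℕ) (k p q r s : ℂ) : Module.End ℂ (RatField (Idx n m)) :=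
  let x : Fin n → RatField (Idx n m) := fun i => var (Sum.inl i)
  let y : Fin m → RatField (Idx n m) := fun j => var (Sum.inr j)
  ∑ i : Fin n, thetaOp (Sum.inl i) ^ 2 + k • ∑ j : Fin m, thetaOp (Sum.inr j) ^ 2
    - (2 * k * (k + 1)) • ∑ i : Fin n, ∑ j ∈ Finset.Ioi i,
        mulOp (x i * x j / (x i - x j) ^ 2 + x i * x j / (x i * x j - 1) ^ 2)
    - (2 * (k⁻¹ + 1)) • ∑ i : Fin m, ∑ j ∈ Finset.Ioi i,
        mulOp (y i * y j / (y i - y j) ^ 2 + y i * y j / (y i * y j - 1) ^ 2)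
    - (2 * (k + 1)) • ∑ i : Fin n, ∑ j : Fin m,
        mulOp (x i * y j / (x i - y j) ^ 2 + x i * y j / (x i * y j - 1) ^ 2)
    - ∑ i : Fin n, ((p * (p + 2 * q + 1)) • mulOp (x i / (x i - 1) ^ 2)
        + (4 * q * (q + 1)) • mulOp (x i ^ 2 / (x i ^ 2 - 1) ^ 2))
    - ∑ j : Fin m, ((k * r * (r + 2 * s + 1)) • mulOp (y j / (y j - 1) ^ 2)
        + (4 * k * s * (s + 1)) • mulOp (y j ^ 2 / (y j ^ 2 - 1) ^ 2))

/-- The block `A` of the quantum Moser matrix. -/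
def moserA (n m : ℕ) (k : ℂ) : Matrix (Idx n m) (Idx n m) (Module.End ℂ (RatField (Idx n m))) :=
  Matrix.of fun i j =>
    if i = j then k ^ parity i • thetaOp i
    else (k ^ (1 - parity j) / 2) • mulOp ((var i + var j) / (var i - var j))

/-- The block `B` of the quantum Moser matrix, with the multiplicity functions
`μ = p, r` and `ν = q, s` on the two groups of indices. -/
def moserB (n m : ℕ) (k p q r s : ℂ) :
    Matrix (Idx n m) (Idx n m) (Module.End ℂ (RatField (Idx n m))) :=
  let μ : Idx n m → ℂ := Sum.elim (fun _ => p) (fun _ => r)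
  let ν : Idx n m → ℂ := Sum.elim (fun _ => q) (fun _ => s)
  Matrix.of fun i j =>
    if i = j then
      (k ^ parity i * μ i / 2) • mulOp ((var i + 1) / (var i - 1))
        + (k ^ parity i * ν i) • mulOp ((var i ^ 2 + 1) / (var i ^ 2 - 1))
    else (k ^ (1 - parity j) / 2) • mulOp ((var i * var j + 1) / (var i * var j - 1))

/-- The quantum Moser matrix, with entries in the algebra of operators on rational functions. -/
def moser (n m : ℕ) (k p q r s : ℂ) :
    Matrix (Idx n m ⊕ Idx n m) (Idx n m ⊕ Idx n m) (Module.End ℂ (RatField (Idx n m))) :=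
  Matrix.fromBlocks (moserA n m k) (moserB n m k p q r s)
    (-moserB n m k p q r s) (-moserA n m k)

/-- The row vector `e^*`: its entries are `k ^ (-p(i))` in both halves. -/
def eStar (n m : ℕ) (k : ℂ) : Idx n m ⊕ Idx n m → ℂ :=
  Sum.elim (fun i => (k ^ parity i)⁻¹) (fun i => (k ^ parity i)⁻¹)

/-- `L_{n,m}^(2l) = e^* L^(2l) e` with `e = (1, …, 1)ᵀ`. -/
def deformedIntegral (n m : ℕ) (k p q r s : ℂ) (l : ℕ) : Module.End ℂ (RatField (Idx n m)) :=
  ∑ a, ∑ b, eStar n m k a • (moser n m k p q r s ^ (2 * l)) a b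

end Deformed

end BCCMS

end

noncomputable section

namespace BCCMS

/-! ### Signed variables -/

section Signed

set_option linter.unusedSectionVars false

/-! Both halves of the theorem come from one Lax matrix. The variables and their inverses are
treated on an equal footing as "signed variables" `svar`, indexed by two copies of `ι`. The BC
system then looks like a type A system: the entries of `laxL` are multiples of `ctg a b`, and only a
pair of opposite indices carries the extra function `laxZ` with the one-particle couplings. All
weights are 1 for the ordinary system; they are 1 and `k` on the two groups of variables for the
deformed one.

Commutation with the Schrödinger operator `H`: `lax_equation` gives `[L, H] = [L, M]`, so `L`
commutes with `H - M`, and so does every power of `L`. The vector `e` is killed by `M` from the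
right and `e^*` from the left, whence `e^* L^n e` commutes with `H` (`laxIntegral_commute`). The Lax
equation itself reduces to the addition theorem `ctg_add`, the duplication formula `ctgOne_mul_ctg`,
and one arithmetic property of the weights (`IsWeight.sub`).

Commutation of the integrals with each other: in the universal connection `∂_i + λ_i`, acting on
polynomials in `λ` over the rational functions, a differential operator is recovered by normal
ordering from its full symbol, its value on 1. Deep in a Weyl chamber every coefficient has a limit,
so each integral tends to multiplication by a polynomial in `λ`, and the symbol of a commutator `P`
of two integrals vanishes at infinity. If that symbol is nonzero, it has a leading monomial `x^γ`.
Comparing leading terms in `P H = H P` gives `∑ κ_i ((λ_i + γ_i)^2 - λ_i^2) = 0`, so `γ = 0`,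
contrary to vanishing at infinity (`eq_zero_of_commute`). Normal ordering carries the result to any
connection (`laxIntegral_commute_laxIntegral`).

The deformed system is the connection `∂_i` itself: `moser_eq` identifies the Moser matrix with
`laxL`, and `deformedCMS_eq` identifies the operator with `laxH` up to an additive constant.

For the algebra at infinity, substituting each signed variable for `x` turns `D` into the
Dunkl–Heckman operators. On the vector of all specializations the same operator acts by the matrix
`laxL` over a connection gauged by the logarithmic gradient of the ground state
(`phiAt_dunklInf_eq_laxL`), because a reflection only permutes the components of this vector. Thus
`𝓛^(2r)` specializes to `e^* L^(2r) e`, and commutativity holds after every specialization. It lifts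
to `Λ̄` because the specializations for all `N` are jointly injective (`eq_zero_of_phi`), even
though each sends `p_0` to the number `2N`. The formula for `𝓛^(2)` is a direct computation with `D
f = ∑ ∂_a f (x^a - x^(-a))` for `f ∈ Λ̄`. -/

instance (ι : Type) : CharZero (RatField ι) :=
  charZero_of_injective_algebraMap (algebraMap ℂ (RatField ι)).injective

variable {ι : Type} [DecidableEq ι]

/-- The variables `x_i` and their inverses, indexed by two copies of `ι`. -/
def svar : ι ⊕ ι → RatField ι := Sum.elim var fun i => (var i)⁻¹

/-- The derivations dual to the signed variables: `∂_i` and `-∂_i`. -/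
def stheta : ι ⊕ ι → Derivation ℂ (RatField ι) (RatField ι) := Sum.elim theta fun i => -theta i

/-- The pairing of signed indices: `1` if equal, `-1` if opposite, `0` otherwise. -/
def spair (a b : ι ⊕ ι) : ℂ := if b = a then 1 else if b = a.swap then -1 else 0

theorem swap_ne (a : ι ⊕ ι) : a.swap ≠ a := by cases a <;> simp

theorem svar_swap (a : ι ⊕ ι) : svar a.swap = (svar a)⁻¹ := by
  cases a <;> simp [svar]

theorem stheta_swap (a : ι ⊕ ι) : stheta a.swap = -stheta a := by
  cases a <;> simp [stheta]

theorem svar_ne_zero (a : ι ⊕ ι) : svar a ≠ 0 := by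
  cases a <;> simp [svar, var_ne_zero]

theorem theta_inv {K : Type} [Field K] [Algebra ℂ K] (d : Derivation ℂ K K) (f : K) (c : ℂ)
    (h : d f = c • f) : d f⁻¹ = (-c) • f⁻¹ := by
  by_cases hf : f = 0
  · simp [hf]
  · rw [Derivation.leibniz_inv, h]
    simp only [smul_eq_mul, Algebra.smul_def, map_neg]
    field_simp

theorem stheta_svar (a b : ι ⊕ ι) : stheta a (svar b) = spair a b • svar b := by
  have h0 : ∀ i j : ι, theta i (var j) = (if j = i then (1 : ℂ) else 0) • var j := by
    intro i j
    rw [theta_var]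
    by_cases h : i = j
    · simp [h]
    · simp [h, Ne.symm h]
  have h1 : ∀ i j : ι, theta i (var j)⁻¹ = (-(if j = i then (1 : ℂ) else 0)) • (var j)⁻¹ :=
    fun i j => theta_inv _ _ _ (h0 i j)
  rcases a with a | a <;> rcases b with b | b <;>
    simp only [svar, stheta, spair, Sum.elim_inl, Sum.elim_inr, Derivation.neg_apply, h0, h1] <;>
    by_cases h : b = a <;> simp [h]

theorem spair_self (a : ι ⊕ ι) : spair a a = 1 := by simp [spair]

theorem spair_swap_self (a : ι ⊕ ι) : spair a a.swap = -1 := by simp [spair, swap_ne]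

theorem spair_swap_right (a b : ι ⊕ ι) : spair a b.swap = -spair a b := by
  rcases a with a | a <;> rcases b with b | b <;> by_cases h : b = a <;> simp [spair, h]

theorem spair_eq_zero {a b : ι ⊕ ι} (h : b ≠ a) (h' : b ≠ a.swap) : spair a b = 0 := by
  simp [spair, h, h']

/-- The derivation along `a` has eigenvalue 1 on `svar a` and eigenvalue 0 or -1 on every other
signed variable, so characteristic zero separates them. -/
theorem svar_injective {a b : ι ⊕ ι} (h : svar a = svar b) : a = b := by
  by_contra hab
  have h1 := congrArg (stheta a) h
  rw [stheta_svar, stheta_svar, spair_self, one_smul, h] at h1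
  have h0 := svar_ne_zero b
  unfold spair at h1
  rw [if_neg (Ne.symm hab)] at h1
  split_ifs at h1
  · have : (2 : RatField ι) * svar b = 0 := by
      rw [neg_smul, one_smul] at h1
      linear_combination h1
    simp [h0] at this
  · simp [h0] at h1

theorem svar_ne_algebraMap (a : ι ⊕ ι) (c : ℂ) : svar a ≠ algebraMap ℂ (RatField ι) c := by
  intro h
  have h1 := congrArg (stheta a) h
  rw [stheta_svar, Derivation.map_algebraMap, spair_self, one_smul] at h1
  exact svar_ne_zero a h1

theorem svar_sub_ne_zero {a b : ι ⊕ ι} (h : a ≠ b) : svar a - svar b ≠ 0 :=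
  sub_ne_zero.2 fun e => h (svar_injective e)

theorem svar_sub_one_ne_zero (a : ι ⊕ ι) : svar a - 1 ≠ 0 := by
  have := svar_ne_algebraMap a 1
  rw [map_one] at this
  exact sub_ne_zero.2 this

theorem svar_mul_sub_one_ne_zero {a b : ι ⊕ ι} (h : a ≠ b.swap) : svar a * svar b - 1 ≠ 0 := by
  have h1 := svar_sub_ne_zero h
  rw [svar_swap] at h1
  intro h2
  apply h1
  have := svar_ne_zero b
  field_simp
  rw [h2, mul_zero]

theorem svar_sq_sub_one_ne_zero (a : ι ⊕ ι) : svar a ^ 2 - 1 ≠ 0 := by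
  have := svar_mul_sub_one_ne_zero (swap_ne a).symm
  rwa [← sq] at this

/-- `(x + y) / (x - y)` for two signed variables. -/
def ctg (a b : ι ⊕ ι) : RatField ι := (svar a + svar b) / (svar a - svar b)

/-- `(x + 1) / (x - 1)` for a signed variable. -/
def ctgOne (a : ι ⊕ ι) : RatField ι := (svar a + 1) / (svar a - 1)

theorem ctg_comm (a b : ι ⊕ ι) : ctg b a = -ctg a b := by
  rw [ctg, ctg, add_comm, ← neg_sub (svar a), div_neg]

theorem ctg_swap_swap (a b : ι ⊕ ι) : ctg a.swap b.swap = -ctg a b := by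
  by_cases hab : a = b
  · simp [hab, ctg]
  have ha := svar_ne_zero a
  have hb := svar_ne_zero b
  have h := svar_sub_ne_zero hab
  have h' := svar_sub_ne_zero (Ne.symm hab)
  rw [ctg, ctg, svar_swap, svar_swap]
  rw [show (svar a)⁻¹ - (svar b)⁻¹ = (svar b - svar a) * ((svar a)⁻¹ * (svar b)⁻¹) by field_simp,
    show (svar a)⁻¹ + (svar b)⁻¹ = (svar b + svar a) * ((svar a)⁻¹ * (svar b)⁻¹) by field_simp,
    mul_div_mul_right _ _ (by positivity), ← neg_sub (svar a), div_neg, add_comm]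

theorem ctg_swap_left (a b : ι ⊕ ι) : ctg a.swap b = -ctg a b.swap := by
  rw [← ctg_swap_swap, Sum.swap_swap]

theorem ctg_swap_right_eq (a b : ι ⊕ ι) :
    ctg a b.swap = (svar a * svar b + 1) / (svar a * svar b - 1) := by
  have hb := svar_ne_zero b
  rw [ctg, svar_swap,
    show svar a - (svar b)⁻¹ = (svar a * svar b - 1) * (svar b)⁻¹ by field_simp,
    show svar a + (svar b)⁻¹ = (svar a * svar b + 1) * (svar b)⁻¹ by field_simp,
    mul_div_mul_right _ _ (inv_ne_zero hb)]

theorem ctg_swap_self (a : ι ⊕ ι) : ctg a a.swap = (svar a ^ 2 + 1) / (svar a ^ 2 - 1) := by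
  rw [ctg_swap_right_eq, sq]

theorem ctgOne_swap (a : ι ⊕ ι) : ctgOne a.swap = -ctgOne a := by
  have ha := svar_ne_zero a
  rw [ctgOne, ctgOne, svar_swap,
    show (svar a)⁻¹ - 1 = (-(svar a - 1)) * (svar a)⁻¹ by field_simp; ring,
    show (svar a)⁻¹ + 1 = (svar a + 1) * (svar a)⁻¹ by field_simp; ring,
    mul_div_mul_right _ _ (inv_ne_zero ha), div_neg]

/-- The addition theorem of the hyperbolic cotangent. -/
theorem ctg_add {a b c : ι ⊕ ι} (hab : a ≠ b) (hac : a ≠ c) (hcb : c ≠ b) :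
    ctg a b * (ctg a c + ctg c b) = ctg a c * ctg c b + 1 := by
  have h1 := svar_sub_ne_zero hab
  have h2 := svar_sub_ne_zero hac
  have h3 := svar_sub_ne_zero hcb
  rw [ctg, ctg, ctg]
  field_simp
  ring

/-- Stated for arbitrary eigenvectors so that it also covers `ctgOne`, where the second function is
1 with eigenvalue 0. -/
theorem derivation_ctg {K : Type} [Field K] [Algebra ℂ K] (d : Derivation ℂ K K) (f g : K)
    (α β : ℂ) (hf : d f = α • f) (hg : d g = β • g) (h : f - g ≠ 0) :
    d ((f + g) / (f - g)) = ((α - β) / 2) • (1 - ((f + g) / (f - g)) ^ 2) := by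
  have : CharZero K := charZero_of_injective_algebraMap (algebraMap ℂ K).injective
  have h2 : (2 : K) ≠ 0 := two_ne_zero
  rw [Derivation.leibniz_div, map_add, map_sub, hf, hg]
  simp only [smul_eq_mul, Algebra.smul_def, map_sub, map_div₀, map_ofNat]
  field_simp
  ring

theorem stheta_ctg (c : ι ⊕ ι) {a b : ι ⊕ ι} (h : a ≠ b) :
    stheta c (ctg a b) = ((spair c a - spair c b) / 2) • (1 - ctg a b ^ 2) :=
  derivation_ctg _ _ _ _ _ (stheta_svar c a) (stheta_svar c b) (svar_sub_ne_zero h)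

theorem stheta_ctgOne (c a : ι ⊕ ι) :
    stheta c (ctgOne a) = (spair c a / 2) • (1 - ctgOne a ^ 2) := by
  have := derivation_ctg (stheta c) (svar a) 1 _ 0 (stheta_svar c a) (by simp)
    (svar_sub_one_ne_zero a)
  rwa [sub_zero] at this

/-- The duplication formula of the hyperbolic cotangent. -/
theorem ctgOne_mul_ctg (a : ι ⊕ ι) : 2 * ctgOne a * ctg a a.swap = 1 + ctgOne a ^ 2 := by
  have h1 := svar_sub_one_ne_zero a
  have h2 := svar_sq_sub_one_ne_zero a
  rw [ctg_swap_self, ctgOne]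
  field_simp
  ring

/-- The commutator is again a derivation. It vanishes on Laurent polynomials, where both maps are
diagonal on monomials, and hence on quotients. -/
theorem theta_comm (i j : ι) (f : RatField ι) : theta i (theta j f) = theta j (theta i f) := by
  have h : ⁅theta (ι := ι) i, theta j⁆ = 0 := by
    ext f
    obtain ⟨a, b, hb, rfl⟩ := IsFractionRing.div_surjective (A := LaurentRing ι) f
    have h0 : ∀ a : LaurentRing ι, ⁅theta (ι := ι) i, theta j⁆ (algebraMap _ _ a) = 0 := by
      intro a
      rw [Derivation.commutator_apply, theta, theta, ratDeriv_algebraMap, ratDeriv_algebraMap,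
        ratDeriv_algebraMap, ratDeriv_algebraMap, ← map_sub]
      have : euler i (euler j a) - euler j (euler i a) = 0 := by
        change eulerLin i (eulerLin j a) - eulerLin j (eulerLin i a) = 0
        induction a using AddMonoidAlgebra.induction_linear with
        | zero => simp
        | add F G hF hG => simp only [map_add]; rw [add_sub_add_comm, hF, hG, add_zero]
        | single γ c => simp only [eulerLin_single, map_smul]; rw [smul_comm, sub_self]
      rw [this, map_zero]
    rw [Derivation.leibniz_div, h0, h0]
    simp
  have := DFunLike.congr_fun h f
  rw [Derivation.commutator_apply] at this
  exact sub_eq_zero.1 this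

end Signed

/-! ### The scalar identities behind the quantum Lax pair -/

section LaxFunctions

set_option linter.unusedSectionVars false

variable {ι : Type} [DecidableEq ι]

/-- The weight of a signed index. -/
def sweight (κ : ι → ℂ) : ι ⊕ ι → ℂ := Sum.elim κ κ

theorem sweight_swap (κ : ι → ℂ) (a : ι ⊕ ι) : sweight κ a.swap = sweight κ a := by
  cases a <;> rfl

/-- The weights take the values `1` and `k` only, and do not vanish. -/
structure IsWeight (k : ℂ) (κ : ι → ℂ) : Prop where
  eq_or : ∀ i, κ i = 1 ∨ κ i = k
  ne_zero : ∀ i, κ i ≠ 0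

theorem IsWeight.sweight_ne_zero {k : ℂ} {κ : ι → ℂ} (h : IsWeight k κ) (a : ι ⊕ ι) :
    sweight κ a ≠ 0 := by
  cases a <;> exact h.ne_zero _

/-- For nonzero weights the identity amounts to `(κ_a - κ_b)(k - κ_a κ_b) = 0`: two weights are
either equal or have product `k`. This is what makes the deformation with two groups of variables
integrable. -/
theorem IsWeight.sub {k : ℂ} {κ : ι → ℂ} (h : IsWeight k κ) (a b : ι ⊕ ι) :
    k / (2 * sweight κ b) - k / (2 * sweight κ a) = (sweight κ a - sweight κ b) / 2 := by
  have ha := h.sweight_ne_zero a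
  have hb := h.sweight_ne_zero b
  have ha' : sweight κ a = 1 ∨ sweight κ a = k := by cases a <;> exact h.eq_or _
  have hb' : sweight κ b = 1 ∨ sweight κ b = k := by cases b <;> exact h.eq_or _
  field_simp
  rcases ha' with ha' | ha' <;> rcases hb' with hb' | hb' <;> rw [ha', hb'] <;> ring

variable (k p q : ℂ) (κ : ι → ℂ)

local notation "𝔠" => algebraMap ℂ (RatField ι)

/-- The entry of the Lax matrix at a pair of opposite indices. -/
def laxZ (a : ι ⊕ ι) : RatField ι :=
  𝔠 (p / 2) * ctgOne a + 𝔠 (q + (1 - sweight κ a) / 2) * ctg a a.swap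

/-- The derivative of `laxZ`. -/
def laxZ' (a : ι ⊕ ι) : RatField ι :=
  𝔠 (p / 2) * ((1 - ctgOne a ^ 2) / 2) + 𝔠 (q + (1 - sweight κ a) / 2) * (1 - ctg a a.swap ^ 2)

/-- The functional part of the Lax matrix. -/
def laxX (a b : ι ⊕ ι) : RatField ι :=
  if b = a then 0 else if b = a.swap then laxZ p q κ a else 𝔠 (k / (2 * sweight κ b)) * ctg a b

/-- The off-diagonal entries of the second matrix of the Lax pair. -/
def laxM (a b : ι ⊕ ι) : RatField ι :=
  if b = a then 0 else if b = a.swap then -laxZ' p q κ a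
  else 𝔠 (k / (2 * sweight κ b)) * (ctg a b ^ 2 - 1)

variable {k p q κ}

theorem laxZ_swap (a : ι ⊕ ι) : laxZ p q κ a.swap = -laxZ p q κ a := by
  rw [laxZ, laxZ, ctgOne_swap, ctg_swap_swap, sweight_swap]; ring

theorem laxZ'_swap (a : ι ⊕ ι) : laxZ' p q κ a.swap = laxZ' p q κ a := by
  rw [laxZ', laxZ', ctgOne_swap, ctg_swap_swap, sweight_swap]; ring

theorem stheta_const_mul (c : ι ⊕ ι) (z : ℂ) (f : RatField ι) :
    stheta c (𝔠 z * f) = 𝔠 z * stheta c f := by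
  rw [← Algebra.smul_def, Derivation.map_smul, Algebra.smul_def]

theorem stheta_laxZ (c a : ι ⊕ ι) :
    stheta c (laxZ p q κ a) = spair c a • laxZ' p q κ a := by
  rw [laxZ, map_add, stheta_const_mul, stheta_const_mul, stheta_ctgOne,
    stheta_ctg _ (swap_ne a).symm, spair_swap_right, laxZ']
  simp only [Algebra.smul_def, map_div₀, map_ofNat, map_sub, map_neg]
  ring

theorem derivation_one_sub_sq {K : Type} [Field K] [Algebra ℂ K] (d : Derivation ℂ K K) (f : K) :
    d (1 - f ^ 2) = -(2 * f * d f) := by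
  rw [map_sub, Derivation.map_one_eq_zero, Derivation.leibniz_pow]
  simp only [smul_eq_mul, nsmul_eq_mul]
  push_cast
  ring

/-- The function depends on the single variable `svar a`, so all its derivatives are multiples of
the one along `a`. -/
theorem stheta_laxZ' (c a : ι ⊕ ι) :
    stheta c (laxZ' p q κ a) = spair c a • stheta a (laxZ' p q κ a) := by
  have h3 : ∀ d f, stheta d (f / 2) = stheta d f / (2 : RatField ι) := by
    intro d f
    have : f / 2 = (1 / 2 : ℂ) • f := by
      rw [Algebra.smul_def, map_div₀, map_one, map_ofNat]; ring
    rw [this, Derivation.map_smul, Algebra.smul_def, map_div₀, map_one, map_ofNat]; ring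
  have h4 : ∀ d, stheta d (laxZ' p q κ a) = -(𝔠 (p / 2) * (ctgOne a * stheta d (ctgOne a))
      + 𝔠 (q + (1 - sweight κ a) / 2) * (2 * ctg a a.swap * stheta d (ctg a a.swap))) := by
    intro d
    rw [laxZ', map_add, stheta_const_mul, stheta_const_mul, h3, derivation_one_sub_sq,
      derivation_one_sub_sq]
    ring
  rw [h4, h4]
  simp only [stheta_ctgOne, stheta_ctg _ (swap_ne a).symm, spair_swap_right, spair_self]
  simp only [Algebra.smul_def, map_div₀, map_ofNat, map_sub, map_neg, map_one]
  ring

theorem stheta_one_sub_sq (c : ι ⊕ ι) {a b : ι ⊕ ι} (h : a ≠ b) :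
    stheta c (1 - ctg a b ^ 2) =
      -((spair c a - spair c b) • (ctg a b * (1 - ctg a b ^ 2))) := by
  rw [derivation_one_sub_sq, stheta_ctg c h]
  simp only [Algebra.smul_def, map_div₀, map_ofNat, map_sub]
  ring

/-- The `c`-th summand of the off-diagonal entry of the commutator of the function parts. -/
def laxG (k p q : ℂ) (κ : ι → ℂ) (a b c : ι ⊕ ι) : RatField ι :=
  laxX k p q κ a c * laxM k p q κ c b - laxM k p q κ a c * laxX k p q κ c b
    + laxX k p q κ a b * (laxM k p q κ a c - laxM k p q κ b c)

theorem swap_ne_of_ne {a b : ι ⊕ ι} (h : b ≠ a.swap) : b.swap ≠ a := fun e =>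
  h (by rw [← e, Sum.swap_swap])

/-- For an intermediate index unrelated to `a` and `b` the constants factor out, and the rest is
`ctg a c - ctg c b` times the defect of the addition theorem. -/
theorem laxG_eq_zero {a b c : ι ⊕ ι} (hb : b ≠ a) (hb' : b ≠ a.swap) (hca : c ≠ a)
    (hca' : c ≠ a.swap) (hcb : c ≠ b) (hcb' : c ≠ b.swap) : laxG k p q κ a b c = 0 := by
  have hbc' : b ≠ c.swap := (swap_ne_of_ne hcb').symm
  simp only [laxG, laxX, laxM, hb, hb', hca, hca', hcb, hcb', hcb.symm, hbc', if_false]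
  have h := ctg_add hb.symm hca.symm hcb
  rw [ctg_comm c b] at *
  linear_combination (𝔠 (k / (2 * sweight κ b)) * 𝔠 (k / (2 * sweight κ c))) *
    (ctg a c - ctg c b) * h

/-- Only the diagonal of the second matrix contributes here. The remainder is proportional to the
difference of the weights, and compensates the asymmetry of the second derivatives in
`lax_off_diagonal`. -/
theorem laxG_self_add (h : IsWeight k κ) {a b : ι ⊕ ι} (hb : b ≠ a) (hb' : b ≠ a.swap) :
    laxG k p q κ a b a + laxG k p q κ a b b =
      𝔠 ((sweight κ b - sweight κ a) / 2 * (k / (2 * sweight κ b))) *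
        (ctg a b * (1 - ctg a b ^ 2)) := by
  have ha' : a ≠ b.swap := (swap_ne_of_ne hb').symm
  simp only [laxG, laxX, laxM, hb, hb', hb.symm, ha', if_false, if_true]
  have h1 := congrArg 𝔠 (h.sub a b)
  rw [ctg_comm a b]
  rw [map_sub] at h1
  rw [map_mul, ← neg_sub (sweight κ a), neg_div, map_neg]
  linear_combination (𝔠 (k / (2 * sweight κ b))) * (ctg a b ^ 3 - ctg a b) * h1

theorem ctg_swap_right_comm (a b : ι ⊕ ι) : ctg a b.swap = ctg b a.swap := by
  rw [ctg_comm, ctg_swap_left, neg_neg]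

/-- The intermediate indices opposite to `a` and to `b` bring in `laxZ`. Neither term vanishes in
general; they cancel together by the addition theorem at the triples containing an opposite pair,
the duplication formula, and `IsWeight.sub`. -/
theorem laxG_swap_add (h : IsWeight k κ) {a b : ι ⊕ ι} (hb : b ≠ a) (hb' : b ≠ a.swap) :
    laxG k p q κ a b a.swap + laxG k p q κ a b b.swap = 0 := by
  have ha' : a ≠ b.swap := (swap_ne_of_ne hb').symm
  have hab : a.swap ≠ b.swap := fun e => hb (by simpa using (congrArg Sum.swap e).symm)
  simp only [laxG, laxX, laxM, hb, hb', hb'.symm, ha'.symm, hab, hab.symm, swap_ne,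
    Sum.swap_swap, if_false, if_true, (swap_ne b).symm, laxZ_swap, laxZ'_swap, sweight_swap]
  have h1 := congrArg 𝔠 (h.sub a b)
  -- A mixed addition formula, linear in `ctgOne`; it is needed only for the terms with the coupling
  -- `p`.
  have hC : ctgOne a * (ctg a b.swap + ctg a b) + ctgOne b * (ctg a b.swap - ctg a b) = 2 := by
    rw [ctg_swap_right_eq, ctg, ctgOne, ctgOne]
    have h1 := svar_sub_ne_zero hb.symm
    have h2 := svar_mul_sub_one_ne_zero ha'
    have h3 := svar_sub_one_ne_zero a
    have h4 := svar_sub_one_ne_zero b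
    field_simp
    ring
  have hA := ctg_add (swap_ne a).symm hb.symm hb'
  have hB := ctg_add (swap_ne b).symm hb ha'
  have hDa := ctgOne_mul_ctg a
  have hDb := ctgOne_mul_ctg b
  rw [ctg_swap_left a b, ctg_swap_right_comm b a]
  rw [ctg_swap_right_comm b a] at hA
  rw [ctg_comm a b] at hB
  rw [laxZ, laxZ, laxZ', laxZ']
  rw [map_sub] at h1
  simp only [map_add, map_sub, map_one, map_div₀ _ (_ - _ : ℂ), map_ofNat] at h1 ⊢
  -- The groups are the terms with `p`, the two with the shifted coupling `q + (1 - κ)/2` at `a` and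
  -- at `b`, and finally the mismatch between these two shifts, which `h1` absorbs.
  linear_combination 𝔠 (k / (2 * sweight κ b)) * (𝔠 (p / 2) * (ctg a b.swap * hC + ctgOne a * hA
      + ctgOne b * hB - 1 / 2 * (ctg a b.swap + ctg a b) * hDa
      - 1 / 2 * (ctg a b.swap - ctg a b) * hDb)
    + (𝔠 q + (1 - 𝔠 (sweight κ a)) / 2) * (ctg a b.swap + ctg a a.swap) * hA
    + (𝔠 q + (1 - 𝔠 (sweight κ b)) / 2) * (ctg a b.swap + ctg b b.swap) * hB
    + ctg a b * (ctg a b.swap ^ 2 - 1) * h1)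

/-- The function part of the off-diagonal entries of the Lax equation, for indices that are not
opposite. -/
theorem sum_laxG [Fintype ι] (h : IsWeight k κ) {a b : ι ⊕ ι} (hb : b ≠ a) (hb' : b ≠ a.swap) :
    ∑ c, laxG k p q κ a b c =
      𝔠 ((sweight κ b - sweight κ a) / 2 * (k / (2 * sweight κ b))) *
        (ctg a b * (1 - ctg a b ^ 2)) := by
  have ha' : a ≠ b.swap := (swap_ne_of_ne hb').symm
  have hab : a.swap ≠ b.swap := fun e => hb (by simpa using (congrArg Sum.swap e).symm)
  rw [← Finset.sum_subset (Finset.subset_univ {a, b, a.swap, b.swap})]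
  · rw [Finset.sum_insert (by simp [hb.symm, ha', (swap_ne a).symm]),
      Finset.sum_insert (by simp [hb', (swap_ne b).symm]), Finset.sum_pair hab, ← add_assoc,
      laxG_self_add h hb hb', laxG_swap_add h hb hb', add_zero]
  · intro c _ hc
    simp only [Finset.mem_insert, Finset.mem_singleton, not_or] at hc
    exact laxG_eq_zero hb hb' hc.1 hc.2.2.1 hc.2.1 hc.2.2.2

/-- The function part of the entries of the Lax equation at opposite indices. -/
theorem sum_laxG_swap [Fintype ι] (a : ι ⊕ ι) : ∑ c, laxG k p q κ a a.swap c = 0 := by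
  -- The summands at opposite intermediate indices cancel, so the whole sum equals its own negative.
  have hs : ∀ c, laxG k p q κ a a.swap c.swap = -laxG k p q κ a a.swap c := by
    intro c
    by_cases h1 : c = a
    · subst h1
      simp only [laxG, laxX, laxM, Sum.swap_swap, if_true, swap_ne, (swap_ne c).symm, if_false,
        laxZ_swap, laxZ'_swap]
      ring
    by_cases h2 : c = a.swap
    · subst h2
      simp only [laxG, laxX, laxM, Sum.swap_swap, if_true, swap_ne, (swap_ne a).symm, if_false,
        laxZ_swap, laxZ'_swap]
      ring
    have h3 : a ≠ c.swap := (swap_ne_of_ne h2).symm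
    have h4 : a.swap ≠ c.swap := fun e => h1 (by simpa using (congrArg Sum.swap e).symm)
    simp only [laxG, laxX, laxM, swap_ne, Sum.swap_swap, if_true, if_false, sweight_swap, h1, h2,
      h3.symm, h4.symm, Ne.symm h2, h4, ctg_swap_left c, ctg_comm a c, ctg_swap_left a,
        ctg_swap_right_comm c a]
    ring
  have : ∑ c : ι ⊕ ι, laxG k p q κ a a.swap c.swap = ∑ c, laxG k p q κ a a.swap c :=
    Equiv.sum_comp (Equiv.sumComm ι ι) _
  rw [Finset.sum_congr rfl (g := fun c => -laxG k p q κ a a.swap c) fun c _ => hs c,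
    Finset.sum_neg_distrib] at this
  exact self_eq_neg.1 this.symm

variable (k p q κ) in
/-- The derivative of `laxM` along the difference of the two indices. -/
def laxM' (a b : ι ⊕ ι) : RatField ι :=
  if b = a then 0 else if b = a.swap then -((1 / 2 : ℂ) • stheta a (laxZ' p q κ a))
  else 𝔠 (k / (2 * sweight κ b)) * (ctg a b * (1 - ctg a b ^ 2))

/-- The reason for the choice of `laxM`: it is, up to normalization, the derivative of the function
part of `L` along the difference of the two indices. -/
theorem stheta_laxX (c a b : ι ⊕ ι) :
    stheta c (laxX k p q κ a b) = -((spair c a - spair c b) / 2) • laxM k p q κ a b := by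
  unfold laxX laxM
  split_ifs with h1 h2
  · simp
  · rw [stheta_laxZ, h2, spair_swap_right]
    rw [smul_neg, ← neg_smul]; congr 1; ring
  · rw [stheta_const_mul, stheta_ctg c (Ne.symm h1)]
    simp only [Algebra.smul_def, map_neg]
    ring

theorem stheta_laxM (c a b : ι ⊕ ι) :
    stheta c (laxM k p q κ a b) = (spair c a - spair c b) • laxM' k p q κ a b := by
  unfold laxM laxM'
  split_ifs with h1 h2
  · simp
  · rw [map_neg, stheta_laxZ', h2, spair_swap_right, smul_neg, smul_smul]; congr 2; ring
  · rw [stheta_const_mul, ← neg_sub, map_neg, stheta_one_sub_sq c (Ne.symm h1)]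
    simp only [Algebra.smul_def]
    ring

/-- This is the weighted squared length of the root attached to the pair. Indices that are neither
equal nor opposite have disjoint supports, so there is no cross term; opposite indices give a long
root, treated next. -/
theorem sum_weight_spair_sq [Fintype ι] {a b : ι ⊕ ι} (hb : b ≠ a) (hb' : b ≠ a.swap) :
    ∑ i, κ i * (spair (Sum.inl i) a - spair (Sum.inl i) b) ^ 2 = sweight κ a + sweight κ b := by
  have h1 : ∀ a : ι ⊕ ι, ∑ i, κ i * spair (Sum.inl i) a ^ 2 = sweight κ a := by
    intro a
    rcases a with a | a <;> simp [spair, sweight, apply_ite (fun z : ℂ => z ^ 2)]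
  have h2 : ∀ i, spair (Sum.inl i) a * spair (Sum.inl i) b = 0 := by
    intro i
    rcases a with a | a <;> rcases b with b | b <;> simp [spair] at * <;> aesop
  rw [← h1 a, ← h1 b, ← Finset.sum_add_distrib]
  refine Finset.sum_congr rfl fun i _ => ?_
  linear_combination (-2 * κ i) * h2 i

theorem sum_weight_spair_sq_swap [Fintype ι] (a : ι ⊕ ι) :
    ∑ i, κ i * (spair (Sum.inl i) a - spair (Sum.inl i) a.swap) ^ 2 = 4 * sweight κ a := by
  have h1 : ∑ i, κ i * spair (Sum.inl i) a ^ 2 = sweight κ a := by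
    rcases a with a | a <;> simp [spair, sweight, apply_ite (fun z : ℂ => z ^ 2)]
  rw [← h1, Finset.mul_sum]
  refine Finset.sum_congr rfl fun i _ => ?_
  rw [spair_swap_right]; ring

/-- The function part of the Lax equation off the diagonal. -/
theorem lax_off_diagonal [Fintype ι] (h : IsWeight k κ) {a b : ι ⊕ ι} (hb : b ≠ a) :
    𝔠 ((∑ i, κ i * (spair (Sum.inl i) a - spair (Sum.inl i) b) ^ 2) / 2) * laxM' k p q κ a b =
      𝔠 (sweight κ a) * stheta a (laxM k p q κ a b) + ∑ c, laxG k p q κ a b c := by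
  by_cases hb' : b = a.swap
  · subst hb'
    rw [sum_laxG_swap, sum_weight_spair_sq_swap, stheta_laxM, spair_swap_right, spair_self,
      Algebra.smul_def]
    simp only [map_div₀, map_mul, map_ofNat, sub_neg_eq_add, map_add, map_one]
    ring
  · rw [sum_laxG h hb hb', sum_weight_spair_sq hb hb', stheta_laxM, spair_self,
      spair_eq_zero hb hb', laxM', if_neg hb, if_neg hb', Algebra.smul_def]
    simp only [map_div₀, map_mul, map_ofNat, map_sub, map_add, map_one, map_zero]
    ring

/-! ### The potentials and the diagonal of the Lax equation -/

variable (k p q κ) in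
/-- The pair potential of two signed variables. -/
def laxW (a c : ι ⊕ ι) : RatField ι :=
  if c = a then 0 else if c = a.swap then 0
  else 𝔠 (k / (2 * sweight κ c) * (1 + k / sweight κ a ^ 2)) * (ctg a c ^ 2 - 1)

variable (p q κ) in
/-- The external potential of a signed variable. -/
def laxS (a : ι ⊕ ι) : RatField ι :=
  𝔠 (sweight κ a)⁻¹ * laxZ p q κ a ^ 2 - laxZ' p q κ a

variable (k p q κ) in
/-- The potential of the Schrödinger operator. -/
def laxV [Fintype ι] : RatField ι :=
  𝔠 (1 / 4) * ∑ a, ∑ c, laxW k κ a c + 𝔠 (1 / 2) * ∑ a, laxS p q κ a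

theorem laxW_swap_swap (a c : ι ⊕ ι) : laxW k κ a.swap c.swap = laxW k κ a c := by
  have e1 : c.swap = a.swap ↔ c =
      a := ⟨fun e => by simpa using congrArg Sum.swap e, fun e => by rw [e]⟩
  have e2 : c.swap = a ↔ c = a.swap :=
    ⟨fun e => by rw [← e, Sum.swap_swap], fun e => by rw [e, Sum.swap_swap]⟩
  simp only [laxW, e1, Sum.swap_swap, e2, sweight_swap, ctg_swap_swap, neg_sq]

/-- The coefficient looks asymmetric in the two weights; it is symmetric because two weights are
equal or multiply to `k`, as in `IsWeight.sub`. -/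
theorem laxW_comm (h : IsWeight k κ) (a c : ι ⊕ ι) : laxW k κ c a = laxW k κ a c := by
  have e2 : a = c.swap ↔ c = a.swap :=
    ⟨fun e => by rw [e, Sum.swap_swap], fun e => by rw [e, Sum.swap_swap]⟩
  simp only [laxW, @eq_comm _ a c, e2, ctg_comm a c, neg_sq]
  have h1 : k / (2 * sweight κ a) * (1 + k / sweight κ c ^ 2) =
      k / (2 * sweight κ c) * (1 + k / sweight κ a ^ 2) := by
    have ha := h.sweight_ne_zero a
    have hc := h.sweight_ne_zero c
    have ha' : sweight κ a = 1 ∨ sweight κ a = k := by cases a <;> exact h.eq_or _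
    have hc' : sweight κ c = 1 ∨ sweight κ c = k := by cases c <;> exact h.eq_or _
    field_simp
    rcases ha' with ha' | ha' <;> rcases hc' with hc' | hc' <;> rw [ha', hc'] <;> ring
  rw [h1]

theorem laxS_swap (a : ι ⊕ ι) : laxS p q κ a.swap = laxS p q κ a := by
  rw [laxS, laxS, laxZ_swap, laxZ'_swap, sweight_swap, neg_sq]

theorem stheta_laxW (c a b : ι ⊕ ι) : ∃ g, stheta c (laxW k κ a b) =
    (spair c a - spair c b) • g := by
  unfold laxW
  split_ifs with h1 h2
  · exact ⟨0, by simp⟩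
  · exact ⟨0, by simp⟩
  · rw [stheta_const_mul, ← neg_sub, map_neg, stheta_one_sub_sq c (Ne.symm h1)]
    exact ⟨𝔠 (k / (2 * sweight κ b) * (1 + k / sweight κ a ^ 2)) *
      (ctg a b * (1 - ctg a b ^ 2)), by simp only [Algebra.smul_def]; ring⟩

theorem stheta_laxS (c a : ι ⊕ ι) :
    stheta c (laxS p q κ a) = spair c a • stheta a (laxS p q κ a) := by
  have h4 : ∀ d, stheta d (laxS p q κ a) = 𝔠 (sweight κ a)⁻¹ *
      (2 * laxZ p q κ a * stheta d (laxZ p q κ a)) - stheta d (laxZ' p q κ a) := by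
    intro d
    rw [laxS, map_sub, stheta_const_mul, Derivation.leibniz_pow]
    simp only [smul_eq_mul, nsmul_eq_mul]
    push_cast
    ring
  rw [h4, h4, stheta_laxZ, stheta_laxZ, stheta_laxZ', spair_self]
  simp only [Algebra.smul_def, map_one]
  ring

/-- Only the rows and columns of `l` and of its opposite depend on this variable. By the symmetries
of `laxW` these four lines contribute equally, and their intersections are zero, which cancels the
factor 1/4; likewise the two equal terms of `laxS` cancel the factor 1/2. -/
theorem stheta_laxV [Fintype ι] (h : IsWeight k κ) (l : ι ⊕ ι) :
    stheta l (laxV k p q κ) = ∑ c, stheta l (laxW k κ l c) + stheta l (laxS p q κ l) := by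
  have hS : ∑ a, stheta l (laxS p q κ a) = 2 * stheta l (laxS p q κ l) := by
    rw [← Finset.sum_subset (Finset.subset_univ {l, l.swap}), Finset.sum_pair (swap_ne l).symm,
      laxS_swap]
    · ring
    · intro c _ hc
      simp only [Finset.mem_insert, Finset.mem_singleton, not_or] at hc
      rw [stheta_laxS, spair_eq_zero hc.1 hc.2, zero_smul]
  have h0 : ∀ a c, a ≠ l → a ≠ l.swap → c ≠ l → c ≠ l.swap → stheta l (laxW k κ a c) = 0 := by
    intro a c h1 h2 h3 h4
    obtain ⟨g, hg⟩ := stheta_laxW (k := k) (κ := κ) l a c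
    rw [hg, spair_eq_zero h1 h2, spair_eq_zero h3 h4, sub_zero, zero_smul]
  have hlc : ∀ c, laxW k κ l.swap c = laxW k κ l c.swap := by
    intro c
    rw [← laxW_swap_swap, Sum.swap_swap]
  have hrow : ∑ c, laxW k κ l.swap c = ∑ c, laxW k κ l c := by
    simp only [hlc]
    exact Equiv.sum_comp (Equiv.sumComm ι ι) (laxW k κ l)
  have hll : laxW k κ l l = 0 := by simp [laxW]
  have hll' : laxW k κ l l.swap = 0 := by simp [laxW]
  have hcol : ∀ a, a ≠ l → a ≠ l.swap → ∑ c, stheta l (laxW k κ a c) =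
      stheta l (laxW k κ l a) + stheta l (laxW k κ l a.swap) := by
    intro a h1 h2
    rw [← Finset.sum_subset (Finset.subset_univ {l, l.swap}), Finset.sum_pair (swap_ne l).symm,
      laxW_comm h l a, laxW_comm h l.swap a, hlc]
    intro c _ hc
    simp only [Finset.mem_insert, Finset.mem_singleton, not_or] at hc
    exact h0 _ _ h1 h2 hc.1 hc.2
  have hW : ∑ a, ∑ c, stheta l (laxW k κ a c) = 4 * ∑ c, stheta l (laxW k κ l c) := by
    have hsw : ∑ a : ι ⊕ ι, stheta l (laxW k κ l a.swap) = ∑ a, stheta l (laxW k κ l a) :=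
      Equiv.sum_comp (Equiv.sumComm ι ι) fun a => stheta l (laxW k κ l a)
    have h5 : ∀ a, ∑ c, stheta l (laxW k κ a c) =
        stheta l (laxW k κ l a) + stheta l (laxW k κ l a.swap)
        + ((if a = l then ∑ c, stheta l (laxW k κ l c) else 0)
        + (if a = l.swap then ∑ c, stheta l (laxW k κ l c) else 0)) := by
      intro a
      by_cases h1 : a = l
      · subst h1
        rw [hll, hll', if_pos rfl, if_neg (swap_ne a).symm]; simp
      by_cases h2 : a = l.swap
      · subst h2
        rw [Sum.swap_swap, hll, hll', if_neg (swap_ne l), if_pos rfl, ← map_sum, hrow]; simp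
      rw [hcol a h1 h2, if_neg h1, if_neg h2]; simp
    rw [Finset.sum_congr rfl fun a _ => h5 a]
    simp only [Finset.sum_add_distrib, hsw, Finset.sum_ite_eq', Finset.mem_univ, if_true]
    ring
  rw [laxV, map_add, stheta_const_mul, stheta_const_mul, map_sum, map_sum, hS]
  simp only [map_sum, hW]
  simp only [map_div₀, map_one, map_ofNat]
  ring

/-- The function part of the Lax equation on the diagonal. -/
theorem lax_diagonal [Fintype ι] (h : IsWeight k κ) (a : ι ⊕ ι) :
    ∑ c, (laxX k p q κ a c * laxM k p q κ c a - laxM k p q κ a c * laxX k p q κ c a)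
      - 𝔠 (sweight κ a) * ∑ c, stheta a (laxM k p q κ a c) =
      -(𝔠 (sweight κ a) * stheta a (laxV k p q κ)) := by
  have hk := h.sweight_ne_zero a
  -- The diagonal identity holds summand by summand: a generic `c` produces the pair force, the
  -- index opposite to `a` produces the external force.
  have e : ∀ c, laxX k p q κ a c * laxM k p q κ c a - laxM k p q κ a c * laxX k p q κ c a
      - 𝔠 (sweight κ a) * stheta a (laxM k p q κ a c) =
      -(𝔠 (sweight κ a) * (stheta a (laxW k κ a c)
        + if c = a.swap then stheta a (laxS p q κ a) else 0)) := by
    intro c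
    by_cases h1 : c = a
    · subst h1; simp [laxX, laxM, laxW, (swap_ne c).symm]
    by_cases h2 : c = a.swap
    · subst h2
      have hS : stheta a (laxS p q κ a) = 𝔠 (sweight κ a)⁻¹ *
          (2 * laxZ p q κ a * laxZ' p q κ a) - stheta a (laxZ' p q κ a) := by
        rw [laxS, map_sub, stheta_const_mul, Derivation.leibniz_pow, stheta_laxZ, spair_self,
          one_smul]
        simp only [smul_eq_mul, nsmul_eq_mul]
        push_cast
        ring
      have hkk : 𝔠 (sweight κ a) * 𝔠 (sweight κ a)⁻¹ = 1 := by
        rw [← map_mul, mul_inv_cancel₀ hk, map_one]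
      rw [if_pos rfl, hS]
      simp only [laxX, laxM, laxW, if_neg (swap_ne a), if_neg (swap_ne a).symm, if_true,
        Sum.swap_swap, laxZ_swap, laxZ'_swap, map_neg, map_zero]
      linear_combination (2 * laxZ p q κ a * laxZ' p q κ a) * hkk
    · have h2' : a ≠ c.swap := (swap_ne_of_ne h2).symm
      have hX := stheta_one_sub_sq a (Ne.symm h1)
      rw [spair_self, spair_eq_zero h1 h2, sub_zero, one_smul] at hX
      simp only [laxX, laxM, laxW, if_neg h1, if_neg (Ne.symm h1), if_neg h2, if_neg h2']
      rw [stheta_const_mul, stheta_const_mul, ← neg_sub 1 (ctg a c ^ 2), map_neg, hX, ctg_comm a c]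
      have hkk : 𝔠 (sweight κ a) * 𝔠 (sweight κ a)⁻¹ = 1 := by
        rw [← map_mul, mul_inv_cancel₀ hk, map_one]
      have hka : 𝔠 (sweight κ a) ≠ 0 := by simpa using hk
      simp only [map_mul, map_div₀, map_add, map_pow, map_one, map_ofNat]
      field_simp
      ring
  rw [stheta_laxV h, Finset.mul_sum, ← Finset.sum_sub_distrib, Finset.sum_congr rfl fun c _ => e c,
    Finset.sum_neg_distrib, ← Finset.mul_sum, Finset.sum_add_distrib, Finset.sum_ite_eq',
    if_pos (Finset.mem_univ _)]

end LaxFunctions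

/-! ### The quantum Lax pair -/

section LaxPair

set_option linter.unusedSectionVars false

variable {ι : Type} [DecidableEq ι] {R : Type} [Ring R] [Algebra ℂ R]

/-- Operators `D i` which commute with each other and satisfy the Leibniz rule with respect to a
representation `m` of the rational functions. -/
structure IsConnection (m : RatField ι →ₐ[ℂ] R) (D : ι → R) : Prop where
  comm : ∀ i j, D i * D j = D j * D i
  leibniz : ∀ i f, D i * m f = m f * D i + m (theta i f)

/-- The operators attached to signed indices. -/
def signedOp (D : ι → R) : ι ⊕ ι → R := Sum.elim D fun i => -D i

theorem IsConnection.signed_leibniz {m : RatField ι →ₐ[ℂ] R} {D : ι → R} (hD : IsConnection m D)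
    (a : ι ⊕ ι) (f : RatField ι) :
    signedOp D a * m f = m f * signedOp D a + m (stheta a f) := by
  rcases a with a | a
  · exact hD.leibniz a f
  · simp [signedOp, stheta, hD.leibniz]; abel

variable (m : RatField ι →ₐ[ℂ] R) (D : ι → R) (k p q : ℂ) (κ : ι → ℂ)

/-- The first matrix of the Lax pair. -/
def laxL : Matrix (ι ⊕ ι) (ι ⊕ ι) R := Matrix.of fun a b =>
  (if a = b then sweight κ a • signedOp D a else 0) + m (laxX k p q κ a b)

variable [Fintype ι]

/-- The second matrix of the Lax pair. -/
def laxMat : Matrix (ι ⊕ ι) (ι ⊕ ι) R := Matrix.of fun a b =>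
  m (laxM k p q κ a b) - if a = b then ∑ c, m (laxM k p q κ a c) else 0

/-- The Schrödinger operator. -/
def laxH : R := ∑ i, κ i • D i ^ 2 - m (laxV k p q κ)

/-- The integrals `e^* L ^ n e`. -/
def laxIntegral (n : ℕ) : R := ∑ a, ∑ b, (sweight κ a)⁻¹ • (laxL m D k p q κ ^ n) a b

variable {m D k p q κ}

theorem IsConnection.commutator_sq (hD : IsConnection m D) (i : ι) (f : RatField ι) :
    m f * D i ^ 2 - D i ^ 2 * m f = -(2 * m (theta i f) * D i + m (theta i (theta i f))) := by
  rw [sq, mul_assoc (D i), hD.leibniz, mul_add, ← mul_assoc (D i), hD.leibniz, hD.leibniz]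
  noncomm_ring

theorem signedOp_comm (hD : IsConnection m D) (a : ι ⊕ ι) (i : ι) :
    signedOp D a * D i = D i * signedOp D a := by
  rcases a with a | a <;> simp [signedOp, hD.comm a i]

theorem sum_weight_spair (a : ι ⊕ ι) :
    ∑ i, (κ i * spair (Sum.inl i) a) • D i = sweight κ a • signedOp D a := by
  rcases a with a | a <;> simp [spair, sweight, signedOp, ite_smul]

/-- The potential commutes with functions, so only the kinetic term acts. Its first order part is
exactly that of `[L, M]`, computed in `commutator_laxMat`; hence the Lax equation becomes a set of
identities between functions. -/
theorem laxX_commutator (hD : IsConnection m D) (a b : ι ⊕ ι) :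
    m (laxX k p q κ a b) * laxH m D k p q κ - laxH m D k p q κ * m (laxX k p q κ a b) =
      m (laxM k p q κ a b) * (sweight κ a • signedOp D a - sweight κ b • signedOp D b)
      + m (algebraMap ℂ _ ((∑ i, κ i * (spair (Sum.inl i) a - spair (Sum.inl i) b) ^ 2) / 2) *
          laxM' k p q κ a b) := by
  have h1 : ∀ i, theta i (laxX k p q κ a b) =
      -((spair (Sum.inl i) a - spair (Sum.inl i) b) / 2) • laxM k p q κ a b :=
    fun i => stheta_laxX (Sum.inl i) a b
  have h2 : ∀ i, theta i (laxM k p q κ a b) =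
      (spair (Sum.inl i) a - spair (Sum.inl i) b) • laxM' k p q κ a b :=
    fun i => stheta_laxM (Sum.inl i) a b
  have h3 : m (laxX k p q κ a b) * m (laxV k p q κ) = m (laxV k p q κ) * m (laxX k p q κ a b) := by
    rw [← map_mul, mul_comm, map_mul]
  have h4 : ∀ i, m (laxX k p q κ a b) * (κ i • D i ^ 2) - (κ i • D i ^ 2) * m (laxX k p q κ a b) =
      m (laxM k p q κ a b) *
        ((κ i * spair (Sum.inl i) a) • D i - (κ i * spair (Sum.inl i) b) • D i)
      + (κ i * (spair (Sum.inl i) a - spair (Sum.inl i) b) ^ 2) • (1 / 2 : ℂ) •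
        m (laxM' k p q κ a b) := by
    intro i
    rw [mul_smul_comm, smul_mul_assoc, ← smul_sub, hD.commutator_sq, h1, Derivation.map_smul, h2,
      ← sub_smul, mul_smul_comm, map_smul, map_smul, map_smul, two_mul]
    simp only [add_mul, smul_mul_assoc]
    module
  rw [laxH, mul_sub, sub_mul, h3, sub_sub_sub_cancel_right, Finset.mul_sum, Finset.sum_mul,
    ← Finset.sum_sub_distrib, Finset.sum_congr rfl fun i _ => h4 i, Finset.sum_add_distrib,
    ← Finset.mul_sum, Finset.sum_sub_distrib, sum_weight_spair, sum_weight_spair, ← Finset.sum_smul,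
    ← Algebra.smul_def, map_smul, smul_smul]
  congr 2
  ring

theorem signedOp_commutator (hD : IsConnection m D) (a : ι ⊕ ι) :
    signedOp D a * laxH m D k p q κ - laxH m D k p q κ * signedOp D a =
      -m (stheta a (laxV k p q κ)) := by
  have h : signedOp D a * ∑ i, κ i • D i ^ 2 = (∑ i, κ i • D i ^ 2) * signedOp D a := by
    rw [Finset.mul_sum, Finset.sum_mul]
    refine Finset.sum_congr rfl fun i _ => ?_
    rw [mul_smul_comm, smul_mul_assoc, sq, ← mul_assoc, signedOp_comm hD, mul_assoc,
      signedOp_comm hD, mul_assoc]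
  rw [laxH, mul_sub, sub_mul, h, hD.signed_leibniz]
  noncomm_ring

theorem commutator_laxMat (hD : IsConnection m D) (a b : ι ⊕ ι) :
    (laxL m D k p q κ * laxMat m k p q κ - laxMat m k p q κ * laxL m D k p q κ) a b =
      m (laxM k p q κ a b) * (sweight κ a • signedOp D a - sweight κ b • signedOp D b)
      + sweight κ a • m (stheta a (laxM k p q κ a b))
      - (if a = b then sweight κ a • ∑ c, m (stheta a (laxM k p q κ a c)) else 0)
      + m (∑ c, (laxX k p q κ a c * laxM k p q κ c b - laxM k p q κ a c * laxX k p q κ c b)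
        + laxX k p q κ a b * (∑ c, laxM k p q κ a c - ∑ c, laxM k p q κ b c)) := by
  have e1 : (laxL m D k p q κ * laxMat m k p q κ) a b =
      (sweight κ a • signedOp D a) * m (laxM k p q κ a b)
      - (if a = b then (sweight κ a • signedOp D a) * ∑ c, m (laxM k p q κ a c) else 0)
      + m (∑ c, laxX k p q κ a c * laxM k p q κ c b
        - laxX k p q κ a b * ∑ c, laxM k p q κ b c) := by
    rw [Matrix.mul_apply]
    simp only [laxL, laxMat, Matrix.of_apply, add_mul, mul_sub, Finset.sum_add_distrib,
      Finset.sum_sub_distrib, ite_mul, zero_mul, mul_ite, mul_zero, Finset.sum_ite_eq,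
      Finset.sum_ite_eq', Finset.mem_univ, if_true, map_sub, map_sum, map_mul]
    by_cases hab : a = b
    · subst hab; simp; abel
    · simp [hab]; abel
  have e2 : (laxMat m k p q κ * laxL m D k p q κ) a b =
      m (laxM k p q κ a b) * (sweight κ b • signedOp D b)
      - (if a = b then (∑ c, m (laxM k p q κ a c)) * (sweight κ a • signedOp D a) else 0)
      + m (∑ c, laxM k p q κ a c * laxX k p q κ c b
        - laxX k p q κ a b * ∑ c, laxM k p q κ a c) := by
    rw [Matrix.mul_apply]
    simp only [laxL, laxMat, Matrix.of_apply, mul_add, sub_mul, Finset.sum_add_distrib,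
      Finset.sum_sub_distrib, ite_mul, zero_mul, mul_ite, mul_zero, Finset.sum_ite_eq,
      Finset.sum_ite_eq', Finset.mem_univ, if_true, map_sub, map_sum, map_mul]
    have hc : (∑ c, m (laxM k p q κ a c)) * m (laxX k p q κ a b) =
        m (laxX k p q κ a b) * ∑ c, m (laxM k p q κ a c) := by
      rw [← map_sum, ← map_mul, mul_comm, map_mul]
    rw [hc]
    by_cases hab : a = b
    · subst hab; simp
    · simp [hab]
  have hs : ∀ f : RatField ι, signedOp D a * m f = m f * signedOp D a + m (stheta a f) :=
    hD.signed_leibniz a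
  rw [Matrix.sub_apply, e1, e2]
  by_cases hab : a = b
  · subst hab
    simp only [if_true, ← map_sum, smul_mul_assoc, mul_smul_comm, hs, mul_sub,
      Finset.sum_sub_distrib, map_sub, map_add, smul_add]
    abel
  · simp only [if_neg hab, smul_mul_assoc, mul_smul_comm, hs, mul_sub,
      Finset.sum_sub_distrib, map_sub, map_add, smul_add]
    abel

/-- The Lax equation `[L, H] = [L, M]`. -/
theorem lax_equation (h : IsWeight k κ) (hD : IsConnection m D) :
    laxL m D k p q κ * Matrix.scalar (ι ⊕ ι) (laxH m D k p q κ)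
      - Matrix.scalar (ι ⊕ ι) (laxH m D k p q κ) * laxL m D k p q κ =
    laxL m D k p q κ * laxMat m k p q κ - laxMat m k p q κ * laxL m D k p q κ := by
  ext a b
  rw [commutator_laxMat hD]
  have e : (laxL m D k p q κ * Matrix.scalar (ι ⊕ ι) (laxH m D k p q κ)
      - Matrix.scalar (ι ⊕ ι) (laxH m D k p q κ) * laxL m D k p q κ) a b =
      (if a = b then -(sweight κ a • m (stheta a (laxV k p q κ))) else 0)
      + (m (laxM k p q κ a b) * (sweight κ a • signedOp D a - sweight κ b • signedOp D b)
      + m (algebraMap ℂ _ ((∑ i, κ i * (spair (Sum.inl i) a - spair (Sum.inl i) b) ^ 2) / 2) *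
          laxM' k p q κ a b)) := by
    rw [Matrix.sub_apply, Matrix.scalar_apply, Matrix.mul_diagonal, Matrix.diagonal_mul,
      ← laxX_commutator hD, ← smul_neg, ← signedOp_commutator hD]
    simp only [laxL, Matrix.of_apply]
    split_ifs
    · simp only [add_mul, mul_add, smul_mul_assoc, mul_smul_comm, smul_sub]; abel
    · simp
  rw [e]
  by_cases hab : a = b
  · subst hab
    have h0 : laxM k p q κ a a = 0 := by simp [laxM]
    have h0' : laxM' k p q κ a a = 0 := by simp [laxM']
    have := congrArg m (lax_diagonal (p := p) (q := q) h a)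
    simp only [← Algebra.smul_def, map_sub, map_neg, map_smul] at this
    simp only [if_true, h0, h0', sub_self, mul_zero, add_zero, map_zero, smul_zero,
      zero_sub, ← map_sum]
    rw [← this, map_sum (stheta a)]; abel
  · have := congrArg m (lax_off_diagonal (p := p) (q := q) h (Ne.symm hab))
    rw [if_neg hab, if_neg hab, this, ← Algebra.smul_def, map_add, map_smul, zero_add, sub_zero,
      add_assoc]
    congr 4
    simp only [laxG, Finset.sum_add_distrib, Finset.mul_sum, mul_sub, Finset.sum_sub_distrib]

theorem laxMat_row_sum (a : ι ⊕ ι) : ∑ b, laxMat m k p q κ a b = 0 := by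
  simp [laxMat]

/-- Dividing row `a` by its weight makes the off-diagonal part of `M` symmetric, so the weighted
column sums reduce to row sums, which vanish by the choice of the diagonal. -/
theorem laxMat_column_sum (b : ι ⊕ ι) :
    ∑ a, (sweight κ a)⁻¹ • laxMat m k p q κ a b = 0 := by
  have hs : ∀ a, (sweight κ a)⁻¹ • laxM k p q κ a b = (sweight κ b)⁻¹ • laxM k p q κ b a := by
    intro a
    have e2 : a = b.swap ↔ b = a.swap :=
      ⟨fun e => by rw [e, Sum.swap_swap], fun e => by rw [e, Sum.swap_swap]⟩
    simp only [laxM, @eq_comm _ a b, e2]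
    split_ifs with h1 h2
    · simp
    · rw [h2, sweight_swap, laxZ'_swap]
    · rw [ctg_comm a b, neg_sq, ← Algebra.smul_def, ← Algebra.smul_def, smul_smul, smul_smul]
      congr 1
      rw [div_eq_mul_inv, div_eq_mul_inv, mul_inv, mul_inv]
      ring
  simp only [laxMat, Matrix.of_apply, smul_sub, smul_ite, smul_zero, Finset.sum_sub_distrib,
    ← map_smul, hs, Finset.sum_ite_eq', Finset.mem_univ, if_true, ← map_sum, Finset.smul_sum,
    sub_self]

theorem laxIntegral_commute (h : IsWeight k κ) (hD : IsConnection m D) (n : ℕ) :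
    laxIntegral m D k p q κ n * laxH m D k p q κ =
      laxH m D k p q κ * laxIntegral m D k p q κ n := by
  set L := laxL m D k p q κ with hL
  set M := laxMat m k p q κ with hM
  set H := laxH m D k p q κ with hH
  -- The Lax equation rewritten as a commutation relation, which passes to powers of `L` without
  -- induction.
  have hc : Commute L (Matrix.scalar _ H - M) := by
    rw [Commute, SemiconjBy, mul_sub, sub_mul, sub_eq_sub_iff_sub_eq_sub]
    exact lax_equation h hD
  have hn : L ^ n * Matrix.scalar _ H - Matrix.scalar _ H * L ^ n = L ^ n * M - M * L ^ n := by
    have := (hc.pow_left n).eq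
    rwa [mul_sub, sub_mul, sub_eq_sub_iff_sub_eq_sub] at this
  have key : ∑ a, ∑ b, (sweight κ a)⁻¹ • (L ^ n * M - M * L ^ n) a b = 0 := by
    simp only [Matrix.sub_apply, smul_sub, Finset.sum_sub_distrib]
    have h1 : ∀ a, ∑ b, (sweight κ a)⁻¹ • (L ^ n * M) a b = 0 := by
      intro a
      rw [← Finset.smul_sum]
      simp only [Matrix.mul_apply]
      rw [Finset.sum_comm]
      simp only [← Finset.mul_sum, hM, laxMat_row_sum, mul_zero, Finset.sum_const_zero, smul_zero]
    have h2 : ∀ b, ∑ a, (sweight κ a)⁻¹ • (M * L ^ n) a b = 0 := by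
      intro b
      simp only [Matrix.mul_apply, Finset.smul_sum]
      rw [Finset.sum_comm]
      simp only [← smul_mul_assoc, ← Finset.sum_mul, hM, laxMat_column_sum, zero_mul,
        Finset.sum_const_zero]
    rw [Finset.sum_congr rfl fun a _ => h1 a, Finset.sum_comm, Finset.sum_congr rfl fun a _ => h2 a]
    simp
  rw [← hn] at key
  simp only [Matrix.sub_apply, Matrix.scalar_apply, Matrix.mul_diagonal, Matrix.diagonal_mul,
    smul_sub, Finset.sum_sub_distrib] at key
  simp only [laxIntegral, Finset.sum_mul, Finset.mul_sum, smul_mul_assoc, mul_smul_comm]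
  exact sub_eq_zero.1 key

end LaxPair

/-! ### Functoriality of the integrals and normal ordering -/

section Normal

set_option linter.unusedSectionVars false

variable {ι : Type} [DecidableEq ι] [Fintype ι] {R R' : Type} [Ring R] [Algebra ℂ R] [Ring R']
  [Algebra ℂ R']

/-- Properties of operators that cut out a subalgebra need to be checked only on the matrix entries.
Both the compatibility with normal ordering and the existence of a limit at infinity are obtained
this way. -/
theorem laxIntegral_mem (S : Subalgebra ℂ R) (m : RatField ι →ₐ[ℂ] R) (D : ι → R) (k p q : ℂ)
    (κ : ι → ℂ) (hm : ∀ a b, m (laxX k p q κ a b) ∈ S) (hD : ∀ i, D i ∈ S) (n : ℕ) :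
    laxIntegral m D k p q κ n ∈ S := by
  have hs : ∀ a, signedOp D a ∈ S := by
    rintro (a | a)
    · exact hD a
    · exact neg_mem (hD a)
  have hL : laxL m D k p q κ ∈ S.matrix (n := ι ⊕ ι) := by
    intro a b
    simp only [laxL, Matrix.of_apply]
    refine add_mem ?_ (hm a b)
    split_ifs
    · exact S.smul_mem (hs a) _
    · exact S.zero_mem
  have hn : laxL m D k p q κ ^ n ∈ S.matrix (n := ι ⊕ ι) := pow_mem hL n
  exact sum_mem fun a _ => sum_mem fun b _ => S.smul_mem (hn a b) _

theorem map_laxIntegral (f : R →ₐ[ℂ] R') (m : RatField ι →ₐ[ℂ] R) (D : ι → R) (k p q : ℂ)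
    (κ : ι → ℂ) (n : ℕ) :
    f (laxIntegral m D k p q κ n) = laxIntegral (f.comp m) (fun i => f (D i)) k p q κ n := by
  have hs : ∀ a, f (signedOp D a) = signedOp (fun i => f (D i)) a := by
    rintro (a | a) <;> simp [signedOp]
  have hL : f.mapMatrix (laxL m D k p q κ) = laxL (f.comp m) (fun i => f (D i)) k p q κ := by
    ext a b
    simp only [AlgHom.mapMatrix_apply, Matrix.map_apply, laxL, Matrix.of_apply, map_add,
      AlgHom.comp_apply, apply_ite f, map_smul, map_zero, hs]
  rw [laxIntegral, laxIntegral, ← hL, ← map_pow]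
  simp [map_sum]

variable {m : RatField ι →ₐ[ℂ] R} {D : ι → R}

/-- Evaluation of constant coefficient polynomials at the operators of a connection. -/
def IsConnection.eval (hD : IsConnection m D) : MvPolynomial ι ℂ →ₐ[ℂ] R :=
  -- `R` is not commutative, so polynomials are evaluated inside the commutative subalgebra
  -- generated by the `D i`.
  letI : CommRing (Algebra.adjoin ℂ (Set.range D)) :=
    { (Algebra.adjoin ℂ (Set.range D)).toRing with
      mul_comm := (Algebra.isMulCommutative_adjoin ℂ (by
        rintro _ ⟨i, rfl⟩ _ ⟨j, rfl⟩; exact hD.comm i j)).is_comm.comm }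
  (Algebra.adjoin ℂ (Set.range D)).val.comp
    (MvPolynomial.aeval fun i => ⟨D i, Algebra.subset_adjoin ⟨i, rfl⟩⟩)

theorem IsConnection.eval_mem (hD : IsConnection m D) (S : Subalgebra ℂ R) (hS : ∀ i, D i ∈ S)
    (u : MvPolynomial ι ℂ) : hD.eval u ∈ S := by
  have : Algebra.adjoin ℂ (Set.range D) ≤ S :=
    Algebra.adjoin_le (by rintro _ ⟨i, rfl⟩; exact hS i)
  exact this (Subtype.property _)

theorem IsConnection.eval_X (hD : IsConnection m D) (i : ι) :
    hD.eval (MvPolynomial.X i) = D i := by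
  simp [IsConnection.eval]

/-- Normal ordering: the linear map with `f λ ^ β ↦ m f * D ^ β`. -/
def IsConnection.normal (hD : IsConnection m D) : MvPolynomial ι (RatField ι) →ₗ[ℂ] R :=
  (Finsupp.lsum ℂ fun β : ι →₀ ℕ =>
    (LinearMap.mulRight ℂ (hD.eval (MvPolynomial.monomial β 1))).comp m.toLinearMap).comp
    (AddMonoidAlgebra.coeffLinearEquiv ℂ).toLinearMap

theorem IsConnection.normal_monomial (hD : IsConnection m D) (β : ι →₀ ℕ) (f : RatField ι) :
    hD.normal (MvPolynomial.monomial β f) = m f * hD.eval (MvPolynomial.monomial β 1) := by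
  have h : AddMonoidAlgebra.coeffLinearEquiv ℂ
      (MvPolynomial.monomial β f : MvPolynomial ι (RatField ι)) =
      (Finsupp.single β f : (ι →₀ ℕ) →₀ RatField ι) := rfl
  rw [IsConnection.normal, LinearMap.comp_apply, LinearEquiv.coe_coe]
  erw [h]
  rw [Finsupp.lsum_single]
  rfl

theorem IsConnection.normal_one (hD : IsConnection m D) : hD.normal 1 = 1 := by
  have := hD.normal_monomial 0 1
  simpa using this

theorem IsConnection.normal_C_mul (hD : IsConnection m D) (f : RatField ι)
    (u : MvPolynomial ι (RatField ι)) : hD.normal (MvPolynomial.C f * u) = m f * hD.normal u := by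
  induction u using MvPolynomial.induction_on' with
  | monomial β g => rw [MvPolynomial.C_mul_monomial, hD.normal_monomial, hD.normal_monomial,
      map_mul, mul_assoc]
  | add u v hu hv => rw [mul_add, map_add, hu, hv, map_add, mul_add]

theorem IsConnection.normal_mem (hD : IsConnection m D) (S : Subalgebra ℂ R) (hS : ∀ i, D i ∈ S)
    (u : MvPolynomial ι (RatField ι)) (hu : ∀ β, m (u.coeff β) ∈ S) : hD.normal u ∈ S := by
  rw [u.as_sum, map_sum]
  refine sum_mem fun β _ => ?_
  rw [hD.normal_monomial]
  exact mul_mem (hu β) (hD.eval_mem S hS _)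

/-! ### The universal connection -/

/-- The derivation `∂_i` applied to the coefficients of a polynomial. -/
def coeffDeriv (i : ι) : Module.End ℂ (MvPolynomial ι (RatField ι)) :=
  (AddMonoidAlgebra.coeffLinearEquiv ℂ).symm.toLinearMap ∘ₗ
    Finsupp.mapRange.linearMap (theta i).toLinearMap ∘ₗ
      (AddMonoidAlgebra.coeffLinearEquiv ℂ).toLinearMap

theorem coeff_coeffDeriv (i : ι) (u : MvPolynomial ι (RatField ι)) (β : ι →₀ ℕ) :
    (coeffDeriv i u).coeff β = theta i (u.coeff β) := rfl

theorem coeffDeriv_monomial (i : ι) (β : ι →₀ ℕ) (f : RatField ι) :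
    coeffDeriv i (MvPolynomial.monomial β f) = MvPolynomial.monomial β (theta i f) := by
  ext δ
  rw [coeff_coeffDeriv, MvPolynomial.coeff_monomial, MvPolynomial.coeff_monomial]
  split_ifs <;> simp

theorem coeffDeriv_mul (i : ι) (u v : MvPolynomial ι (RatField ι)) :
    coeffDeriv i (u * v) = coeffDeriv i u * v + u * coeffDeriv i v := by
  ext β
  simp only [coeff_coeffDeriv, MvPolynomial.coeff_add, MvPolynomial.coeff_mul, map_sum,
    Derivation.leibniz, smul_eq_mul, ← Finset.sum_add_distrib]
  refine Finset.sum_congr rfl fun x _ => ?_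
  ring

theorem coeffDeriv_map (i : ι) (v : MvPolynomial ι ℂ) :
    coeffDeriv i (MvPolynomial.map (algebraMap ℂ (RatField ι)) v) = 0 := by
  ext β
  rw [coeff_coeffDeriv, MvPolynomial.coeff_map, Derivation.map_algebraMap, MvPolynomial.coeff_zero]

theorem coeffDeriv_X (i j : ι) : coeffDeriv i (MvPolynomial.X j) = 0 := by
  have := coeffDeriv_map i (MvPolynomial.X j)
  rwa [MvPolynomial.map_X] at this

theorem coeffDeriv_C (i : ι) (f : RatField ι) :
    coeffDeriv i (MvPolynomial.C f) = MvPolynomial.C (theta i f) := coeffDeriv_monomial i 0 f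

/-- The operator `∂_i + λ_i` on polynomials in the spectral variables `λ`. -/
def univD (i : ι) : Module.End ℂ (MvPolynomial ι (RatField ι)) :=
  coeffDeriv i + LinearMap.mulLeft ℂ (MvPolynomial.X i)

theorem univD_apply (i : ι) (u : MvPolynomial ι (RatField ι)) :
    univD i u = coeffDeriv i u + MvPolynomial.X i * u := rfl

variable (ι) in
/-- Multiplication by rational functions on polynomials in the spectral variables. -/
def univM : RatField ι →ₐ[ℂ] Module.End ℂ (MvPolynomial ι (RatField ι)) :=
  (Algebra.lmul ℂ (MvPolynomial ι (RatField ι))).comp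
    (IsScalarTower.toAlgHom ℂ (RatField ι) (MvPolynomial ι (RatField ι)))

theorem univM_apply (f : RatField ι) (u : MvPolynomial ι (RatField ι)) :
    univM ι f u = MvPolynomial.C f * u := rfl

variable (ι) in
theorem isConnection_univ : IsConnection (univM ι) univD where
  comm i j := by
    refine LinearMap.ext fun u => ?_
    simp only [Module.End.mul_apply, univD_apply, map_add, coeffDeriv_mul, coeffDeriv_X]
    have : coeffDeriv i (coeffDeriv j u) = coeffDeriv j (coeffDeriv i u) := by
      ext β
      simp only [coeff_coeffDeriv, theta_comm i j]
    rw [this]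
    ring
  leibniz i f := by
    refine LinearMap.ext fun u => ?_
    simp only [Module.End.mul_apply, univD_apply, univM_apply, LinearMap.add_apply, coeffDeriv_mul,
      coeffDeriv_C]
    ring

/-- Moving `D i` to the right past a coefficient differentiates it or leaves an extra factor `D i`;
on symbols this is precisely `∂_i + λ_i`. -/
theorem IsConnection.normal_univD (hD : IsConnection m D) (i : ι)
    (u : MvPolynomial ι (RatField ι)) : hD.normal (univD i u) = D i * hD.normal u := by
  induction u using MvPolynomial.induction_on' with
  | monomial β g =>
    rw [univD_apply, coeffDeriv_monomial, map_add, hD.normal_monomial, MvPolynomial.X,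
      MvPolynomial.monomial_mul, one_mul, hD.normal_monomial, hD.normal_monomial, ← mul_assoc,
      hD.leibniz]
    have : (MvPolynomial.monomial (Finsupp.single i 1 + β) 1 : MvPolynomial ι ℂ) =
        MvPolynomial.X i * MvPolynomial.monomial β 1 := by
      rw [MvPolynomial.X, MvPolynomial.monomial_mul, one_mul]
    rw [this, map_mul, hD.eval_X, add_mul, add_comm, mul_assoc]
  | add u v hu hv => rw [map_add, map_add, hu, hv, map_add, mul_add]

/-- The pairs of operators which are intertwined by normal ordering. -/
def IsConnection.intertwined (hD : IsConnection m D) :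
    Subalgebra ℂ (Module.End ℂ (MvPolynomial ι (RatField ι)) × R) where
  carrier := {P | ∀ u, hD.normal (P.1 u) = P.2 * hD.normal u}
  mul_mem' {P Q} hP hQ u := by
    change hD.normal (P.1 (Q.1 u)) = P.2 * Q.2 * _
    rw [hP, hQ, mul_assoc]
  add_mem' {P Q} hP hQ u := by
    change hD.normal (P.1 u + Q.1 u) = (P.2 + Q.2) * _
    rw [map_add, hP, hQ, add_mul]
  algebraMap_mem' c u := by
    change hD.normal (algebraMap ℂ (Module.End ℂ _) c u) = algebraMap ℂ R c * _
    rw [Module.algebraMap_end_apply, map_smul, Algebra.smul_def]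

/-- The integral is formed once in the product of the two operator algebras, over the paired
connection; it lies in the subalgebra `intertwined` and projects to both integrals. At `u = 1` this
says that an integral is the normal ordering of its universal symbol. -/
theorem IsConnection.normal_laxIntegral (hD : IsConnection m D) (k p q : ℂ) (κ : ι → ℂ) (n : ℕ)
    (u : MvPolynomial ι (RatField ι)) :
    hD.normal (laxIntegral (univM ι) univD k p q κ n u) =
      laxIntegral m D k p q κ n * hD.normal u := by
  have h := laxIntegral_mem hD.intertwined ((univM ι).prod m) (fun i => (univD i, D i)) k p q κ
    (fun a b u => hD.normal_C_mul _ u) (fun i u => hD.normal_univD i u) n u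
  have h1 : (laxIntegral ((univM ι).prod m) (fun i => (univD i, D i)) k p q κ n).1 =
      laxIntegral (univM ι) univD k p q κ n := by
    have := map_laxIntegral (AlgHom.fst ℂ (Module.End ℂ (MvPolynomial ι (RatField ι))) R)
      ((univM ι).prod m) (fun i => (univD i, D i)) k p q κ n
    rwa [AlgHom.fst_prod] at this
  have h2 : (laxIntegral ((univM ι).prod m) (fun i => (univD i, D i)) k p q κ n).2 =
      laxIntegral m D k p q κ n := by
    have := map_laxIntegral (AlgHom.snd ℂ (Module.End ℂ (MvPolynomial ι (RatField ι))) R)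
      ((univM ι).prod m) (fun i => (univD i, D i)) k p q κ n
    rwa [AlgHom.snd_prod] at this
  rw [h1, h2] at h
  exact h

end Normal

/-! ### Expansion at infinity in a Weyl chamber -/

section Asymptotics

set_option linter.unusedSectionVars false

variable {ι : Type} [DecidableEq ι] [Fintype ι]

/-- A total order on the lattice of exponents. -/
def lexExp (γ : ι →₀ ℤ) : Lex (Fin (Fintype.card ι) →₀ ℤ) :=
  toLex (Finsupp.domCongr (M := ℤ) (Fintype.equivFin ι) γ)

theorem lexExp_add (γ δ : ι →₀ ℤ) : lexExp (γ + δ) = lexExp γ + lexExp δ := by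
  rw [lexExp, map_add]; rfl

theorem lexExp_zero : lexExp (0 : ι →₀ ℤ) = 0 := by
  rw [lexExp, map_zero]; rfl

theorem lexExp_neg (γ : ι →₀ ℤ) : lexExp (-γ) = -lexExp γ := by
  rw [lexExp, map_neg]; rfl

theorem lexExp_injective : Function.Injective (lexExp (ι := ι)) :=
  toLex.injective.comp (Finsupp.domCongr (M := ℤ) (Fintype.equivFin ι)).injective

variable (ι) in
/-- Laurent polynomials all of whose exponents are positive. -/
def positivePart : Submodule ℂ (LaurentRing ι) where
  carrier := {a | ∀ γ, a.coeff γ ≠ 0 → 0 < lexExp γ}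
  zero_mem' γ h := by simp at h
  add_mem' {a b} ha hb γ h := by
    by_cases h1 : a.coeff γ = 0
    · refine hb γ fun h2 => h ?_
      simp [h1, h2]
    · exact ha γ h1
  smul_mem' c a ha γ h := ha γ fun h1 => h (by simp [h1])

theorem mul_mem_positivePart {a b : LaurentRing ι} (ha : a ∈ positivePart ι)
    (hb : b ∈ positivePart ι) : a * b ∈ positivePart ι := by
  intro γ h
  rw [AddMonoidAlgebra.coeff_mul] at h
  obtain ⟨γ₁, h1, h⟩ := Finset.exists_ne_zero_of_sum_ne_zero h
  obtain ⟨γ₂, h2, h⟩ := Finset.exists_ne_zero_of_sum_ne_zero h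
  have e : γ₁ + γ₂ = γ := by
    by_contra e
    simp [e] at h
  rw [← e, lexExp_add]
  exact add_pos (ha γ₁ (Finsupp.mem_support_iff.1 h1)) (hb γ₂ (Finsupp.mem_support_iff.1 h2))

theorem coeff_euler (i : ι) (a : LaurentRing ι) (γ : ι →₀ ℤ) :
    (euler i a).coeff γ = (γ i : ℂ) * a.coeff γ := by
  change (eulerLin i a).coeff γ = _
  induction a using AddMonoidAlgebra.induction_linear with
  | zero => simp
  | add F G hF hG => rw [map_add, AddMonoidAlgebra.coeff_add, Finsupp.add_apply, hF, hG]; simp; ring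
  | single δ c =>
    rw [eulerLin_single]
    by_cases h : δ = γ
    · subst h; simp
    · simp [h]

theorem euler_mem_positivePart (i : ι) {a : LaurentRing ι} (ha : a ∈ positivePart ι) :
    euler i a ∈ positivePart ι := fun γ h =>
  ha γ fun h1 => h (by rw [coeff_euler, h1, mul_zero])

theorem coeff_zero_of_mem_positivePart {a : LaurentRing ι} (ha : a ∈ positivePart ι) :
    a.coeff 0 = 0 := by
  by_contra h
  have := ha 0 h
  rw [lexExp_zero] at this
  exact lt_irrefl _ this

theorem one_add_ne_zero {a : LaurentRing ι} (ha : a ∈ positivePart ι) :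
    1 + algebraMap _ (RatField ι) a ≠ 0 := by
  rw [← map_one (algebraMap (LaurentRing ι) (RatField ι)), ← map_add]
  intro h
  have h1 := (IsFractionRing.to_map_eq_zero_iff (K := RatField ι)).1 h
  have h2 := congrArg (fun a : LaurentRing ι => a.coeff 0) h1
  simp [coeff_zero_of_mem_positivePart ha, AddMonoidAlgebra.one_def] at h2

theorem algebraMap_laurent_smul (c : ℂ) (a : LaurentRing ι) :
    algebraMap _ (RatField ι) (c • a) = c • algebraMap _ (RatField ι) a := by
  rw [Algebra.smul_def, map_mul, ← IsScalarTower.algebraMap_apply, ← Algebra.smul_def]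

variable (ι) in
/-- The rational functions which vanish at infinity. -/
def infinitesimal : Submodule ℂ (RatField ι) where
  carrier := {f | ∃ a ∈ positivePart ι, ∃ b ∈ positivePart ι,
    f * (1 + algebraMap _ (RatField ι) b) = algebraMap _ (RatField ι) a}
  zero_mem' := ⟨0, zero_mem _, 0, zero_mem _, by simp⟩
  add_mem' := by
    rintro f g ⟨a, ha, b, hb, h⟩ ⟨a', ha', b', hb', h'⟩
    refine ⟨a + a * b' + (a' + a' * b), add_mem (add_mem ha (mul_mem_positivePart ha hb'))
      (add_mem ha' (mul_mem_positivePart ha' hb)), b + b' + b * b',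
      add_mem (add_mem hb hb') (mul_mem_positivePart hb hb'), ?_⟩
    simp only [map_add, map_mul]
    linear_combination (1 + algebraMap _ (RatField ι) b') * h
      + (1 + algebraMap _ (RatField ι) b) * h'
  smul_mem' := by
    rintro c f ⟨a, ha, b, hb, h⟩
    refine ⟨c • a, Submodule.smul_mem _ _ ha, b, hb, ?_⟩
    rw [smul_mul_assoc, h, algebraMap_laurent_smul]

theorem mul_mem_infinitesimal {f g : RatField ι} (hf : f ∈ infinitesimal ι)
    (hg : g ∈ infinitesimal ι) : f * g ∈ infinitesimal ι := by
  obtain ⟨a, ha, b, hb, h⟩ := hf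
  obtain ⟨a', ha', b', hb', h'⟩ := hg
  refine ⟨a * a', mul_mem_positivePart ha ha', b + b' + b * b',
    add_mem (add_mem hb hb') (mul_mem_positivePart hb hb'), ?_⟩
  simp only [map_add, map_mul]
  rw [← h, ← h']
  ring

theorem theta_mem_infinitesimal (i : ι) {f : RatField ι} (hf : f ∈ infinitesimal ι) :
    theta i f ∈ infinitesimal ι := by
  obtain ⟨a, ha, b, hb, h⟩ := hf
  -- The quotient rule: the denominator becomes `(1 + b)^2`, whose constant term is again 1.
  refine ⟨euler i a + (euler i a * b - a * euler i b),
    add_mem (euler_mem_positivePart i ha) (sub_mem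
      (mul_mem_positivePart (euler_mem_positivePart i ha) hb)
      (mul_mem_positivePart ha (euler_mem_positivePart i hb))),
    b + b + b * b, add_mem (add_mem hb hb) (mul_mem_positivePart hb hb), ?_⟩
  have hd := congrArg (theta i) h
  rw [Derivation.leibniz, map_add, Derivation.map_one_eq_zero, theta, ratDeriv_algebraMap,
    ratDeriv_algebraMap] at hd
  rw [theta]
  simp only [map_add, map_mul, map_sub, smul_eq_mul] at hd ⊢
  linear_combination (1 + algebraMap _ (RatField ι) b) * hd
    - algebraMap _ (RatField ι) (euler i b) * h

/-- Uniqueness of limits: after clearing the denominator, compare the coefficients at exponent 0. -/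
theorem algebraMap_mem_infinitesimal {c : ℂ} (h : algebraMap ℂ (RatField ι) c ∈ infinitesimal ι) :
    c = 0 := by
  obtain ⟨a, ha, b, hb, h⟩ := h
  have h1 : algebraMap ℂ (LaurentRing ι) c * (1 + b) = a := by
    apply IsFractionRing.injective (LaurentRing ι) (RatField ι)
    rw [map_mul, map_add, map_one, ← h, ← IsScalarTower.algebraMap_apply]
  have h2 := congrArg (fun a : LaurentRing ι => a.coeff 0) h1
  rw [← Algebra.smul_def] at h2
  simpa [coeff_zero_of_mem_positivePart ha, coeff_zero_of_mem_positivePart hb,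
    AddMonoidAlgebra.one_def] using h2

/-! ### Leading monomials and limits -/

/-- A Laurent monomial. -/
def mono (γ : ι →₀ ℤ) : RatField ι := algebraMap (LaurentRing ι) _ (AddMonoidAlgebra.single γ 1)

theorem mono_add (γ δ : ι →₀ ℤ) : mono (γ + δ) = mono γ * mono δ := by
  rw [mono, mono, mono, ← map_mul, AddMonoidAlgebra.single_mul_single, mul_one]

theorem mono_zero : mono (0 : ι →₀ ℤ) = 1 := by
  rw [mono, ← AddMonoidAlgebra.one_def, map_one]

theorem mono_mul_neg (γ : ι →₀ ℤ) : mono γ * mono (-γ) = 1 := by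
  rw [← mono_add, add_neg_cancel, mono_zero]

theorem mono_ne_zero (γ : ι →₀ ℤ) : mono γ ≠ 0 := left_ne_zero_of_mul_eq_one (mono_mul_neg γ)

theorem mono_neg (γ : ι →₀ ℤ) : mono (-γ) = (mono γ)⁻¹ :=
  eq_inv_of_mul_eq_one_right (mono_mul_neg γ)

theorem theta_mono (i : ι) (γ : ι →₀ ℤ) : theta i (mono γ) = (γ i : ℂ) • mono γ := by
  rw [theta, mono, ratDeriv_algebraMap]
  change algebraMap _ _ (eulerLin i _) = _
  rw [eulerLin_single, algebraMap_laurent_smul]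

theorem single_mem_positivePart {γ : ι →₀ ℤ} (h : 0 < lexExp γ) :
    (AddMonoidAlgebra.single γ 1 : LaurentRing ι) ∈ positivePart ι := by
  intro δ hδ
  by_cases e : γ = δ
  · rwa [← e]
  · simp [e] at hδ

theorem mono_mem_infinitesimal {γ : ι →₀ ℤ} (h : 0 < lexExp γ) : mono γ ∈ infinitesimal ι :=
  ⟨_, single_mem_positivePart h, 0, zero_mem _, by simp [mono]⟩

/-- Factor out the term whose exponent is least in the total order; all other exponents become
positive. -/
theorem exists_leading_laurent {a : LaurentRing ι} (ha : a ≠ 0) : ∃ γ : ι →₀ ℤ, ∃ c : ℂ, c ≠ 0 ∧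
    ∃ b ∈ positivePart ι, a = AddMonoidAlgebra.single γ c * (1 + b) := by
  have hs : a.coeff.support.Nonempty := by
    rw [Finsupp.support_nonempty_iff]
    intro h
    exact ha (AddMonoidAlgebra.ext h)
  obtain ⟨γ, hγ, hmin⟩ := Finset.exists_min_image _ lexExp hs
  have hc := Finsupp.mem_support_iff.1 hγ
  refine ⟨γ, a.coeff γ, hc, AddMonoidAlgebra.single (-γ) (a.coeff γ)⁻¹ * a - 1, ?_, ?_⟩
  · intro δ hδ
    have e : (AddMonoidAlgebra.single (-γ) (a.coeff γ)⁻¹ * a : LaurentRing ι).coeff δ =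
        (a.coeff γ)⁻¹ * a.coeff (γ + δ) :=
      AddMonoidAlgebra.coeff_single_mul_eq_mul_coeff _ fun m _ => by
        rw [neg_add_eq_iff_eq_add]
    rw [AddMonoidAlgebra.coeff_sub, Finsupp.sub_apply, e, AddMonoidAlgebra.one_def,
      AddMonoidAlgebra.coeff_single] at hδ
    by_cases h0 : δ = 0
    · subst h0
      simp [hc] at hδ
    · rw [Finsupp.single_eq_of_ne h0, sub_zero] at hδ
      have h1 := hmin _ (Finsupp.mem_support_iff.2 (right_ne_zero_of_mul hδ))
      rw [lexExp_add, le_add_iff_nonneg_right] at h1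
      refine lt_of_le_of_ne h1 fun h2 => h0 (lexExp_injective ?_)
      rw [← h2, lexExp_zero]
  · rw [add_sub_cancel, ← mul_assoc, AddMonoidAlgebra.single_mul_single, mul_inv_cancel₀ hc,
      add_neg_cancel, ← AddMonoidAlgebra.one_def, one_mul]

theorem exists_leading {f : RatField ι} (hf : f ≠ 0) : ∃ γ : ι →₀ ℤ, ∃ c : ℂ, c ≠ 0 ∧
    ∃ ε ∈ infinitesimal ι, f = mono γ * (algebraMap ℂ _ c + ε) := by
  obtain ⟨a, b, hb, rfl⟩ := IsFractionRing.div_surjective (A := LaurentRing ι) f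
  have ha : a ≠ 0 := by rintro rfl; simp at hf
  obtain ⟨γ, c, hc, a', ha', rfl⟩ := exists_leading_laurent ha
  obtain ⟨δ, d, hd, b', hb', rfl⟩ := exists_leading_laurent (nonZeroDivisors.ne_zero hb)
  have h1 := one_add_ne_zero hb'
  have hs : ∀ (γ : ι →₀ ℤ) (c : ℂ), algebraMap _ (RatField ι) (AddMonoidAlgebra.single γ c) =
      algebraMap ℂ _ c * mono γ := by
    intro γ c
    rw [mono, ← Algebra.smul_def, ← algebraMap_laurent_smul, AddMonoidAlgebra.smul_single,
      smul_eq_mul,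
      mul_one]
  -- The remainder comes from `(1 + a')/(1 + b') = 1 + (a' - b')/(1 + b')`.
  refine ⟨γ + -δ, c / d, div_ne_zero hc hd, (c / d) • ((algebraMap _ (RatField ι) (a' - b'))
    / (1 + algebraMap _ (RatField ι) b')), Submodule.smul_mem _ _
    ⟨a' - b', sub_mem ha' hb', b', hb', div_mul_cancel₀ _ h1⟩, ?_⟩
  have hd' : algebraMap ℂ (RatField ι) d ≠ 0 := by simpa using hd
  have hm := mono_ne_zero δ
  rw [mono_add, mono_neg, Algebra.smul_def]
  simp only [map_mul, map_add, map_one, hs, map_sub, map_div₀]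
  field_simp
  ring

variable (ι) in
/-- The rational functions which have a limit at infinity. -/
def regular : Subalgebra ℂ (RatField ι) where
  carrier := {f | ∃ c : ℂ, f - algebraMap ℂ _ c ∈ infinitesimal ι}
  mul_mem' := by
    rintro f g ⟨c, hc⟩ ⟨d, hd⟩
    refine ⟨c * d, ?_⟩
    have h := add_mem (add_mem (mul_mem_infinitesimal hc hd)
      (Submodule.smul_mem (infinitesimal ι) c hd)) (Submodule.smul_mem (infinitesimal ι) d hc)
    convert h using 1
    simp only [Algebra.smul_def, map_mul]
    ring
  add_mem' := by
    rintro f g ⟨c, hc⟩ ⟨d, hd⟩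
    refine ⟨c + d, ?_⟩
    rw [map_add, add_sub_add_comm]
    exact add_mem hc hd
  algebraMap_mem' c := ⟨c, by simp⟩

theorem mem_regular_of_infinitesimal {f : RatField ι} (hf : f ∈ infinitesimal ι) :
    f ∈ regular ι := ⟨0, by simpa using hf⟩

theorem regular_mul_infinitesimal {f g : RatField ι} (hf : f ∈ regular ι)
    (hg : g ∈ infinitesimal ι) : f * g ∈ infinitesimal ι := by
  obtain ⟨c, hc⟩ := hf
  have h := add_mem (mul_mem_infinitesimal hc hg) (Submodule.smul_mem (infinitesimal ι) c hg)
  rw [Algebra.smul_def, sub_mul, sub_add_cancel] at h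
  exact h

/-- `(z + 1) / (z - 1)` has a limit at infinity for a nontrivial monomial `z`. -/
theorem mono_ctg_mem_regular {γ : ι →₀ ℤ} (h : γ ≠ 0) :
    (mono γ + 1) / (mono γ - 1) ∈ regular ι := by
  have key : ∀ γ : ι →₀ ℤ, 0 < lexExp γ → (mono γ + 1) / (mono γ - 1) ∈ regular ι := by
    intro γ h
    have hp := single_mem_positivePart h
    have h1 : mono γ - 1 ≠ 0 := by
      have := one_add_ne_zero (neg_mem hp)
      rw [map_neg] at this
      intro h2
      apply this
      change 1 + -mono γ = 0
      linear_combination -h2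
    -- A monomial with positive exponent tends to 0, so the limit is -1, with error `-2z/(1 - z)`.
    refine ⟨-1, (-2 : ℂ) • AddMonoidAlgebra.single γ 1, Submodule.smul_mem _ _ hp,
      -AddMonoidAlgebra.single γ 1, neg_mem hp, ?_⟩
    rw [algebraMap_laurent_smul, Algebra.smul_def]
    simp only [map_neg, map_one, map_ofNat]
    change ((mono γ + 1) / (mono γ - 1) - -1) * (1 + -mono γ) = -2 * mono γ
    field_simp
    ring
  have h0 : lexExp γ ≠ 0 := fun e => h (lexExp_injective (by rw [e, lexExp_zero]))
  rcases lt_or_gt_of_ne h0 with h1 | h1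
  · have h2 := key (-γ) (by rw [lexExp_neg]; exact neg_pos.2 h1)
    rw [mono_neg] at h2
    have hm := mono_ne_zero γ
    have e : ((mono γ)⁻¹ + 1) / ((mono γ)⁻¹ - 1) = -((mono γ + 1) / (mono γ - 1)) := by
      rw [show (mono γ)⁻¹ + 1 = (mono γ + 1) * (mono γ)⁻¹ by field_simp; ring,
        show (mono γ)⁻¹ - 1 = -(mono γ - 1) * (mono γ)⁻¹ by field_simp; ring,
        mul_div_mul_right _ _ (inv_ne_zero hm), div_neg]
    rw [e] at h2
    simpa using neg_mem h2
  · exact key γ h1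

end Asymptotics

/-! ### Commutativity of the integrals -/

section Commutativity

set_option linter.unusedSectionVars false

variable {ι : Type} [DecidableEq ι] [Fintype ι]

/-- The exponent of a signed variable. -/
def svarExp : ι ⊕ ι → (ι →₀ ℤ) :=
  Sum.elim (fun i => Finsupp.single i 1) fun i => -Finsupp.single i 1

theorem svar_eq_mono (a : ι ⊕ ι) : svar a = mono (svarExp a) := by
  rcases a with i | i
  · rfl
  · simp only [svar, svarExp, Sum.elim_inr, mono_neg]; rfl

theorem svarExp_ne_zero (a : ι ⊕ ι) : svarExp a ≠ 0 := by
  rcases a with i | i <;> simp [svarExp]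

theorem ctg_mem_regular (a b : ι ⊕ ι) : ctg a b ∈ regular ι := by
  by_cases hab : a = b
  · subst hab
    simp [ctg]
  have h : svarExp a + -svarExp b ≠ 0 := by
    intro h
    apply hab
    apply svar_injective
    rw [svar_eq_mono, svar_eq_mono, add_neg_eq_zero.1 h]
  have hr := mono_ctg_mem_regular h
  rw [mono_add, mono_neg, ← svar_eq_mono, ← svar_eq_mono] at hr
  have hb := svar_ne_zero b
  rwa [show svar a * (svar b)⁻¹ + 1 = (svar a + svar b) * (svar b)⁻¹ by field_simp,
    show svar a * (svar b)⁻¹ - 1 = (svar a - svar b) * (svar b)⁻¹ by field_simp,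
    mul_div_mul_right _ _ (inv_ne_zero hb)] at hr

theorem ctgOne_mem_regular (a : ι ⊕ ι) : ctgOne a ∈ regular ι := by
  rw [ctgOne, svar_eq_mono]
  exact mono_ctg_mem_regular (svarExp_ne_zero a)

theorem half_mem_regular {f : RatField ι} (hf : f ∈ regular ι) : f / 2 ∈ regular ι := by
  have := Subalgebra.smul_mem (regular ι) hf (1 / 2 : ℂ)
  rw [Algebra.smul_def, map_div₀, map_one, map_ofNat] at this
  rwa [div_eq_mul_inv, mul_comm, ← one_div]

theorem laxZ_mem_regular (p q : ℂ) (κ : ι → ℂ) (a : ι ⊕ ι) : laxZ p q κ a ∈ regular ι :=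
  add_mem (mul_mem (algebraMap_mem _ _) (ctgOne_mem_regular a))
    (mul_mem (algebraMap_mem _ _) (ctg_mem_regular _ _))

theorem laxZ'_mem_regular (p q : ℂ) (κ : ι → ℂ) (a : ι ⊕ ι) : laxZ' p q κ a ∈ regular ι :=
  add_mem (mul_mem (algebraMap_mem _ _)
      (half_mem_regular (sub_mem (one_mem _) (pow_mem (ctgOne_mem_regular a) 2))))
    (mul_mem (algebraMap_mem _ _) (sub_mem (one_mem _) (pow_mem (ctg_mem_regular _ _) 2)))

theorem laxX_mem_regular (k p q : ℂ) (κ : ι → ℂ) (a b : ι ⊕ ι) :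
    laxX k p q κ a b ∈ regular ι := by
  unfold laxX
  split_ifs
  · exact zero_mem _
  · exact laxZ_mem_regular p q κ a
  · exact mul_mem (algebraMap_mem _ _) (ctg_mem_regular _ _)

theorem laxV_mem_regular (k p q : ℂ) (κ : ι → ℂ) : laxV k p q κ ∈ regular ι := by
  refine add_mem (mul_mem (algebraMap_mem _ _) (sum_mem fun a _ => sum_mem fun c _ => ?_))
    (mul_mem (algebraMap_mem _ _) (sum_mem fun a _ => ?_))
  · unfold laxW
    split_ifs
    · exact zero_mem _
    · exact zero_mem _
    · exact mul_mem (algebraMap_mem _ _) (sub_mem (pow_mem (ctg_mem_regular _ _) 2) (one_mem _))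
  · exact sub_mem (mul_mem (algebraMap_mem _ _) (pow_mem (laxZ_mem_regular p q κ a) 2))
      (laxZ'_mem_regular p q κ a)

local notation "KL" => MvPolynomial ι (RatField ι)
local notation "const" => MvPolynomial.map (σ := ι) (algebraMap ℂ (RatField ι))

/-! ### Limits of operators on polynomials in the spectral variables -/

variable (ι) in
/-- The polynomials in the spectral variables whose coefficients vanish at infinity. -/
def infPoly : Submodule ℂ (MvPolynomial ι (RatField ι)) where
  carrier := {u | ∀ β, u.coeff β ∈ infinitesimal ι}
  zero_mem' β := by rw [MvPolynomial.coeff_zero]; exact zero_mem _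
  add_mem' hu hv β := by rw [MvPolynomial.coeff_add]; exact add_mem (hu β) (hv β)
  smul_mem' c u hu β := by
    rw [MvPolynomial.coeff_smul]; exact Submodule.smul_mem _ _ (hu β)

theorem C_mul_mem_infPoly {f : RatField ι} (hf : f ∈ regular ι) {u : KL} (hu : u ∈ infPoly ι) :
    MvPolynomial.C f * u ∈ infPoly ι := by
  intro β
  rw [MvPolynomial.coeff_C_mul]
  exact regular_mul_infinitesimal hf (hu β)

theorem const_mul_mem_infPoly (v : MvPolynomial ι ℂ) {u : KL} (hu : u ∈ infPoly ι) :
    const v * u ∈ infPoly ι := by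
  intro β
  rw [MvPolynomial.coeff_mul]
  refine sum_mem fun x _ => ?_
  rw [MvPolynomial.coeff_map]
  exact regular_mul_infinitesimal (algebraMap_mem _ _) (hu _)

theorem C_mul_const_mem_infPoly {f : RatField ι} (hf : f ∈ infinitesimal ι) (v : MvPolynomial ι ℂ) :
    MvPolynomial.C f * const v ∈ infPoly ι := by
  intro β
  rw [MvPolynomial.coeff_C_mul, MvPolynomial.coeff_map, mul_comm]
  exact regular_mul_infinitesimal (algebraMap_mem _ _) hf

theorem const_eq_zero_of_mem_infPoly {v : MvPolynomial ι ℂ} (h : const v ∈ infPoly ι) : v = 0 := by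
  ext β
  have := h β
  rw [MvPolynomial.coeff_map] at this
  rw [algebraMap_mem_infinitesimal this, MvPolynomial.coeff_zero]

theorem univD_mem_infPoly (i : ι) {u : KL} (hu : u ∈ infPoly ι) : univD i u ∈ infPoly ι := by
  rw [univD_apply]
  refine add_mem (fun β => ?_) ?_
  · rw [coeff_coeffDeriv]; exact theta_mem_infinitesimal i (hu β)
  · have := const_mul_mem_infPoly (MvPolynomial.X i) hu
    rwa [MvPolynomial.map_X] at this

theorem univD_const_mul (i : ι) (v : MvPolynomial ι ℂ) (u : KL) :
    univD i (const v * u) = const v * univD i u := by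
  rw [univD_apply, univD_apply, coeffDeriv_mul, coeffDeriv_map]; ring

theorem univD_const (i : ι) (v : MvPolynomial ι ℂ) :
    univD i (const v) = const (MvPolynomial.X i * v) := by
  rw [univD_apply, coeffDeriv_map, map_mul, MvPolynomial.map_X, zero_add]

theorem smul_eq_C_mul (c : ℂ) (u : KL) :
    c • u = MvPolynomial.C (algebraMap ℂ (RatField ι) c) * u := by
  rw [Algebra.smul_def, MvPolynomial.algebraMap_apply]

/-- Conjugation by `x^γ` shifts the spectral variable `λ_i` by `γ_i`; this shift forces `γ = 0` in
`eq_zero_of_commute`. -/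
theorem univD_mono_mul (i : ι) (γ : ι →₀ ℤ) (u : KL) :
    univD i (MvPolynomial.C (mono γ) * u) =
      MvPolynomial.C (mono γ) * (univD i u + (γ i : ℂ) • u) := by
  have h : (MvPolynomial.C ((γ i : ℂ) • mono γ) : KL) = (γ i : ℂ) • MvPolynomial.C (mono γ) := by
    rw [smul_eq_C_mul, Algebra.smul_def, map_mul]
  rw [univD_apply, univD_apply, coeffDeriv_mul, coeffDeriv_C, theta_mono, h, smul_mul_assoc,
    mul_add, mul_smul_comm]
  ring

variable (ι) in
/-- The operators which preserve the polynomials vanishing at infinity. -/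
def preserving : Subalgebra ℂ (Module.End ℂ KL) where
  carrier := {Q | ∀ u ∈ infPoly ι, Q u ∈ infPoly ι}
  mul_mem' hP hQ _ hu := hP _ (hQ _ hu)
  add_mem' hP hQ u hu := add_mem (hP u hu) (hQ u hu)
  algebraMap_mem' c _ hu := Submodule.smul_mem _ c hu

variable (ι) in
/-- The operators which have a limit at infinity, given by multiplication by a polynomial. -/
def limiting : Subalgebra ℂ (Module.End ℂ KL) where
  carrier := {Q | Q ∈ preserving ι ∧ ∃ w : MvPolynomial ι ℂ, ∀ v : MvPolynomial ι ℂ,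
    Q (const v) - const (w * v) ∈ infPoly ι}
  mul_mem' := by
    rintro P Q ⟨hP, w, hw⟩ ⟨hQ, x, hx⟩
    refine ⟨mul_mem hP hQ, w * x, fun v => ?_⟩
    have := add_mem (hP _ (hx v)) (hw (x * v))
    rw [map_sub, sub_add_sub_cancel, ← mul_assoc] at this
    exact this
  add_mem' := by
    rintro P Q ⟨hP, w, hw⟩ ⟨hQ, x, hx⟩
    refine ⟨add_mem hP hQ, w + x, fun v => ?_⟩
    rw [add_mul, map_add, LinearMap.add_apply, add_sub_add_comm]
    exact add_mem (hw v) (hx v)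
  algebraMap_mem' c := ⟨algebraMap_mem _ c, MvPolynomial.C c, fun v => by
    rw [Module.algebraMap_end_apply, map_mul, MvPolynomial.map_C, smul_eq_C_mul, sub_self]
    exact zero_mem _⟩

/-- The limits are multiplications by polynomials in `λ`, and these commute. -/
theorem commutator_limiting {P Q : Module.End ℂ KL} (hP : P ∈ limiting ι) (hQ : Q ∈ limiting ι) :
    (P * Q - Q * P) 1 ∈ infPoly ι := by
  obtain ⟨hP, w, hw⟩ := hP
  obtain ⟨hQ, x, hx⟩ := hQ
  have h1 := add_mem (hP _ (hx 1)) (hw (x * 1))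
  have h2 := add_mem (hQ _ (hw 1)) (hx (w * 1))
  have := sub_mem h1 h2
  rw [map_sub, sub_add_sub_cancel, map_sub, sub_add_sub_cancel, ← mul_assoc, ← mul_assoc,
    mul_comm w x, sub_sub_sub_cancel_right, map_one] at this
  exact this

theorem univM_mem_limiting {f : RatField ι} (hf : f ∈ regular ι) : univM ι f ∈ limiting ι := by
  refine ⟨fun u hu => C_mul_mem_infPoly hf hu, ?_⟩
  obtain ⟨c, hc⟩ := hf
  refine ⟨MvPolynomial.C c, fun v => ?_⟩
  rw [univM_apply, map_mul, MvPolynomial.map_C, ← sub_mul, ← map_sub]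
  exact C_mul_const_mem_infPoly hc v

theorem univD_mem_limiting (i : ι) : univD i ∈ limiting ι := by
  refine ⟨fun u hu => univD_mem_infPoly i hu, MvPolynomial.X i, fun v => ?_⟩
  rw [univD_const, sub_self]
  exact zero_mem _

theorem univIntegral_mem_limiting (k p q : ℂ) (κ : ι → ℂ) (n : ℕ) :
    laxIntegral (univM ι) univD k p q κ n ∈ limiting ι :=
  laxIntegral_mem _ _ _ _ _ _ _ (fun a b => univM_mem_limiting (laxX_mem_regular k p q κ a b))
    univD_mem_limiting n

/-- A nonzero polynomial in the spectral variables has a leading term at infinity. -/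
theorem exists_leading_poly {u : KL} (hu : u ≠ 0) : ∃ γ : ι →₀ ℤ, ∃ v : MvPolynomial ι ℂ, v ≠ 0 ∧
    ∃ w ∈ infPoly ι, u = MvPolynomial.C (mono γ) * (const v + w) := by
  -- `γ` is the least among the leading exponents of the nonzero coefficients; `β₀` is a coefficient
  -- where it is attained, which keeps the limit polynomial nonzero.
  obtain ⟨γ, h1, β₀, h2⟩ : ∃ γ : ι →₀ ℤ, (∀ β, mono (-γ) * u.coeff β ∈ regular ι) ∧
      ∃ β, mono (-γ) * u.coeff β ∉ infinitesimal ι := by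
    choose g c hc ε hε he using fun (f : RatField ι) (hf : f ≠ 0) => exists_leading hf
    have hs : u.support.Nonempty := MvPolynomial.support_nonempty.2 hu
    obtain ⟨⟨β₀, h₀⟩, _, hmin⟩ := Finset.exists_min_image u.support.attach
      (fun β => lexExp (g _ (MvPolynomial.mem_support_iff.1 β.2))) (by simpa using hs)
    have h₀' := MvPolynomial.mem_support_iff.1 h₀
    have hr : ∀ f hf, algebraMap ℂ _ (c f hf) + ε f hf ∈ regular ι := fun f hf =>
      add_mem (algebraMap_mem _ _) (mem_regular_of_infinitesimal (hε f hf))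
    refine ⟨g _ h₀', fun β => ?_, β₀, fun h => ?_⟩
    · by_cases hβ : u.coeff β = 0
      · rw [hβ, mul_zero]; exact zero_mem _
      have h3 := hmin ⟨β, MvPolynomial.mem_support_iff.2 hβ⟩ (Finset.mem_attach _ _)
      simp only at h3
      rw [he _ hβ, ← mul_assoc, ← mono_add]
      rcases h3.eq_or_lt with h4 | h4
      · rw [lexExp_injective h4, neg_add_cancel, mono_zero, one_mul]
        exact hr _ hβ
      · refine mul_mem (mem_regular_of_infinitesimal (mono_mem_infinitesimal ?_)) (hr _ hβ)
        rw [lexExp_add, lexExp_neg]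
        rwa [lt_neg_add_iff_add_lt, add_zero]
    · rw [congrArg (mono (-g _ h₀') * ·) (he _ h₀'), ← mul_assoc, ← mono_add, neg_add_cancel,
        mono_zero, one_mul] at h
      have h4 := sub_mem h (hε _ h₀')
      rw [add_sub_cancel_right] at h4
      exact hc _ h₀' (algebraMap_mem_infinitesimal h4)
  choose r hr using h1
  set v : MvPolynomial ι ℂ := ∑ β ∈ u.support, MvPolynomial.monomial β (r β) with hv
  have hw : MvPolynomial.C (mono (-γ)) * u - const v ∈ infPoly ι := by
    intro β
    rw [MvPolynomial.coeff_sub, MvPolynomial.coeff_C_mul, MvPolynomial.coeff_map, hv,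
      MvPolynomial.coeff_sum]
    simp only [MvPolynomial.coeff_monomial, Finset.sum_ite_eq']
    split_ifs with h
    · exact hr β
    · rw [MvPolynomial.notMem_support_iff.1 h, mul_zero, map_zero, sub_zero]
      exact zero_mem _
  refine ⟨γ, v, fun h0 => ?_, _, hw, ?_⟩
  · rw [h0, map_zero, sub_zero] at hw
    have := hw β₀
    rw [MvPolynomial.coeff_C_mul] at this
    exact h2 this
  · rw [add_sub_cancel, ← mul_assoc, ← map_mul, mono_mul_neg, map_one, one_mul]

variable (ι) in
/-- The operators which are linear over the constant coefficient polynomials. -/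
def constLinear : Subalgebra ℂ (Module.End ℂ KL) where
  carrier := {Q | ∀ (v : MvPolynomial ι ℂ) (u : KL), Q (const v * u) = const v * Q u}
  mul_mem' {P Q} hP hQ v u := by
    change P (Q _) = _ * P (Q _)
    rw [hQ, hP]
  add_mem' {P Q} hP hQ v u := by
    rw [LinearMap.add_apply, hP, hQ, LinearMap.add_apply, mul_add]
  algebraMap_mem' c v u := by
    rw [Module.algebraMap_end_apply, Module.algebraMap_end_apply, mul_smul_comm]

/-- An operator which commutes with the Schrödinger operator and is determined by its action on
`1` vanishes if it vanishes at infinity. -/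
theorem eq_zero_of_commute {k p q : ℂ} {κ : ι → ℂ} (hκ : ∀ i, κ i ≠ 0) (P : Module.End ℂ KL)
    (hP : P = (isConnection_univ ι).normal (P 1)) (h1 : P 1 ∈ infPoly ι)
    (hc : P * laxH (univM ι) univD k p q κ = laxH (univM ι) univD k p q κ * P) : P 1 = 0 := by
  by_contra hu
  obtain ⟨γ, u₀, hu₀, u₁, hu₁, e⟩ := exists_leading_poly hu
  obtain ⟨c, hε⟩ := laxV_mem_regular k p q κ
  set ε := laxV k p q κ - algebraMap ℂ _ c with hεd
  set u := P 1 with hud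
  set u' := const u₀ + u₁ with hu'
  set h₀ : MvPolynomial ι ℂ := ∑ i, MvPolynomial.C (κ i) * MvPolynomial.X i ^ 2 with hh₀
  have hV : laxV k p q κ = algebraMap ℂ _ c + ε := by rw [hεd]; ring
  have hH : ∀ w : KL, laxH (univM ι) univD k p q κ w =
      ∑ i, κ i • univD i (univD i w) - MvPolynomial.C (laxV k p q κ) * w := by
    intro w
    simp [laxH, LinearMap.sub_apply, LinearMap.sum_apply, sq, univM_apply]
  -- Being the normal ordering of its symbol, `P` is built from coefficients and the operators `∂_i
  -- + λ_i`, all linear over polynomials in `λ`. Hence `P (h₀ - c)` is `(h₀ - c) u`.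
  have hPc : P ∈ constLinear ι := by
    rw [hP]
    exact (isConnection_univ ι).normal_mem (constLinear ι) (fun i v u => univD_const_mul i v u) _
      fun β v w => by rw [univM_apply, univM_apply]; ring
  have hreg : ∀ β, u'.coeff β ∈ regular ι := fun β => by
    rw [hu', MvPolynomial.coeff_add, MvPolynomial.coeff_map]
    exact add_mem (algebraMap_mem _ _) (mem_regular_of_infinitesimal (hu₁ β))
  have hCε : (MvPolynomial.C ε : KL) ∈ infPoly ι := by
    have := C_mul_const_mem_infPoly hε 1
    rwa [map_one, mul_one] at this
  -- The leading monomial can be taken out on the left of the whole operator `P`, so the vanishing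
  -- part of the potential contributes only below the leading order.
  have hPε : P (MvPolynomial.C ε) = MvPolynomial.C (mono γ) *
      (isConnection_univ ι).normal u' (MvPolynomial.C ε) := by
    rw [hP, e, (isConnection_univ ι).normal_C_mul]
    rfl
  have hr1 : (isConnection_univ ι).normal u' (MvPolynomial.C ε) ∈ infPoly ι :=
    (isConnection_univ ι).normal_mem (preserving ι) (fun i => (univD_mem_limiting i).1) _
      (fun β => (univM_mem_limiting (hreg β)).1) _ hCε
  have hr2 : MvPolynomial.C ε * u' ∈ infPoly ι := by
    rw [hu', mul_add]
    exact add_mem (C_mul_const_mem_infPoly hε _)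
      (C_mul_mem_infPoly (mem_regular_of_infinitesimal hε) hu₁)
  have hH1 : laxH (univM ι) univD k p q κ 1 =
      const h₀ * 1 - const (MvPolynomial.C c) * 1 - MvPolynomial.C ε := by
    have h2 : ∀ i, univD i (univD i (1 : KL)) = const (MvPolynomial.X i ^ 2) := by
      intro i
      rw [← map_one const, univD_const, univD_const, mul_one, sq]
    rw [hH, hV, map_add, hh₀, map_sum, MvPolynomial.map_C]
    simp only [h2, map_mul, MvPolynomial.map_C, smul_eq_C_mul]
    ring
  have hmain := LinearMap.congr_fun hc 1
  simp only [Module.End.mul_apply] at hmain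
  rw [hH1, map_sub, map_sub, hPc, hPc, ← hud, hPε, hH, hV, MvPolynomial.C_add,
    MvPolynomial.map_C] at hmain
  set E : ι → KL → KL := fun i w => univD i w + (γ i : ℂ) • w with hE
  have hEE : ∀ i, univD i (univD i u) = MvPolynomial.C (mono γ) * E i (E i u') := by
    intro i
    rw [e, univD_mono_mul, univD_mono_mul]
  have hEc : ∀ i v, E i (const v) = const ((MvPolynomial.X i + MvPolynomial.C (γ i : ℂ)) * v) := by
    intro i v
    simp only [hE, univD_const, smul_eq_C_mul, add_mul, map_add, map_mul, MvPolynomial.map_C]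
  have hEi : ∀ i w, w ∈ infPoly ι → E i w ∈ infPoly ι := fun i w hw =>
    add_mem (univD_mem_infPoly i hw) (Submodule.smul_mem _ _ hw)
  have hEadd : ∀ i v w, E i (v + w) = E i v + E i w := by
    intro i v w
    simp only [hE, map_add, smul_add]; abel
  -- The change of the free symbol `∑ κ_i λ_i^2` under the shift by `γ`. The leading order of `P H =
  -- H P` says that `g u₀` vanishes.
  set g : MvPolynomial ι ℂ := ∑ i, MvPolynomial.C (κ i) *
    ((MvPolynomial.X i + MvPolynomial.C (γ i : ℂ)) ^ 2 - MvPolynomial.X i ^ 2) with hg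
  have hsum : ∑ i, κ i • E i (E i u') - const h₀ * u' =
      const (g * u₀) + (∑ i, κ i • E i (E i u₁) - const h₀ * u₁) := by
    have h3 : ∑ i, κ i • E i (E i (const u₀)) = const (g * u₀) + const h₀ * const u₀ := by
      rw [← map_mul, ← map_add, ← add_mul, hg, hh₀, ← Finset.sum_add_distrib, Finset.sum_mul,
        map_sum]
      refine Finset.sum_congr rfl fun i _ => ?_
      rw [hEc, hEc, smul_eq_C_mul, ← MvPolynomial.map_C, ← map_mul]
      congr 1
      ring
    simp only [hu', hEadd, smul_add, Finset.sum_add_distrib, h3]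
    ring
  have hfin : const (g * u₀) ∈ infPoly ι := by
    have h4 : MvPolynomial.C (mono γ) * (∑ i, κ i • E i (E i u') - const h₀ * u') =
        MvPolynomial.C (mono γ) *
          (MvPolynomial.C ε * u' - (isConnection_univ ι).normal u' (MvPolynomial.C ε)) := by
      simp only [hEE, ← mul_smul_comm, ← Finset.mul_sum] at hmain
      rw [e] at hmain
      linear_combination -hmain
    have h5 := mul_left_cancel₀ (by simpa using mono_ne_zero γ) h4
    rw [hsum] at h5
    rw [eq_sub_of_add_eq h5]
    exact sub_mem (sub_mem hr2 hr1) (sub_mem (sum_mem fun i _ => Submodule.smul_mem _ _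
      (hEi i _ (hEi i _ hu₁))) (const_mul_mem_infPoly _ hu₁))
  have hg0 : g = 0 := (mul_eq_zero.1 (const_eq_zero_of_mem_infPoly hfin)).resolve_right hu₀
  have hγ : γ = 0 := by
    have hev : ∀ t : ι → ℂ, ∑ i, κ i * ((t i + γ i) ^ 2 - t i ^ 2) = 0 := by
      intro t
      -- The values at a basis vector and at 0 are compared below; their difference is `2 κ_i γ_i`.
      have := congrArg (MvPolynomial.eval t) hg0
      simpa [hg] using this
    ext i
    have h6 := hev (Pi.single i 1)
    have h7 := hev 0
    rw [← sub_eq_zero, ← h7, eq_comm] at h6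
    have h8 : ∑ j, κ j * (((Pi.single i 1 : ι → ℂ) j + γ j) ^ 2 - (Pi.single i 1 : ι → ℂ) j ^ 2) -
        ∑ j, κ j * (((0 : ι → ℂ) j + γ j) ^ 2 - (0 : ι → ℂ) j ^ 2) = 2 * κ i * γ i := by
      rw [← Finset.sum_sub_distrib, Finset.sum_eq_single i]
      · simp; ring
      · intro j _ hj; simp [hj]
      · simp
    rw [hev, hev, sub_zero] at h8
    have := hκ i
    simpa [this] using h8.symm
  apply hu₀
  apply const_eq_zero_of_mem_infPoly
  have h9 : const u₀ = u - u₁ := by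
    rw [e, hγ, mono_zero, map_one, one_mul, hu', add_sub_cancel_right]
  rw [h9]
  exact sub_mem h1 hu₁

/-- Only the value on 1 is claimed: it is the full symbol of the commutator, and normal ordering
then yields the operator identity in every connection. -/
theorem univIntegral_commute {k p q : ℂ} {κ : ι → ℂ} (h : IsWeight k κ) (n n' : ℕ) :
    (laxIntegral (univM ι) univD k p q κ n * laxIntegral (univM ι) univD k p q κ n'
      - laxIntegral (univM ι) univD k p q κ n' * laxIntegral (univM ι) univD k p q κ n) 1 = 0 := by
  have hU := isConnection_univ ι
  have h1 := laxIntegral_commute (p := p) (q := q) h hU n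
  have h2 := laxIntegral_commute (p := p) (q := q) h hU n'
  refine eq_zero_of_commute (k := k) (p := p) (q := q) h.ne_zero _ ?_
    (commutator_limiting (univIntegral_mem_limiting k p q κ n)
      (univIntegral_mem_limiting k p q κ n')) ?_
  · simp only [LinearMap.sub_apply, Module.End.mul_apply, map_sub, hU.normal_laxIntegral,
      hU.normal_one, mul_one]
  · exact ((Commute.mul_left h1 h2).sub_left (Commute.mul_left h2 h1)).eq

/-- The integrals commute with each other. -/
theorem laxIntegral_commute_laxIntegral {R : Type} [Ring R] [Algebra ℂ R] {m : RatField ι →ₐ[ℂ] R}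
    {D : ι → R} (hD : IsConnection m D) {k p q : ℂ} {κ : ι → ℂ} (h : IsWeight k κ) (n n' : ℕ) :
    Commute (laxIntegral m D k p q κ n) (laxIntegral m D k p q κ n') := by
  have := congrArg hD.normal (univIntegral_commute (p := p) (q := q) h n n')
  simp only [LinearMap.sub_apply, Module.End.mul_apply, map_sub, hD.normal_laxIntegral,
    hD.normal_one, mul_one, map_zero] at this
  exact sub_eq_zero.1 this

end Commutativity

/-! ### The deformed system -/

section DeformedSystem

set_option linter.unusedSectionVars false

variable {ι : Type} [DecidableEq ι]

variable (ι) in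
/-- Multiplication operators as a homomorphism of algebras. -/
def mulHom : RatField ι →ₐ[ℂ] Module.End ℂ (RatField ι) := Algebra.lmul ℂ (RatField ι)

theorem mulHom_apply (f g : RatField ι) : mulHom ι f g = f * g := rfl

theorem mulOp_eq (f : RatField ι) : mulOp f = mulHom ι f := rfl

variable (ι) in
theorem isConnection_theta : IsConnection (mulHom ι) thetaOp where
  comm i j := LinearMap.ext fun f => theta_comm i j f
  leibniz i f := by
    refine LinearMap.ext fun g => ?_
    change theta i (f * g) = f * theta i g + theta i f * g
    rw [Derivation.leibniz, smul_eq_mul, smul_eq_mul, mul_comm g]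

local notation "𝔠" => algebraMap ℂ (RatField ι)

theorem ctg_sq_sub_one {a b : ι ⊕ ι} (h : a ≠ b) :
    ctg a b ^ 2 - 1 = 4 * (svar a * svar b / (svar a - svar b) ^ 2) := by
  have h1 := svar_sub_ne_zero h
  rw [ctg]
  field_simp
  ring

theorem ctg_swap_sq_sub_one {a b : ι ⊕ ι} (h : a ≠ b.swap) :
    ctg a b.swap ^ 2 - 1 = 4 * (svar a * svar b / (svar a * svar b - 1) ^ 2) := by
  have h1 := svar_mul_sub_one_ne_zero h
  rw [ctg_swap_right_eq]
  field_simp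
  ring

/-- The pair potential of the deformed operator. -/
def pairPot (i j : ι) : RatField ι :=
  var i * var j / (var i - var j) ^ 2 + var i * var j / (var i * var j - 1) ^ 2

theorem pairPot_comm (i j : ι) : pairPot i j = pairPot j i := by
  rw [pairPot, pairPot, mul_comm (var i), ← neg_sub (var i), neg_sq]

theorem laxW_add (k : ℂ) (κ : ι → ℂ) {i j : ι} (h : j ≠ i) :
    laxW k κ (Sum.inl i) (Sum.inl j) + laxW k κ (Sum.inl i) (Sum.inr j) =
      𝔠 (2 * k / κ j * (1 + k / κ i ^ 2)) * pairPot i j := by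
  have e1 : (Sum.inl i : ι ⊕ ι) ≠ Sum.inl j := by simpa using h.symm
  have e2 : (Sum.inl i : ι ⊕ ι) ≠ (Sum.inl j : ι ⊕ ι).swap := by simp
  have h1 := ctg_sq_sub_one e1
  have h2 := ctg_swap_sq_sub_one e2
  rw [Sum.swap_inl] at h2
  simp only [laxW, Sum.swap_inl, Sum.inl.injEq, Sum.inr.injEq, h, reduceCtorEq, if_false, h1, h2]
  have e3 : 2 * k / κ j * (1 + k / κ i ^ 2) = 4 * (k / (2 * κ j) * (1 + k / κ i ^ 2)) := by ring
  rw [e3, pairPot, map_mul 𝔠 4, map_ofNat]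
  simp only [svar, sweight, Sum.elim_inl, Sum.elim_inr]
  ring

/-- The cross term of the square mixes the two kinds of cotangent; the duplication formula rewrites
it through `ctgOne ^ 2`. The constant term is what separates `deformedCMS` from `laxH`. -/
theorem laxS_inl (p q : ℂ) (κ : ι → ℂ) (i : ι) :
    laxS p q κ (Sum.inl i) =
      𝔠 ((κ i)⁻¹ * (p / 2 + (q + (1 - κ i) / 2)) ^ 2)
      + (𝔠 ((κ i)⁻¹ * (p ^ 2 + 2 * p * (q + (1 - κ i) / 2)) + p) * (var i / (var i - 1) ^ 2)
      + 𝔠 ((κ i)⁻¹ * (4 * (q + (1 - κ i) / 2) ^ 2) + 4 * (q + (1 - κ i) / 2)) *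
          (var i ^ 2 / (var i ^ 2 - 1) ^ 2)) := by
  have h1 := svar_sub_one_ne_zero (Sum.inl i : ι ⊕ ι)
  have h2 := svar_sq_sub_one_ne_zero (Sum.inl i : ι ⊕ ι)
  have e1 : ctgOne (Sum.inl i : ι ⊕ ι) ^ 2 = 1 + 4 * (var i / (var i - 1) ^ 2) := by
    change var i - 1 ≠ 0 at h1
    change ((var i + 1) / (var i - 1)) ^ 2 = _
    field_simp
    ring
  have e2 : ctg (Sum.inl i : ι ⊕ ι) (Sum.inl i : ι ⊕ ι).swap ^ 2 =
      1 + 4 * (var i ^ 2 / (var i ^ 2 - 1) ^ 2) := by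
    rw [ctg_swap_self]
    change var i ^ 2 - 1 ≠ 0 at h2
    change ((var i ^ 2 + 1) / (var i ^ 2 - 1)) ^ 2 = _
    field_simp
    ring
  have e3 := ctgOne_mul_ctg (Sum.inl i : ι ⊕ ι)
  rw [e1] at e3
  rw [laxS, laxZ, laxZ', e1, e2]
  change 𝔠 (κ i)⁻¹ * (𝔠 (p / 2) * _ + 𝔠 (q + (1 - κ i) / 2) * _) ^ 2 - (𝔠 (p / 2) * _
    + 𝔠 (q + (1 - κ i) / 2) * _) = _
  set ν := q + (1 - κ i) / 2
  simp only [map_mul, map_add, map_pow, map_div₀, map_ofNat]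
  linear_combination (𝔠 (κ i)⁻¹) * ((𝔠 p / 2) ^ 2 * e1 + (𝔠 ν) ^ 2 * e2 + (𝔠 p / 2 * 𝔠 ν) * e3)

theorem laxV_eq [Fintype ι] (k p q : ℂ) (κ : ι → ℂ) :
    laxV k p q κ = 𝔠 (1 / 2) * ∑ i, ∑ j ∈ {i}ᶜ, 𝔠 (2 * k / κ j * (1 + k / κ i ^ 2)) * pairPot i j
      + ∑ i, laxS p q κ (Sum.inl i) := by
  have hS : ∑ a, laxS p q κ a = 2 * ∑ i, laxS p q κ (Sum.inl i) := by
    have : ∀ i : ι, laxS p q κ (Sum.inr i) = laxS p q κ (Sum.inl i) := fun i =>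
      laxS_swap (Sum.inl i)
    rw [Fintype.sum_sum_type, Finset.sum_congr rfl fun i _ => this i, two_mul]
  have hW1 : ∀ i : ι, ∑ c, laxW k κ (Sum.inl i) c =
      ∑ j ∈ {i}ᶜ, 𝔠 (2 * k / κ j * (1 + k / κ i ^ 2)) * pairPot i j := by
    intro i
    rw [Fintype.sum_sum_type, ← Finset.sum_add_distrib,
      ← Finset.sum_subset (Finset.subset_univ {i}ᶜ)]
    · refine Finset.sum_congr rfl fun j hj => ?_
      exact laxW_add k κ (by simpa using hj)
    · intro j _ hj
      have : j = i := by simpa using hj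
      subst this
      simp [laxW]
  have hW2 : ∀ i : ι, ∑ c, laxW k κ (Sum.inr i) c = ∑ c, laxW k κ (Sum.inl i) c := by
    intro i
    rw [← Equiv.sum_comp (Equiv.sumComm ι ι)]
    exact Finset.sum_congr rfl fun c _ => laxW_swap_swap (Sum.inl i) c
  have hW : ∑ a, ∑ c, laxW k κ a c =
      2 * ∑ i, ∑ j ∈ {i}ᶜ, 𝔠 (2 * k / κ j * (1 + k / κ i ^ 2)) * pairPot i j := by
    rw [Fintype.sum_sum_type, Finset.sum_congr rfl fun i _ => hW2 i,
      Finset.sum_congr rfl fun i _ => hW1 i]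
    ring
  rw [laxV, hS, hW]
  simp only [map_div₀, map_one, map_ofNat]
  ring

theorem sum_offdiag_symm {n : ℕ} {M : Type} [AddCommGroup M] (F : Fin n → Fin n → M)
    (hF : ∀ i j, F i j = F j i) :
    ∑ i, ∑ j ∈ {i}ᶜ, F i j = 2 • ∑ i, ∑ j ∈ Finset.Ioi i, F i j := by
  have := Finset.sum_sum_Ioi_add_eq_sum_sum_off_diag fun i j => F i j
  rw [Finset.sum_congr rfl fun i _ => Finset.sum_congr rfl fun j _ => hF i j, ← this,
    Finset.smul_sum]
  refine Finset.sum_congr rfl fun i _ => ?_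
  rw [Finset.smul_sum]
  refine Finset.sum_congr rfl fun j _ => ?_
  rw [hF j i, two_smul]

theorem sum_compl_inl {n m : ℕ} {M : Type} [AddCommGroup M] (i : Fin n) (F : Idx n m → M) :
    ∑ j ∈ {Sum.inl i}ᶜ, F j = ∑ j ∈ {i}ᶜ, F (Sum.inl j) + ∑ j, F (Sum.inr j) := by
  have h : ∀ (α : Type) [Fintype α] [DecidableEq α] (a : α) (F : α → M),
      ∑ j ∈ {a}ᶜ, F j = ∑ j, F j - F a := fun α _ _ a F => by
    rw [← Finset.sum_compl_add_sum {a}, Finset.sum_singleton, add_sub_cancel_right]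
  rw [h, h, Fintype.sum_sum_type]; abel

theorem sum_compl_inr {n m : ℕ} {M : Type} [AddCommGroup M] (i : Fin m) (F : Idx n m → M) :
    ∑ j ∈ {Sum.inr i}ᶜ, F j = ∑ j, F (Sum.inl j) + ∑ j ∈ {i}ᶜ, F (Sum.inr j) := by
  have h : ∀ (α : Type) [Fintype α] [DecidableEq α] (a : α) (F : α → M),
      ∑ j ∈ {a}ᶜ, F j = ∑ j, F j - F a := fun α _ _ a F => by
    rw [← Finset.sum_compl_add_sum {a}, Finset.sum_singleton, add_sub_cancel_right]
  rw [h, h, Fintype.sum_sum_type]; abel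

variable {n m : ℕ} {k p q r s : ℂ}

/-- The weights of the deformed system. -/
def parityWeight (n m : ℕ) (k : ℂ) (i : Idx n m) : ℂ := k ^ parity i

theorem isWeight_parity (hk : k ≠ 0) : IsWeight k (parityWeight n m k) where
  eq_or i := by rcases i with i | i <;> simp [parityWeight, parity]
  ne_zero i := by rcases i with i | i <;> simp [parityWeight, parity, hk]

/-- The two relations between the couplings say exactly that `k^p(i) μ(i) = p` and `k^p(i) ν(i) = q
+ (1 - κ_i)/2` on both groups of indices, so that a single formula for `laxZ` serves all of them. -/
theorem moser_eq (hk : k ≠ 0) (hp : p = k * r) (hq : 2 * q + 1 = k * (2 * s + 1)) :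
    moser n m k p q r s = laxL (mulHom _) thetaOp k p q (parityWeight n m k) := by
  have hm : ∀ (c : ℂ) (f : RatField (Idx n m)), mulHom (Idx n m) (algebraMap ℂ _ c * f) =
      c • mulOp f := by
    intro c f
    rw [← Algebra.smul_def, map_smul, mulOp_eq]
  have hk' : ∀ j : Idx n m, k ^ (1 - parity j) / 2 = k / (2 * parityWeight n m k j) := by
    rintro (j | j) <;> simp [parity, parityWeight]
    field_simp
  have h1 : ∀ i : Idx n m, k ^ parity i * Sum.elim (fun _ => p) (fun _ => r) i / 2 = p / 2 := by
    rintro (i | i) <;> simp [parity, hp]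
  have h2 : ∀ i : Idx n m, k ^ parity i * Sum.elim (fun _ => q) (fun _ => s) i =
      q + (1 - parityWeight n m k i) / 2 := by
    rintro (i | i) <;> simp [parity, parityWeight]
    linear_combination -hq / 2
  have hA : ∀ i j, moserA n m k i j =
      laxL (mulHom _) thetaOp k p q (parityWeight n m k) (Sum.inl i) (Sum.inl j) := by
    intro i j
    simp only [moserA, laxL, Matrix.of_apply, laxX, Sum.inl.injEq, Sum.swap_inl, reduceCtorEq,
      if_false, @eq_comm _ j i, hk']
    split_ifs with h
    · rw [map_zero, add_zero]; rfl
    · rw [hm, zero_add]; rfl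
  have hB : ∀ i j, moserB n m k p q r s i j =
      laxL (mulHom _) thetaOp k p q (parityWeight n m k) (Sum.inl i) (Sum.inr j) := by
    intro i j
    simp only [moserB, laxL, Matrix.of_apply, laxX, Sum.inr.injEq, Sum.swap_inl, reduceCtorEq,
      if_false, @eq_comm _ j i, hk', zero_add, h1, h2]
    split_ifs with h
    · rw [laxZ, map_add, hm, hm, ctg_swap_self]; rfl
    · rw [hm]
      congr 2
      exact (ctg_swap_right_eq (Sum.inl i) (Sum.inl j)).symm
  -- Inverting all variables reverses the sign of `L`; this gives the lower blocks `-B` and `-A`.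
  have hneg : ∀ a b : Idx n m ⊕ Idx n m,
      laxL (mulHom _) thetaOp k p q (parityWeight n m k) a.swap b.swap =
        -laxL (mulHom _) thetaOp k p q (parityWeight n m k) a b := by
    intro a b
    have e1 : ∀ a b : Idx n m ⊕ Idx n m, a.swap = b.swap ↔ a = b := fun a b =>
      ⟨fun e => by simpa using congrArg Sum.swap e, fun e => by rw [e]⟩
    have e2 : b.swap = a ↔ b = a.swap :=
      ⟨fun e => by rw [← e, Sum.swap_swap], fun e => by rw [e, Sum.swap_swap]⟩
    have e3 : signedOp (thetaOp (ι := Idx n m)) a.swap = -signedOp thetaOp a := by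
      rcases a with a | a <;> simp [signedOp]
    simp only [laxL, Matrix.of_apply, laxX, e1, Sum.swap_swap, e2, sweight_swap, e3,
      ctg_swap_swap, laxZ_swap]
    split_ifs <;> simp [add_comm]
  ext1 a b
  rcases a with i | i <;> rcases b with j | j
  · exact hA i j
  · exact hB i j
  · change -moserB n m k p q r s i j = _
    rw [hB, ← hneg]; rfl
  · change -moserA n m k i j = _
    rw [hA, ← hneg]; rfl

theorem deformedIntegral_eq (hk : k ≠ 0) (hp : p = k * r) (hq : 2 * q + 1 = k * (2 * s + 1))
    (l : ℕ) : deformedIntegral n m k p q r s l =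
      laxIntegral (mulHom _) thetaOp k p q (parityWeight n m k) (2 * l) := by
  rw [deformedIntegral, moser_eq hk hp hq, laxIntegral]
  refine Finset.sum_congr rfl fun a _ => Finset.sum_congr rfl fun b _ => ?_
  congr 1
  rcases a with a | a <;> rfl

theorem deformedCMS_eq (hk : k ≠ 0) (hp : p = k * r) (hq : 2 * q + 1 = k * (2 * s + 1)) :
    ∃ c : ℂ, deformedCMS n m k p q r s =
      laxH (mulHom _) thetaOp k p q (parityWeight n m k) + algebraMap ℂ _ c := by
  set κ := parityWeight n m k with hκ
  have hconst : ∀ c : ℂ, mulHom (Idx n m) (algebraMap ℂ _ c) = algebraMap ℂ _ c := fun c =>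
    AlgHom.commutes _ c
  refine ⟨∑ i, (κ i)⁻¹ * (p / 2 + (q + (1 - κ i) / 2)) ^ 2, ?_⟩
  have κl : ∀ i : Fin n, κ (Sum.inl i) = 1 := fun i => by simp [hκ, parityWeight, parity]
  have κr : ∀ j : Fin m, κ (Sum.inr j) = k := fun j => by simp [hκ, parityWeight, parity]
  have hs : k * s = q + (1 - k) / 2 := by linear_combination -hq / 2
  have hD : ∑ i : Fin n, thetaOp (ι := Idx n m) (Sum.inl i) ^ 2
      + k • ∑ j : Fin m, thetaOp (ι := Idx n m) (Sum.inr j) ^ 2 =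
      ∑ i, κ i • thetaOp i ^ 2 := by
    rw [Fintype.sum_sum_type, Finset.smul_sum]
    simp only [κl, κr, one_smul]
  have hV : laxV k p q κ = algebraMap ℂ _ (2 * k * (k + 1)) *
        ∑ i : Fin n, ∑ j ∈ Finset.Ioi i, pairPot (Sum.inl i) (Sum.inl j)
      + algebraMap ℂ _ (2 * (k⁻¹ + 1)) *
        ∑ i : Fin m, ∑ j ∈ Finset.Ioi i, pairPot (Sum.inr i) (Sum.inr j)
      + algebraMap ℂ _ (2 * (k + 1)) *
        ∑ i : Fin n, ∑ j : Fin m, pairPot (Sum.inl i) (Sum.inr j)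
      + ∑ i : Fin n, (algebraMap ℂ _ (p * (p + 2 * q + 1)) *
          (var (Sum.inl i) / (var (Sum.inl i) - 1) ^ 2)
        + algebraMap ℂ _ (4 * q * (q + 1)) *
          (var (Sum.inl i) ^ 2 / (var (Sum.inl i) ^ 2 - 1) ^ 2))
      + ∑ j : Fin m, (algebraMap ℂ _ (k * r * (r + 2 * s + 1)) *
          (var (Sum.inr j) / (var (Sum.inr j) - 1) ^ 2)
        + algebraMap ℂ _ (4 * k * s * (s + 1)) *
          (var (Sum.inr j) ^ 2 / (var (Sum.inr j) ^ 2 - 1) ^ 2))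
      + algebraMap ℂ _ (∑ i, (κ i)⁻¹ * (p / 2 + (q + (1 - κ i) / 2)) ^ 2) := by
    have hpair : ∑ i, ∑ j ∈ {i}ᶜ,
        algebraMap ℂ _ (2 * k / κ j * (1 + k / κ i ^ 2)) * pairPot i j =
        2 * (algebraMap ℂ _ (2 * k * (k + 1)) *
          ∑ i : Fin n, ∑ j ∈ Finset.Ioi i, pairPot (Sum.inl i) (Sum.inl j)
        + algebraMap ℂ _ (2 * (k⁻¹ + 1)) *
          ∑ i : Fin m, ∑ j ∈ Finset.Ioi i, pairPot (Sum.inr i) (Sum.inr j)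
        + algebraMap ℂ _ (2 * (k + 1)) *
          ∑ i : Fin n, ∑ j : Fin m, pairPot (ι := Idx n m) (Sum.inl i) (Sum.inr j)) := by
      -- The three pair couplings of the deformed operator arise from one formula in the weights;
      -- the mixed coupling appears twice, once for each order of the pair.
      have c1 : 2 * k / 1 * (1 + k / 1 ^ 2) = 2 * k * (k + 1) := by ring
      have c2 : 2 * k / k * (1 + k / 1 ^ 2) = 2 * (k + 1) := by field_simp; ring
      have c3 : 2 * k / 1 * (1 + k / k ^ 2) = 2 * (k + 1) := by field_simp
      have c4 : 2 * k / k * (1 + k / k ^ 2) = 2 * (k⁻¹ + 1) := by field_simp; ring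
      have d1 := sum_offdiag_symm (fun i j : Fin n =>
        pairPot (Sum.inl i : Idx n m) (Sum.inl j)) fun i j => pairPot_comm _ _
      have d2 := sum_offdiag_symm (fun i j : Fin m =>
        pairPot (Sum.inr i : Idx n m) (Sum.inr j)) fun i j => pairPot_comm _ _
      have d3 : ∑ i : Fin m, ∑ j : Fin n, pairPot (Sum.inr i : Idx n m) (Sum.inl j) =
          ∑ i : Fin n, ∑ j : Fin m, pairPot (Sum.inl i) (Sum.inr j) := by
        rw [Finset.sum_comm]
        exact Finset.sum_congr rfl fun i _ => Finset.sum_congr rfl fun j _ => pairPot_comm _ _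
      rw [Fintype.sum_sum_type]
      simp only [sum_compl_inl, sum_compl_inr, κl, κr, c1, c2, c3, c4, ← Finset.mul_sum,
        Finset.sum_add_distrib, d1, d2, d3]
      simp only [nsmul_eq_mul]
      push_cast
      ring
    have hS1 : ∀ i : Fin n, laxS p q κ (Sum.inl (Sum.inl i)) =
        algebraMap ℂ _ ((κ (Sum.inl i))⁻¹ * (p / 2 + (q + (1 - κ (Sum.inl i)) / 2)) ^ 2)
        + (algebraMap ℂ _ (p * (p + 2 * q + 1)) * (var (Sum.inl i) / (var (Sum.inl i) - 1) ^ 2)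
        + algebraMap ℂ _ (4 * q * (q + 1)) *
          (var (Sum.inl i) ^ 2 / (var (Sum.inl i) ^ 2 - 1) ^ 2)) := by
      intro i
      rw [laxS_inl, κl]
      congr 3 <;> congr 1 <;> ring
    have hS2 : ∀ j : Fin m, laxS p q κ (Sum.inl (Sum.inr j)) =
        algebraMap ℂ _ ((κ (Sum.inr j))⁻¹ * (p / 2 + (q + (1 - κ (Sum.inr j)) / 2)) ^ 2)
        + (algebraMap ℂ _ (k * r * (r + 2 * s + 1)) *
          (var (Sum.inr j) / (var (Sum.inr j) - 1) ^ 2)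
        + algebraMap ℂ _ (4 * k * s * (s + 1)) *
          (var (Sum.inr j) ^ 2 / (var (Sum.inr j) ^ 2 - 1) ^ 2)) := by
      intro j
      rw [laxS_inl, κr, ← hs, hp]
      congr 3 <;> congr 1 <;> field_simp
    rw [laxV_eq, hpair, Fintype.sum_sum_type, Finset.sum_congr rfl fun i _ => hS1 i,
      Finset.sum_congr rfl fun i _ => hS2 i, Fintype.sum_sum_type]
    simp only [Finset.sum_add_distrib, map_add, map_sum]
    rw [map_div₀, map_one, map_ofNat]
    ring
  rw [laxH, hV, deformedCMS, hD]
  generalize ∑ i, (κ i)⁻¹ * (p / 2 + (q + (1 - κ i) / 2)) ^ 2 = c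
  simp only [mulOp_eq, pairPot, ← Algebra.smul_def, map_add, map_sum, map_smul, hconst]
  abel

theorem deformedIntegral_commute_deformedCMS (hk : k ≠ 0) (hp : p = k * r)
    (hq : 2 * q + 1 = k * (2 * s + 1)) (l : ℕ) :
    Commute (deformedIntegral n m k p q r s l) (deformedCMS n m k p q r s) := by
  obtain ⟨c, hc⟩ := deformedCMS_eq (n := n) (m := m) hk hp hq
  rw [deformedIntegral_eq hk hp hq, hc]
  exact Commute.add_right (laxIntegral_commute (isWeight_parity hk) (isConnection_theta _) _)
    (Algebra.commutes c _).symm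

theorem deformedIntegral_commute (hk : k ≠ 0) (hp : p = k * r)
    (hq : 2 * q + 1 = k * (2 * s + 1)) (l l' : ℕ) :
    Commute (deformedIntegral n m k p q r s l) (deformedIntegral n m k p q r s l') := by
  rw [deformedIntegral_eq hk hp hq, deformedIntegral_eq hk hp hq]
  exact laxIntegral_commute_laxIntegral (isConnection_theta _) (isWeight_parity hk) _ _

end DeformedSystem

/-! ### Specialization of the algebra at infinity -/

section Specialization

variable {N : ℕ}

variable (N) in
/-- The extension of `phi N` to `Λ̄[x, x⁻¹]` with `x ↦ svar a`. -/
def phiAt (a : Fin N ⊕ Fin N) : LambdaBarX →+* RatField (Fin N) :=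
  LaurentPolynomial.eval₂ (phi N).toRingHom (Units.mk0 (svar a) (svar_ne_zero a))

theorem phiAt_C (a : Fin N ⊕ Fin N) (c : LambdaBar) :
    phiAt N a (LaurentPolynomial.C c) = phi N c :=
  LaurentPolynomial.eval₂_C _ _ _

theorem phiAt_T (a : Fin N ⊕ Fin N) (l : ℤ) :
    phiAt N a (LaurentPolynomial.T l) = svar a ^ l := by
  rw [phiAt, LaurentPolynomial.eval₂_T, Units.val_zpow_eq_zpow_val, Units.val_mk0]

theorem phiAt_smul (a : Fin N ⊕ Fin N) (c : ℂ) (F : LambdaBarX) :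
    phiAt N a (c • F) = c • phiAt N a F := by
  have h : c • F = LaurentPolynomial.C (algebraMap ℂ LambdaBar c) * F := by
    rw [Algebra.smul_def]; rfl
  rw [h, map_mul, phiAt_C, AlgHom.commutes, Algebra.smul_def]

theorem phiAt_smul' (a : Fin N ⊕ Fin N) (c : LambdaBar) (F : LambdaBarX) :
    phiAt N a (c • F) = phi N c * phiAt N a F := by
  rw [LaurentPolynomial.smul_eq_C_mul, map_mul, phiAt_C]

theorem phiAt_invert (a : Fin N ⊕ Fin N) (F : LambdaBarX) :
    phiAt N a (LaurentPolynomial.invert F) = phiAt N a.swap F := by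
  induction F using AddMonoidAlgebra.induction_linear with
  | zero => simp
  | add F G hF hG => rw [map_add, map_add, map_add, hF, hG]
  | single l c =>
    rw [LaurentPolynomial.single_eq_C_mul_T, map_mul, map_mul, map_mul,
      LaurentPolynomial.invert_C, LaurentPolynomial.invert_T, phiAt_C, phiAt_C, phiAt_T, phiAt_T,
      svar_swap, inv_zpow']

theorem phi_pgen (j : ℤ) : phi N (pgen j) = ∑ a : Fin N ⊕ Fin N, svar a ^ j := by
  have h (n : ℕ) : ∑ i : Fin N, ((var i : RatField (Fin N)) ^ n + (var i)⁻¹ ^ n) =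
      ∑ a : Fin N ⊕ Fin N, svar a ^ n := by
    rw [Fintype.sum_sum_type, Finset.sum_add_distrib]; rfl
  rw [pgen, phi, MvPolynomial.aeval_X, h]
  rcases Int.natAbs_eq j with e | e
  · conv_rhs => rw [e]
    simp only [zpow_natCast]
  · conv_rhs => rw [e, ← Equiv.sum_comp (Equiv.sumComm (Fin N) (Fin N))]
    refine Finset.sum_congr rfl fun a _ => ?_
    rw [Equiv.sumComm_apply, svar_swap, inv_zpow', neg_neg, zpow_natCast]

/-- Since `p_j` becomes the sum of `j`-th powers of all signed variables, `E` becomes the pairing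
with the vector of ones. -/
theorem phi_traceE (F : LambdaBarX) : phi N (traceE F) = ∑ a, phiAt N a F := by
  induction F using AddMonoidAlgebra.induction_linear with
  | zero => simp
  | add F G hF hG => rw [map_add, map_add, hF, hG, ← Finset.sum_add_distrib]; simp
  | single l c =>
    rw [traceE, onPowers_single, smul_eq_mul, map_mul, phi_pgen, Finset.mul_sum]
    refine Finset.sum_congr rfl fun a _ => ?_
    rw [LaurentPolynomial.single_eq_C_mul_T, map_mul, phiAt_C, phiAt_T]

theorem stheta_svar_zpow (a b : Fin N ⊕ Fin N) (l : ℤ) :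
    stheta a (svar b ^ l) = ((l : ℂ) * spair a b) • svar b ^ l := by
  have h (n : ℕ) : stheta a (svar b ^ n) = ((n : ℂ) * spair a b) • svar b ^ n := by
    induction n with
    | zero => simp
    | succ n ih =>
      rw [pow_succ, Derivation.leibniz, ih, stheta_svar]
      simp only [smul_eq_mul, Algebra.smul_def]
      rw [Nat.cast_succ, map_mul, map_mul, map_add, map_one]
      ring
  obtain ⟨n, rfl | rfl⟩ := l.eq_nat_or_neg
  · rw [zpow_natCast, h]; norm_cast
  · rw [zpow_neg, zpow_natCast, theta_inv _ _ _ (h n)]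
    congr 1
    push_cast; ring

theorem stheta_phi (a : Fin N ⊕ Fin N) (f : LambdaBar) :
    stheta a (phi N f) = phiAt N a (derivP f) := by
  induction f using MvPolynomial.induction_on with
  | C c =>
    rw [← MvPolynomial.algebraMap_eq, AlgHom.commutes, Derivation.map_algebraMap,
      Derivation.map_algebraMap, map_zero]
  | add f g hf hg => simp only [map_add, hf, hg]
  | mul_X f l hf =>
    have h1 : phi N (MvPolynomial.X l) = ∑ a : Fin N ⊕ Fin N, svar a ^ (l : ℤ) := phi_pgen l
    have h2 : stheta a (phi N (MvPolynomial.X l)) = phiAt N a (derivP (MvPolynomial.X l)) := by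
      rw [h1, derivP, MvPolynomial.mkDerivation_X, phiAt_smul, map_sub, phiAt_T, phiAt_T, map_sum]
      simp only [stheta_svar_zpow]
      have h3 (b : Fin N ⊕ Fin N) : (((l : ℤ) : ℂ) * spair a b) • svar b ^ (l : ℤ) =
          (if b = a then (l : ℂ) • svar a ^ (l : ℤ) else 0)
            + (if b = a.swap then -((l : ℂ) • svar a ^ (-(l : ℤ))) else 0) := by
        have := swap_ne a
        rw [spair]
        by_cases e : b = a
        · subst e
          simp [this.symm]
        · by_cases e' : b = a.swap
          · subst e'
            simp [this, svar_swap]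
          · simp [e, e']
      simp only [h3, Finset.sum_add_distrib, Finset.sum_ite_eq', Finset.mem_univ, if_true]
      rw [smul_sub, sub_eq_add_neg]
    rw [map_mul, Derivation.leibniz, Derivation.leibniz, map_add, phiAt_smul', phiAt_smul', hf, h2]
    rfl

theorem phiAt_derivInf (a : Fin N ⊕ Fin N) (F : LambdaBarX) :
    phiAt N a (derivInf F) = stheta a (phiAt N a F) := by
  induction F using AddMonoidAlgebra.induction_linear with
  | zero => simp
  | add F G hF hG => simp only [map_add, hF, hG]
  | single l c =>
    change phiAt N a (derivLin _) = _
    rw [derivLin_single, LaurentPolynomial.single_eq_C_mul_T, map_mul, map_mul, map_add,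
      phiAt_smul, phiAt_C, phiAt_T, Derivation.leibniz, stheta_svar_zpow, stheta_phi, spair_self]
    simp only [smul_eq_mul, Algebra.smul_def, mul_one]
    ring

theorem ctg_mul_pow_sub_pow {a b : Fin N ⊕ Fin N} (h : a ≠ b) {l : ℕ} (hl : 0 < l) :
    ctg a b * (svar a ^ l - svar b ^ l) = svar a ^ l + svar b ^ l
      + 2 * ∑ j ∈ Finset.Ico 1 l, svar b ^ j * svar a ^ (l - j) := by
  have h1 := svar_sub_ne_zero h
  rw [ctg, div_mul_eq_mul_div, div_eq_iff h1]
  induction l, hl using Nat.le_induction with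
  | base => simp
  | succ l hl ih =>
    have e : ∑ j ∈ Finset.Ico 1 (l + 1), svar b ^ j * svar a ^ (l + 1 - j) =
        svar a * ∑ j ∈ Finset.Ico 1 l, svar b ^ j * svar a ^ (l - j) + svar b ^ l * svar a := by
      rw [Finset.sum_Ico_succ_top hl, Nat.add_sub_cancel_left, pow_one, Finset.mul_sum]
      congr 1
      refine Finset.sum_congr rfl fun j hj => ?_
      rw [Finset.mem_Ico] at hj
      rw [Nat.succ_sub hj.2.le, pow_succ]; ring
    rw [e]
    linear_combination svar a * ih

theorem ctg_self (a : Fin N ⊕ Fin N) : ctg a a = 0 := by simp [ctg]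

theorem phiAt_deltaPos (a : Fin N ⊕ Fin N) {l : ℕ} (hl : 0 < l) :
    phiAt N a (deltaPos l) = ∑ b, ctg a b * (svar a ^ l - svar b ^ l)
      - ctg a a.swap * (svar a ^ l - svar a.swap ^ l) := by
  have h0 := svar_ne_zero a
  -- At `b = a` the left side is 0, whereas the geometric expression gives `2l x^l`; removing it
  -- accounts for the `-2l` in `Δ`.
  have h1 (b : Fin N ⊕ Fin N) : ctg a b * (svar a ^ l - svar b ^ l) =
      (svar a ^ l + svar b ^ l + 2 * ∑ j ∈ Finset.Ico 1 l, svar b ^ j * svar a ^ (l - j))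
      - if b = a then (2 * l : RatField (Fin N)) * svar a ^ l else 0 := by
    by_cases e : b = a
    · subst e
      have : ∑ j ∈ Finset.Ico 1 l, svar b ^ j * svar b ^ (l - j) =
          ((l - 1 : ℕ) : RatField (Fin N)) * svar b ^ l := by
        rw [Finset.sum_congr rfl (g := fun _ => svar b ^ l), Finset.sum_const, Nat.card_Ico,
          nsmul_eq_mul]
        intro j hj
        rw [Finset.mem_Ico] at hj
        rw [← pow_add]; congr 1; omega
      rw [this, if_pos rfl, Nat.cast_sub (by omega)]
      push_cast; ring
    · rw [if_neg e, ctg_mul_pow_sub_pow (Ne.symm e) hl, sub_zero]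
  have hp (j : ℕ) : ∑ b : Fin N ⊕ Fin N, svar b ^ j = phi N (pgen j) := by
    rw [phi_pgen]; simp only [zpow_natCast]
  have hp0 : phi N (pgen 0) = ((Fintype.card (Fin N ⊕ Fin N) : ℕ) : RatField (Fin N)) := by
    rw [phi_pgen]; simp
  have hz1 : ∀ j ∈ Finset.Ico 1 l, svar a ^ ((l : ℤ) - 2 * j) =
      svar a.swap ^ j * svar a ^ (l - j) := by
    intro j hj
    rw [Finset.mem_Ico] at hj
    rw [svar_swap, ← zpow_natCast, ← zpow_natCast, inv_zpow', ← zpow_add₀ h0]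
    congr 1; omega
  have hz2 : ∀ j ∈ Finset.Ico 1 l, phi N (pgen j) * svar a ^ ((l : ℤ) - j) =
      phi N (pgen j) * svar a ^ (l - j) := by
    intro j hj
    rw [Finset.mem_Ico] at hj
    rw [← zpow_natCast]
    congr 2; omega
  rw [Finset.sum_congr rfl fun b _ => h1 b, ctg_mul_pow_sub_pow (swap_ne a).symm hl,
    Finset.sum_sub_distrib, Finset.sum_ite_eq', if_pos (Finset.mem_univ a), Finset.sum_add_distrib,
    Finset.sum_add_distrib, hp, ← Finset.mul_sum, Finset.sum_comm,
    Finset.sum_const, Finset.card_univ, nsmul_eq_mul, ← hp0]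
  simp only [← Finset.sum_mul, hp]
  simp only [deltaPos, map_add, map_sub, map_mul, map_sum, phiAt_C, phiAt_T, map_ofNat, map_natCast,
    map_one]
  rw [Finset.sum_congr rfl hz1, Finset.sum_congr rfl hz2]
  simp only [zpow_natCast, svar_swap, zpow_neg, inv_pow]
  ring

theorem deltaNeg_eq (l : ℕ) : deltaNeg l = -LaurentPolynomial.invert (deltaPos l) := by
  have h : ∑ j ∈ Finset.Ico 1 l, (LaurentPolynomial.T ((l : ℤ) - 2 * j) : LambdaBarX) =
      ∑ j ∈ Finset.Ico 1 l, LaurentPolynomial.T (-((l : ℤ) - 2 * j)) := by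
    refine Finset.sum_nbij' (fun j => l - j) (fun j => l - j) ?_ ?_ ?_ ?_ ?_ <;>
      intro j hj <;> simp only [Finset.mem_Ico] at hj ⊢
    · omega
    · omega
    · omega
    · omega
    · congr 1; omega
  simp only [deltaNeg, deltaPos, map_add, map_sub, map_mul, map_sum, LaurentPolynomial.invert_C,
    LaurentPolynomial.invert_T, map_ofNat, map_natCast, map_one, neg_neg]
  rw [h]
  simp only [neg_sub, neg_add_eq_sub]
  ring

theorem phiAt_Delta (a : Fin N ⊕ Fin N) (F : LambdaBarX) :
    phiAt N a (Delta F) = ∑ b, ctg a b * (phiAt N a F - phiAt N b F)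
      - ctg a a.swap * (phiAt N a F - phiAt N a.swap F) := by
  induction F using AddMonoidAlgebra.induction_linear with
  | zero => simp
  | add F G hF hG =>
    simp only [map_add, hF, hG, add_sub_add_comm, mul_add, Finset.sum_add_distrib]
  | single l c =>
    rw [Delta, onPowers_single, phiAt_smul']
    have key : phiAt N a (if 0 < l then deltaPos l.natAbs else if l < 0 then deltaNeg l.natAbs
        else 0) = ∑ b, ctg a b * (svar a ^ l - svar b ^ l)
          - ctg a a.swap * (svar a ^ l - svar a.swap ^ l) := by
      rcases lt_trichotomy l 0 with h | rfl | h
      · rw [if_neg h.not_gt, if_pos h, deltaNeg_eq, map_neg, phiAt_invert,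
          phiAt_deltaPos _ (by omega), ← Equiv.sum_comp (Equiv.sumComm (Fin N) (Fin N)),
          neg_sub, Sum.swap_swap]
        have e (b : Fin N ⊕ Fin N) : svar b.swap ^ l.natAbs = svar b ^ l := by
          rw [svar_swap, ← zpow_natCast, inv_zpow']; congr 1; omega
        have e' : svar a ^ l.natAbs = svar a.swap ^ l := by
          rw [svar_swap, ← zpow_natCast, inv_zpow']; congr 1; omega
        simp only [Equiv.sumComm_apply, e, ctg_swap_swap, e', ctg_comm a]
        simp only [neg_mul, Finset.sum_neg_distrib]
        ring
      · simp
      · rw [if_pos h, phiAt_deltaPos _ (by omega)]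
        have e (b : Fin N ⊕ Fin N) : svar b ^ l.natAbs = svar b ^ l := by
          rw [← zpow_natCast]; congr 1; omega
        simp only [e]
    rw [key, LaurentPolynomial.single_eq_C_mul_T]
    simp only [map_mul, phiAt_C, phiAt_T, ← mul_sub, mul_left_comm _ (phi N c), ← Finset.mul_sum]

theorem phiAt_reflOne (a : Fin N ⊕ Fin N) (F : LambdaBarX) :
    phiAt N a (reflOne F) = ctgOne a * (phiAt N a F - phiAt N a.swap F) := by
  have h := congrArg (phiAt N a) (reflOne_spec F)
  simp only [map_mul, map_sub, map_add, map_one, phiAt_T, zpow_one, phiAt_invert] at h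
  rw [ctgOne, div_mul_eq_mul_div, ← h, mul_div_cancel_left₀ _ (svar_sub_one_ne_zero a)]

theorem phiAt_reflTwo (a : Fin N ⊕ Fin N) (F : LambdaBarX) :
    phiAt N a (reflTwo F) = ctg a a.swap * (phiAt N a F - phiAt N a.swap F) := by
  have h := congrArg (phiAt N a) (reflTwo_spec F)
  have e : svar a ^ (2 : ℤ) = svar a ^ 2 := by norm_cast
  simp only [map_mul, map_sub, map_add, map_one, phiAt_T, e, phiAt_invert] at h
  rw [ctg_swap_self, div_mul_eq_mul_div, ← h,
    mul_div_cancel_left₀ _ (svar_sq_sub_one_ne_zero a)]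

/-- The operator at infinity, specialized at all signed variables at once. -/
theorem phiAt_dunklInf (k p q : ℂ) (a : Fin N ⊕ Fin N) (F : LambdaBarX) :
    phiAt N a (dunklInf k p q F) = stheta a (phiAt N a F)
      - (k / 2) • (∑ b, ctg a b * (phiAt N a F - phiAt N b F)
          - ctg a a.swap * (phiAt N a F - phiAt N a.swap F))
      - (p / 2) • (ctgOne a * (phiAt N a F - phiAt N a.swap F))
      - q • (ctg a a.swap * (phiAt N a F - phiAt N a.swap F)) := by
  rw [← phiAt_derivInf, ← phiAt_Delta, ← phiAt_reflOne, ← phiAt_reflTwo, ← phiAt_smul,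
    ← phiAt_smul, ← phiAt_smul, ← map_sub, ← map_sub, ← map_sub]
  rfl

/-- The operator changes sign under inversion of `x`, so even powers applied to `Λ̄` agree at
opposite indices. This is the source of the factor 2 relative to Heckman's integrals. -/
theorem phiAt_swap_dunklInf_pow (k p q : ℂ) (f : LambdaBar) (n : ℕ) (a : Fin N ⊕ Fin N) :
    phiAt N a.swap ((dunklInf k p q ^ n) (LaurentPolynomial.C f)) =
      (-1) ^ n * phiAt N a ((dunklInf k p q ^ n) (LaurentPolynomial.C f)) := by
  induction n generalizing a with
  | zero => simp [phiAt_C]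
  | succ n ih =>
    rw [pow_succ', Module.End.mul_apply, phiAt_dunklInf, phiAt_dunklInf, Sum.swap_swap]
    set F := (dunklInf k p q ^ n) (LaurentPolynomial.C f)
    have ih' := ih a
    have e : stheta a.swap (phiAt N a.swap F) = (-1) ^ (n + 1) * stheta a (phiAt N a F) := by
      rw [ih, stheta_swap]
      have := (stheta a).map_smul ((-1) ^ n) (phiAt N a F)
      rw [Algebra.smul_def, Algebra.smul_def, map_pow, map_neg, map_one] at this
      rw [Derivation.neg_apply, this]
      ring
    have e2 : ∑ b, ctg a.swap b * (phiAt N a.swap F - phiAt N b F) =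
        (-1) ^ (n + 1) * ∑ b, ctg a b * (phiAt N a F - phiAt N b F) := by
      rw [← Equiv.sum_comp (Equiv.sumComm (Fin N) (Fin N)), Finset.mul_sum]
      refine Finset.sum_congr rfl fun b _ => ?_
      rw [Equiv.sumComm_apply, ctg_swap_swap, ih, ih]
      ring
    have e3 : phiAt N a F = (-1) ^ n * phiAt N a.swap F := by
      rw [ih, ← mul_assoc, ← pow_add, Even.neg_one_pow ⟨n, rfl⟩, one_mul]
    rw [e, e2, ctgOne_swap, show ctg a.swap a = -ctg a a.swap from ctg_comm _ _]
    have e4 : phiAt N a.swap F - phiAt N a F =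
        (-1) ^ n * (phiAt N a F - phiAt N a.swap F) := by
      rw [mul_sub, ← ih, ← e3]
    rw [e4]
    simp only [Algebra.smul_def]
    ring

end Specialization

/-! ### The Dunkl–Heckman operators -/

section Heckman

variable {N : ℕ}

theorem algEquiv_phi (w : RatField (Fin N) ≃ₐ[ℂ] RatField (Fin N))
    (π : Equiv.Perm (Fin N ⊕ Fin N)) (h : ∀ a, w (svar a) = svar (π a)) (f : LambdaBar) :
    w (phi N f) = phi N f := by
  have : (w : RatField (Fin N) →ₐ[ℂ] RatField (Fin N)).comp (phi N) = phi N := by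
    refine MvPolynomial.algHom_ext fun l => ?_
    have h1 : phi N (MvPolynomial.X l) = ∑ a : Fin N ⊕ Fin N, svar a ^ (l : ℤ) := phi_pgen l
    change w (phi N (MvPolynomial.X l)) = _
    rw [h1, map_sum]
    conv_rhs => rw [← Equiv.sum_comp π]
    exact Finset.sum_congr rfl fun a _ => by rw [map_zpow₀, h]
  exact DFunLike.congr_fun this f

theorem algEquiv_phiAt (w : RatField (Fin N) ≃ₐ[ℂ] RatField (Fin N))
    (π : Equiv.Perm (Fin N ⊕ Fin N)) (h : ∀ a, w (svar a) = svar (π a)) (a : Fin N ⊕ Fin N)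
    (F : LambdaBarX) : w (phiAt N a F) = phiAt N (π a) F := by
  induction F using AddMonoidAlgebra.induction_linear with
  | zero => simp
  | add F G hF hG => rw [map_add, map_add, map_add, hF, hG]
  | single l c =>
    rw [LaurentPolynomial.single_eq_C_mul_T, map_mul, map_mul, map_mul, phiAt_C, phiAt_C, phiAt_T,
      phiAt_T, algEquiv_phi w π h, map_zpow₀, h]

/-- The permutation of the signed indices induced by `s_{ij}^+`. -/
def permPlus (i j : Fin N) : Equiv.Perm (Fin N ⊕ Fin N) :=
  Equiv.sumCongr (Equiv.swap i j) (Equiv.swap i j)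

/-- The permutation of the signed indices induced by `t_i`. -/
def permInv (i : Fin N) : Equiv.Perm (Fin N ⊕ Fin N) := Equiv.swap (Sum.inl i) (Sum.inr i)

theorem sPlus_svar (i j : Fin N) (a : Fin N ⊕ Fin N) :
    sPlus i j (svar a) = svar (permPlus i j a) := by
  rcases a with a | a
  · exact sPlus_var i j a
  · change sPlus i j (var a)⁻¹ = _
    rw [map_inv₀, sPlus_var]; rfl

theorem tInv_svar (i : Fin N) (a : Fin N ⊕ Fin N) : tInv i (svar a) = svar (permInv i a) := by
  rw [permInv, Equiv.swap_apply_def]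
  rcases a with a | a
  · change tInv i (var a) = _
    rw [tInv_var]
    by_cases h : i = a
    · simp [h, svar]
    · simp [h, Ne.symm h, svar]
  · change tInv i (var a)⁻¹ = _
    rw [map_inv₀, tInv_var]
    by_cases h : i = a
    · simp [h, svar]
    · simp [h, Ne.symm h, svar]

theorem sMinus_svar (i j : Fin N) (a : Fin N ⊕ Fin N) :
    sMinus i j (svar a) = svar (((permPlus i j).trans ((permInv i).trans (permInv j))) a) := by
  change tInv j (tInv i (sPlus i j (svar a))) = _
  rw [sPlus_svar, tInv_svar, tInv_svar]; rfl

theorem phi_mem_invariants (f : LambdaBar) : phi N f ∈ invariants N := by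
  refine ⟨?_, fun i j _ => ⟨algEquiv_phi _ _ (sPlus_svar i j) f,
      algEquiv_phi _ _ (sMinus_svar i j) f⟩,
    fun i => algEquiv_phi _ _ (tInv_svar i) f⟩
  change phi N f ∈ (algebraMap (LaurentRing (Fin N)) (RatField (Fin N))).range
  have h1 (i : Fin N) :
      (var i)⁻¹ ∈ (algebraMap (LaurentRing (Fin N)) (RatField (Fin N))).range := by
    refine ⟨AddMonoidAlgebra.single (Finsupp.single i (-1)) 1, ?_⟩
    apply eq_inv_of_mul_eq_one_left
    rw [var, ← map_mul, laurentVar, AddMonoidAlgebra.single_mul_single, ← Finsupp.single_add]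
    simp [← AddMonoidAlgebra.one_def]
  induction f using MvPolynomial.induction_on with
  | C c =>
    refine ⟨algebraMap ℂ _ c, ?_⟩
    rw [← MvPolynomial.algebraMap_eq, AlgHom.commutes, ← IsScalarTower.algebraMap_apply]
  | add f g hf hg => rw [map_add]; exact Subring.add_mem _ hf hg
  | mul_X f l hf =>
    rw [map_mul]
    refine Subring.mul_mem _ hf ?_
    rw [phi, MvPolynomial.aeval_X]
    exact Subring.sum_mem _ fun i _ => Subring.add_mem _ (Subring.pow_mem _
      (RingHom.mem_range_self _ _) _)
      (Subring.pow_mem _ (h1 i) _)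

theorem dunkl_apply (k p q : ℂ) (i : Fin N) (g : RatField (Fin N)) :
    dunkl N k p q i g = theta i g
      - (k / 2) • ∑ j ∈ {i}ᶜ, (ctg (Sum.inl i) (Sum.inl j) * (g - sPlus i j g)
          + ctg (Sum.inl i) (Sum.inr j) * (g - sMinus i j g))
      - (p / 2) • (ctgOne (Sum.inl i) * (g - tInv i g))
      - q • (ctg (Sum.inl i) (Sum.inr i) * (g - tInv i g)) := by
  have e (j : Fin N) : ctg (Sum.inl i : Fin N ⊕ Fin N) (Sum.inr j) =
      (var i * var j + 1) / (var i * var j - 1) := ctg_swap_right_eq (Sum.inl i) (Sum.inl j)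
  rw [e i, ← sq]
  simp only [e]
  rw [dunkl, Finset.compl_singleton]
  simp only [LinearMap.sub_apply, LinearMap.smul_apply, LinearMap.sum_apply, LinearMap.add_apply,
    Module.End.mul_apply]
  rfl

theorem sum_signed_offdiag {M : Type} [AddCommGroup M] (i : Fin N) (G : Fin N ⊕ Fin N → M)
    (h : G (Sum.inl i) = 0) :
    ∑ b, G b - G (Sum.inr i) = ∑ j ∈ {i}ᶜ, (G (Sum.inl j) + G (Sum.inr j)) := by
  rw [Fintype.sum_sum_type, ← Finset.sum_add_distrib,
    ← Finset.sum_compl_add_sum {i} (fun j => G (Sum.inl j) + G (Sum.inr j)),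
      Finset.sum_singleton, h]
  abel

theorem phiAt_dunklInf_inl (k p q : ℂ) (i : Fin N) (F : LambdaBarX) :
    phiAt N (Sum.inl i) (dunklInf k p q F) = dunkl N k p q i (phiAt N (Sum.inl i) F) := by
  have hp : ∀ j, permPlus i j (Sum.inl i) = Sum.inl j := fun j => by simp [permPlus]
  have ht : permInv i (Sum.inl i) = Sum.inr i := by simp [permInv]
  have hm : ∀ j ∈ ({i}ᶜ : Finset (Fin N)),
      ((permPlus i j).trans ((permInv i).trans (permInv j))) (Sum.inl i) = Sum.inr j := by
    intro j hj
    have hj : j ≠ i := by simpa using hj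
    simp [permPlus, permInv, Equiv.swap_apply_def, hj]
  rw [phiAt_dunklInf, dunkl_apply, algEquiv_phiAt _ _ (tInv_svar i), ht, Sum.swap_inl]
  congr 4
  rw [sum_signed_offdiag i (fun b => ctg (Sum.inl i) b *
    (phiAt N (Sum.inl i) F - phiAt N b F)) (by simp)]
  refine Finset.sum_congr rfl fun j hj => ?_
  rw [algEquiv_phiAt _ _ (sPlus_svar i j), algEquiv_phiAt _ _ (sMinus_svar i j), hp, hm j hj]

theorem phiAt_dunklInf_pow (k p q : ℂ) (i : Fin N) (n : ℕ) (F : LambdaBarX) :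
    phiAt N (Sum.inl i) ((dunklInf k p q ^ n) F) =
      (dunkl N k p q i ^ n) (phiAt N (Sum.inl i) F) := by
  induction n with
  | zero => simp
  | succ n ih =>
    rw [pow_succ', pow_succ', Module.End.mul_apply, Module.End.mul_apply, phiAt_dunklInf_inl, ih]

theorem phi_cmsInf (k p q : ℂ) (r : ℕ) (f : LambdaBar) :
    phi N (cmsInf k p q r f) =
      ∑ a, phiAt N a ((dunklInf k p q ^ (2 * r)) (LaurentPolynomial.C f)) :=
  phi_traceE _

theorem phi_cmsInf_eq_heckman (k p q : ℂ) (r : ℕ) (f : LambdaBar) :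
    phi N (cmsInf k p q r f) = 2 * heckman N k p q r (phi N f) := by
  have h (i : Fin N) : phiAt N (Sum.inr i) ((dunklInf k p q ^ (2 * r)) (LaurentPolynomial.C f)) =
      phiAt N (Sum.inl i) ((dunklInf k p q ^ (2 * r)) (LaurentPolynomial.C f)) := by
    have := phiAt_swap_dunklInf_pow k p q f (2 * r) (Sum.inl i)
    rwa [Even.neg_one_pow ⟨r, by ring⟩, one_mul] at this
  rw [phi_cmsInf, Fintype.sum_sum_type, Finset.sum_congr rfl fun i _ => h i, ← two_mul, heckman,
    LinearMap.sum_apply]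
  simp only [phiAt_dunklInf_pow, phiAt_C]

/-- Euler derivations read off coordinates of exponents, so on monomials the claim is the hypothesis
on `e`; the quotient rule extends it. -/
theorem ratAut_theta (e : (Fin N →₀ ℤ) ≃+ (Fin N →₀ ℤ)) (i j : Fin N) (ε : ℤ)
    (h : ∀ m, m i = ε * (e m) j) (g : RatField (Fin N)) :
    ratAut e (theta i g) = ε * theta j (ratAut e g) := by
  have h0 (F : LaurentRing (Fin N)) :
      ratAut e (theta i (algebraMap _ _ F)) = ε * theta j (ratAut e (algebraMap _ _ F)) := by
    rw [theta, theta, ratDeriv_algebraMap, ratAut, IsFractionRing.algEquivOfAlgEquiv_algebraMap,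
      IsFractionRing.algEquivOfAlgEquiv_algebraMap, ratDeriv_algebraMap, ← map_intCast (algebraMap
        (LaurentRing (Fin N)) (RatField (Fin N))), ← map_mul]
    congr 1
    change AddMonoidAlgebra.domCongr ℂ ℂ e (eulerLin i F) =
      ε * eulerLin j (AddMonoidAlgebra.domCongr ℂ ℂ e F)
    induction F using AddMonoidAlgebra.induction_linear with
    | zero => simp
    | add F G hF hG => simp only [map_add, hF, hG, mul_add]
    | single m c =>
      rw [eulerLin_single, map_smul, AddMonoidAlgebra.domCongr_single, eulerLin_single, h,
        ← zsmul_eq_mul, ← Int.cast_smul_eq_zsmul ℂ, smul_smul, Int.cast_mul]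
  obtain ⟨a, b, hb, rfl⟩ := IsFractionRing.div_surjective (A := LaurentRing (Fin N)) g
  rw [Derivation.leibniz_div, map_div₀, Derivation.leibniz_div]
  simp only [smul_eq_mul, map_mul, map_sub, h0, map_pow, map_inv₀]
  ring

theorem sPlus_theta (i j : Fin N) (g : RatField (Fin N)) :
    sPlus i j (theta i g) = theta j (sPlus i j g) := by
  have := ratAut_theta (Finsupp.domCongr (Equiv.swap i j)) i j 1 (fun m => by
    rw [Finsupp.domCongr_apply, Finsupp.equivMapDomain_apply]; simp) g
  rwa [Int.cast_one, one_mul] at this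

theorem tInv_theta_self (i : Fin N) (g : RatField (Fin N)) :
    tInv i (theta i g) = -theta i (tInv i g) := by
  have := ratAut_theta (negExponent i) i i (-1) (fun m => by simp [negExponent]; ring) g
  rwa [Int.cast_neg, Int.cast_one, neg_one_mul] at this

theorem tInv_theta_of_ne {i j : Fin N} (h : i ≠ j) (g : RatField (Fin N)) :
    tInv i (theta j g) = theta j (tInv i g) := by
  have := ratAut_theta (negExponent i) j j 1 (fun m => by simp [negExponent, h]) g
  rwa [Int.cast_one, one_mul] at this

theorem sMinus_theta {i j : Fin N} (h : i ≠ j) (g : RatField (Fin N)) :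
    sMinus i j (theta i g) = -theta j (sMinus i j g) := by
  change tInv j (tInv i (sPlus i j (theta i g))) = _
  rw [sPlus_theta, tInv_theta_of_ne h, tInv_theta_self]; rfl

/-- On an invariant all reflection terms drop out and `D_i g = ∂_i g`. In the second application the
reflections send `∂_i g` to `±∂_j g` or `-∂_i g`, which turns difference terms into first order
ones. -/
theorem heckman_one (k p q : ℂ) (g : RatField (Fin N)) (hg : g ∈ invariants N) :
    heckman N k p q 1 g = gaugedCMS N k p q g := by
  obtain ⟨-, hs, ht⟩ := hg
  have h1 (i : Fin N) : dunkl N k p q i g = theta i g := by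
    have : ∑ j ∈ {i}ᶜ, (ctg (Sum.inl i) (Sum.inl j) * (g - sPlus i j g)
          + ctg (Sum.inl i) (Sum.inr j) * (g - sMinus i j g)) = 0 := by
      refine Finset.sum_eq_zero fun j hj => ?_
      have hj : i ≠ j := fun h => by simp [h] at hj
      rw [(hs i j hj).1, (hs i j hj).2, sub_self, mul_zero, mul_zero, add_zero]
    rw [dunkl_apply, this, ht, sub_self, mul_zero, mul_zero, smul_zero, smul_zero, smul_zero,
      sub_zero, sub_zero, sub_zero]
  have h2 (i : Fin N) : dunkl N k p q i (theta i g) = theta i (theta i g)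
      - (k / 2) • ∑ j ∈ {i}ᶜ, (ctg (Sum.inl i) (Sum.inl j) * (theta i g - theta j g)
          + ctg (Sum.inl i) (Sum.inr j) * (theta i g + theta j g))
      - (p • mulOp (ctgOne (Sum.inl i)) + (2 * q) • mulOp (ctg (Sum.inl i) (Sum.inr i)))
          (theta i g) := by
    have : ∑ j ∈ {i}ᶜ, (ctg (Sum.inl i) (Sum.inl j) * (theta i g - sPlus i j (theta i g))
          + ctg (Sum.inl i) (Sum.inr j) * (theta i g - sMinus i j (theta i g))) =
        ∑ j ∈ {i}ᶜ, (ctg (Sum.inl i) (Sum.inl j) * (theta i g - theta j g)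
          + ctg (Sum.inl i) (Sum.inr j) * (theta i g + theta j g)) := by
      refine Finset.sum_congr rfl fun j hj => ?_
      have hj : i ≠ j := fun h => by simp [h] at hj
      rw [sPlus_theta, sMinus_theta hj, (hs i j hj).1, (hs i j hj).2, sub_neg_eq_add]
    rw [dunkl_apply, this, tInv_theta_self, ht, sub_neg_eq_add, LinearMap.add_apply,
      LinearMap.smul_apply, LinearMap.smul_apply, mulOp_eq, mulOp_eq, mulHom_apply, mulHom_apply,
      ← two_mul]
    simp only [Algebra.smul_def, map_mul, map_div₀, map_ofNat]
    ring
  have e1 (i j : Fin N) : (var i + var j) / (var i - var j) =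
      ctg (Sum.inl i : Fin N ⊕ Fin N) (Sum.inl j) := rfl
  have e2 (i j : Fin N) : (var i * var j + 1) / (var i * var j - 1) =
      ctg (Sum.inl i : Fin N ⊕ Fin N) (Sum.inr j) := (ctg_swap_right_eq (Sum.inl i) (Sum.inl
        j)).symm
  have e3 (i : Fin N) : (var i + 1) / (var i - 1) = ctgOne (Sum.inl i : Fin N ⊕ Fin N) := rfl
  have h3 : ∑ i : Fin N, (k / 2) • ∑ j ∈ {i}ᶜ,
      (ctg (Sum.inl i) (Sum.inl j) * (theta i g - theta j g)
          + ctg (Sum.inl i) (Sum.inr j) * (theta i g + theta j g)) =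
      k • ∑ i : Fin N, ∑ j ∈ Finset.Ioi i, ctg (Sum.inl i) (Sum.inl j) * (theta i g - theta j g)
        + k • ∑ i : Fin N, ∑ j ∈ Finset.Ioi i,
          ctg (Sum.inl i) (Sum.inr j) * (theta i g + theta j g) := by
    rw [← Finset.smul_sum, sum_offdiag_symm, ← smul_add, ← Finset.sum_add_distrib]
    · simp only [← Finset.sum_add_distrib]
      rw [← Nat.cast_smul_eq_nsmul ℂ, smul_smul]
      congr 1
      push_cast; ring
    · intro i j
      have : ctg (Sum.inl j : Fin N ⊕ Fin N) (Sum.inr i) = ctg (Sum.inl i) (Sum.inr j) :=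
        ctg_swap_right_comm (Sum.inl j) (Sum.inl i)
      rw [ctg_comm, this]
      ring
  rw [heckman, LinearMap.sum_apply, gaugedCMS]
  have h4 (i : Fin N) : (dunkl N k p q i ^ (2 * 1)) g = dunkl N k p q i (theta i g) := by
    rw [mul_one, sq, Module.End.mul_apply, h1]
  simp only [h4, h2, Finset.sum_sub_distrib, h3]
  simp only [LinearMap.sub_apply, LinearMap.sum_apply, LinearMap.smul_apply, e1, e2, e3,
    Module.End.mul_apply, ← sub_sub]
  simp only [sq, e2]
  rfl

end Heckman

/-! ### The gauge transformation to the Lax matrix -/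

section Gauge

variable {N : ℕ}

/-- The logarithmic derivative of the ground state in the direction of a signed variable. -/
def gauge (k p q : ℂ) (a : Fin N ⊕ Fin N) : RatField (Fin N) :=
  -((k / 2) • (∑ b, ctg a b - ctg a a.swap) + (p / 2) • ctgOne a + q • ctg a a.swap)

/-- The connection attached to the ground state. -/
def gaugedOp (k p q : ℂ) (i : Fin N) : Module.End ℂ (RatField (Fin N)) :=
  thetaOp i + mulHom (Fin N) (gauge k p q (Sum.inl i))

theorem gauge_swap (k p q : ℂ) (a : Fin N ⊕ Fin N) : gauge k p q a.swap = -gauge k p q a := by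
  have h : ∑ b, ctg a.swap b = -∑ b, ctg a b := by
    rw [← Equiv.sum_comp (Equiv.sumComm (Fin N) (Fin N)), ← Finset.sum_neg_distrib]
    exact Finset.sum_congr rfl fun b _ => ctg_swap_swap a b
  rw [gauge, gauge, h, ctg_swap_swap, ctgOne_swap]
  module

/-- Closedness of the logarithmic differential of the ground state, which makes the gauged operators
commute; no ground state has to be constructed. -/
theorem theta_gauge_symm (k p q : ℂ) (i j : Fin N) :
    theta i (gauge k p q (Sum.inl j)) = theta j (gauge k p q (Sum.inl i)) := by
  rcases eq_or_ne i j with rfl | hij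
  · rfl
  have h (i j : Fin N) (hij : i ≠ j) : theta i (gauge k p q (Sum.inl j)) =
      -((k / 2) • ((1 / 2 : ℂ) • (ctg (Sum.inl j) (Sum.inl i) ^ 2 -
        ctg (Sum.inl j) (Sum.inr i) ^ 2))) := by
    have e (b : Fin N ⊕ Fin N) : stheta (Sum.inl i) (ctg (Sum.inl j) b) =
        (if b = Sum.inl i then (1 / 2 : ℂ) • (ctg (Sum.inl j) (Sum.inl i) ^ 2 - 1) else 0) +
        (if b = Sum.inr i then -((1 / 2 : ℂ) • (ctg (Sum.inl j) (Sum.inr i) ^ 2 - 1)) else 0) := by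
      by_cases hb : b = Sum.inl j
      · subst hb; simp [ctg_self, hij.symm]
      rw [stheta_ctg _ (Ne.symm hb)]
      have e1 : spair (Sum.inl i : Fin N ⊕ Fin N) (Sum.inl j) = 0 :=
        spair_eq_zero (by simpa using hij.symm) (by simp)
      rw [e1]
      by_cases h1 : b = Sum.inl i
      · subst h1
        rw [spair_self, if_pos rfl, if_neg (by simp)]
        module
      by_cases h2 : b = Sum.inr i
      · subst h2
        have : spair (Sum.inl i : Fin N ⊕ Fin N) (Sum.inr i) = -1 := spair_swap_self (Sum.inl i)
        rw [this, if_pos rfl, if_neg (by simp)]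
        module
      · rw [spair_eq_zero h1 h2, if_neg h1, if_neg h2]; simp
    have e' : stheta (Sum.inl i) (ctg (Sum.inl j) (Sum.inr j)) = 0 := by
      rw [e, if_neg (by simp), if_neg (by simpa using hij.symm), add_zero]
    change stheta (Sum.inl i) _ = _
    rw [gauge, map_neg, map_add, map_add, Derivation.map_smul, Derivation.map_smul,
      Derivation.map_smul, map_sub, map_sum, Sum.swap_inl, e', stheta_ctgOne,
      spair_eq_zero (by simpa using hij.symm) (by simp)]
    simp only [e, Finset.sum_add_distrib, Finset.sum_ite_eq', Finset.mem_univ, if_true]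
    module
  rw [h i j hij, h j i hij.symm, ctg_comm (Sum.inl j) (Sum.inl i),
    show ctg (Sum.inl j : Fin N ⊕ Fin N) (Sum.inr i) = ctg (Sum.inl i) (Sum.inr j) from
      ctg_swap_right_comm (Sum.inl j) (Sum.inl i), neg_sq]

theorem isConnection_gaugedOp (k p q : ℂ) : IsConnection (mulHom (Fin N)) (gaugedOp k p q) where
  comm i j := by
    have h := isConnection_theta (Fin N)
    have h1 : mulHom (Fin N) (gauge k p q (Sum.inl i)) * mulHom (Fin N) (gauge k p q (Sum.inl j)) =
        mulHom (Fin N) (gauge k p q (Sum.inl j)) * mulHom (Fin N) (gauge k p q (Sum.inl i)) := by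
      rw [← map_mul, ← map_mul, mul_comm]
    simp only [gaugedOp, add_mul, mul_add, h.comm i j, h.leibniz, h1, theta_gauge_symm k p q i j]
    abel
  leibniz i f := by
    have h := isConnection_theta (Fin N)
    have h1 : mulHom (Fin N) (gauge k p q (Sum.inl i)) * mulHom (Fin N) f =
        mulHom (Fin N) f * mulHom (Fin N) (gauge k p q (Sum.inl i)) := by
      rw [← map_mul, ← map_mul, mul_comm]
    simp only [gaugedOp, add_mul, mul_add, h.leibniz, h1]
    abel

theorem signedOp_gaugedOp (k p q : ℂ) (a : Fin N ⊕ Fin N) (f : RatField (Fin N)) :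
    signedOp (gaugedOp k p q) a f = stheta a f + gauge k p q a * f := by
  rcases a with a | a
  · rfl
  · have := gauge_swap k p q (Sum.inl a : Fin N ⊕ Fin N)
    rw [Sum.swap_inl] at this
    rw [this]
    change -(theta a f + gauge k p q (Sum.inl a) * f) = -theta a f + _
    ring

/-- The operator at infinity acts on the vector of its specializations by the Lax matrix. -/
theorem phiAt_dunklInf_eq_laxL (k p q : ℂ) (a : Fin N ⊕ Fin N) (F : LambdaBarX) :
    phiAt N a (dunklInf k p q F) =
      ∑ b, laxL (mulHom (Fin N)) (gaugedOp k p q) k p q (fun _ => 1) a b (phiAt N b F) := by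
  have hw (a : Fin N ⊕ Fin N) : sweight (fun _ => (1 : ℂ)) a = 1 := by cases a <;> rfl
  -- The uniform term `(k/2) ctg a b` is split off for every `b`, since `ctg a a = 0`; at the
  -- opposite index this leaves `q - k/2`, matching the opposite root that `Δ` omits.
  have e (b : Fin N ⊕ Fin N) :
      laxL (mulHom (Fin N)) (gaugedOp k p q) k p q (fun _ => 1) a b (phiAt N b F) =
      (if b = a then stheta a (phiAt N a F) + gauge k p q a * phiAt N a F else 0)
      + (if b = a.swap then ((p / 2) • ctgOne a + (q - k / 2) • ctg a a.swap) * phiAt N a.swap F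
          else 0)
      + (k / 2) • (ctg a b * phiAt N b F) := by
    have h0 := swap_ne a
    rw [laxL, Matrix.of_apply, LinearMap.add_apply, mulHom_apply, laxX]
    by_cases h1 : b = a
    · subst h1
      rw [if_pos rfl, if_pos rfl, if_pos rfl, if_neg h0.symm, ctg_self, hw, one_smul,
        signedOp_gaugedOp]
      simp
    rw [if_neg h1, if_neg h1, if_neg (Ne.symm h1)]
    by_cases h2 : b = a.swap
    · subst h2
      rw [if_pos rfl, if_pos rfl, laxZ, hw]
      simp only [Algebra.smul_def, map_sub, map_div₀, map_ofNat, sub_self,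
        zero_div, add_zero, LinearMap.zero_apply]
      ring
    · rw [if_neg h2, if_neg h2, hw]
      simp only [Algebra.smul_def, map_div₀, map_mul, map_one, map_ofNat, LinearMap.zero_apply]
      ring
  rw [phiAt_dunklInf, Finset.sum_congr rfl fun b _ => e b]
  simp only [Finset.sum_add_distrib, Finset.sum_ite_eq', Finset.mem_univ, if_true, mul_sub,
    Finset.sum_sub_distrib, ← Finset.smul_sum, ← Finset.sum_mul, gauge]
  simp only [Algebra.smul_def, map_sub, map_div₀, map_ofNat]
  ring

theorem phiAt_dunklInf_pow_eq (k p q : ℂ) (f : LambdaBar) (n : ℕ) (a : Fin N ⊕ Fin N) :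
    phiAt N a ((dunklInf k p q ^ n) (LaurentPolynomial.C f)) =
      ∑ b, (laxL (mulHom (Fin N)) (gaugedOp k p q) k p q (fun _ => 1) ^ n) a b (phi N f) := by
  induction n generalizing a with
  | zero => simp [phiAt_C, Matrix.one_apply,
    apply_ite (fun T : Module.End ℂ (RatField (Fin N)) => T (phi N f))]
  | succ n ih =>
    rw [pow_succ', pow_succ', Module.End.mul_apply, phiAt_dunklInf_eq_laxL]
    simp only [ih, Matrix.mul_apply, map_sum, LinearMap.sum_apply, Module.End.mul_apply]
    rw [Finset.sum_comm]

theorem phi_cmsInf_eq_laxIntegral (k p q : ℂ) (r : ℕ) (f : LambdaBar) :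
    phi N (cmsInf k p q r f) =
      laxIntegral (mulHom (Fin N)) (gaugedOp k p q) k p q (fun _ => 1) (2 * r) (phi N f) := by
  have hw (a : Fin N ⊕ Fin N) : sweight (fun _ => (1 : ℂ)) a = 1 := by cases a <;> rfl
  rw [phi_cmsInf]
  simp only [phiAt_dunklInf_pow_eq, laxIntegral, hw, inv_one, one_smul, LinearMap.sum_apply]

theorem phi_cmsInf_commute (k p q : ℂ) (r s : ℕ) (f : LambdaBar) :
    phi N (cmsInf k p q r (cmsInf k p q s f)) = phi N (cmsInf k p q s (cmsInf k p q r f)) := by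
  have h : IsWeight k fun _ : Fin N => (1 : ℂ) := ⟨fun _ => Or.inl rfl, fun _ => one_ne_zero⟩
  have := laxIntegral_commute_laxIntegral (p := p) (q := q) (isConnection_gaugedOp (N := N) k p q) h
    (2 * r) (2 * s)
  simp only [phi_cmsInf_eq_laxIntegral]
  exact DFunLike.congr_fun this.eq (phi N f)

end Gauge

/-! ### Joint injectivity of the specializations -/

section Injectivity

/-- The power sums `ξ ^ l + ξ ^ (-l)`. -/
def powerVec (ξ : ℂˣ) (l : ℕ) : ℂ := (ξ : ℂ) ^ l + (ξ : ℂ)⁻¹ ^ l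

/-- Evaluation of Laurent polynomials at a point of the torus. -/
def torusEval {N : ℕ} (z : Fin N → ℂˣ) : LaurentRing (Fin N) →ₐ[ℂ] ℂ :=
  AddMonoidAlgebra.lift ℂ ℂ (Fin N →₀ ℤ)
    { toFun := fun m => ((∏ i, z i ^ (m.toAdd i) : ℂˣ) : ℂ)
      map_one' := by simp
      map_mul' := fun m m' => by simp [zpow_add, Finset.prod_mul_distrib] }

theorem torusEval_single {N : ℕ} (z : Fin N → ℂˣ) (i : Fin N) (l : ℤ) :
    torusEval z (AddMonoidAlgebra.single (Finsupp.single i l) 1) = ((z i ^ l : ℂˣ) : ℂ) := by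
  rw [torusEval, AddMonoidAlgebra.lift_single, one_smul]
  change ((∏ j, z j ^ (Finsupp.single i l j) : ℂˣ) : ℂ) = _
  rw [Finset.prod_eq_single i]
  · simp
  · intro j _ hj; simp [Finsupp.single_eq_of_ne hj]
  · simp

/-- Rational functions cannot be evaluated everywhere, so `phi N` is first factored through Laurent
polynomials. -/
theorem eval_eq_zero_of_phi {N : ℕ} {f : LambdaBar} (hf : phi N f = 0) (z : Fin N → ℂˣ) :
    MvPolynomial.eval (∑ i, powerVec (z i)) f = 0 := by
  let x (i : Fin N) (l : ℤ) : LaurentRing (Fin N) := AddMonoidAlgebra.single (Finsupp.single i l) 1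
  have hx (i : Fin N) (l l' : ℤ) : x i l * x i l' = x i (l + l') := by
    simp only [x, AddMonoidAlgebra.single_mul_single, ← Finsupp.single_add, mul_one]
  have hx0 (i : Fin N) : x i 0 = 1 := by simp [x, AddMonoidAlgebra.one_def]
  have hi (i : Fin N) : algebraMap (LaurentRing (Fin N)) (RatField (Fin N)) (x i (-1)) =
      (var i)⁻¹ := by
    apply eq_inv_of_mul_eq_one_left
    change _ * algebraMap _ _ (x i 1) = 1
    rw [← map_mul, hx, neg_add_cancel, hx0, map_one]
  let ψ : LambdaBar →ₐ[ℂ] LaurentRing (Fin N) :=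
    MvPolynomial.aeval fun l : ℕ => ∑ i, (x i 1 ^ l + x i (-1) ^ l)
  have h1 : (Algebra.algHom ℂ (LaurentRing (Fin N)) (RatField (Fin N))).comp ψ = phi N := by
    refine MvPolynomial.algHom_ext fun l => ?_
    change algebraMap _ _ (ψ (MvPolynomial.X l)) = _
    simp only [ψ, phi, MvPolynomial.aeval_X, map_sum, map_add, map_pow, hi]
    rfl
  have h2 : ψ f = 0 := by
    apply IsFractionRing.injective (LaurentRing (Fin N)) (RatField (Fin N))
    rw [map_zero, ← hf, ← h1]
    rfl
  have h3 : (torusEval z).comp ψ = MvPolynomial.aeval (∑ i, powerVec (z i)) := by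
    refine MvPolynomial.algHom_ext fun l => ?_
    rw [AlgHom.comp_apply]
    simp only [ψ, x, MvPolynomial.aeval_X, map_sum, map_add, map_pow, torusEval_single,
      Finset.sum_apply, powerVec]
    simp
  have h4 := DFunLike.congr_fun h3 f
  rw [AlgHom.comp_apply, h2, map_zero] at h4
  exact h4.symm

theorem eval_add_smul_eq_zero {f : LambdaBar} {a v : ℕ → ℂ}
    (h : ∀ n : ℕ, MvPolynomial.eval (a + (n : ℂ) • v) f = 0) (t : ℂ) :
    MvPolynomial.eval (a + t • v) f = 0 := by
  let g : Polynomial ℂ :=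
    MvPolynomial.aeval (fun l => Polynomial.C (a l) + Polynomial.X * Polynomial.C (v l)) f
  have hg (t : ℂ) : g.eval t = MvPolynomial.eval (a + t • v) f := by
    have : (Polynomial.aeval t).comp (MvPolynomial.aeval fun l =>
        Polynomial.C (a l) + Polynomial.X * Polynomial.C (v l)) =
        (MvPolynomial.aeval (a + t • v) : LambdaBar →ₐ[ℂ] ℂ) :=
      MvPolynomial.algHom_ext fun l => by simp; ring
    exact DFunLike.congr_fun this f
  have h0 : g = 0 := by
    refine Polynomial.eq_zero_of_infinite_isRoot g
      ((Set.infinite_range_of_injective (Nat.cast_injective (R := ℂ))).mono ?_)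
    rintro _ ⟨n, rfl⟩
    exact (hg n).trans (h n)
  rw [← hg, h0, Polynomial.eval_zero]

/-- Repeating a variable `n` times gives the multiplicity `n`; a polynomial in the multiplicity that
vanishes at all naturals vanishes at all complex numbers. This frees the value of `p_0` from the
even integers `2N`. -/
theorem eval_linearCombination_eq_zero {f : LambdaBar} (hf : ∀ N, phi N f = 0) (c : ℂˣ →₀ ℂ) :
    MvPolynomial.eval (Finsupp.linearCombination ℂ powerVec c) f = 0 := by
  -- The list holds the points whose multiplicities are still natural numbers; the induction makes
  -- one multiplicity complex at a time.
  have h : ∀ s : List ℂˣ, MvPolynomial.eval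
      ((s.map powerVec).sum + Finsupp.linearCombination ℂ powerVec c) f = 0 := by
    induction c using Finsupp.induction with
    | zero =>
      intro s
      have := eval_eq_zero_of_phi (hf s.length) s.get
      rw [map_zero, add_zero]
      convert this
      rw [← List.sum_ofFn]
      congr 1
      rw [← List.ofFn_get (s.map powerVec)]
      simp [List.ofFn_eq_map]
    | single_add ξ t c _ _ ih =>
      intro s
      rw [map_add, Finsupp.linearCombination_single, add_comm (t • _), ← add_assoc]
      refine eval_add_smul_eq_zero (fun n => ?_) t
      have := ih (s ++ List.replicate n ξ)
      rw [List.map_append, List.sum_append, List.map_replicate, List.sum_replicate,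
        ← Nat.cast_smul_eq_nsmul ℂ] at this
      convert this using 2
      abel_nf
  simpa using h []

/-- Multiplying by `ξ^M` gives a polynomial with infinitely many zeros. Its coefficient at `M + l`
is `c l`, doubled when `l = 0`, where both exponents coincide. -/
theorem powerVec_independent {M : ℕ} (c : Fin (M + 1) → ℂ)
    (h : ∀ ξ, ∑ l, c l * powerVec ξ l = 0) : c = 0 := by
  let g : Polynomial ℂ := ∑ l : Fin (M + 1),
    Polynomial.C (c l) * (Polynomial.X ^ (M + l : ℕ) + Polynomial.X ^ (M - l : ℕ))
  have hg : g = 0 := by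
    refine Polynomial.eq_zero_of_infinite_isRoot g
      ((Set.finite_singleton (0 : ℂ)).infinite_compl.mono ?_)
    intro t ht
    have ht : t ≠ 0 := ht
    have := h (Units.mk0 t ht)
    change g.eval t = 0
    rw [Polynomial.eval_finsetSum, ← mul_zero (t ^ M), ← this, Finset.mul_sum]
    refine Finset.sum_congr rfl fun l _ => ?_
    have e : t ^ (M - l : ℕ) = t ^ M * t⁻¹ ^ (l : ℕ) := by
      rw [pow_sub₀ _ ht (by omega), inv_pow]
    simp only [Polynomial.eval_mul, Polynomial.eval_C, Polynomial.eval_add, Polynomial.eval_pow,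
      Polynomial.eval_X, powerVec, Units.val_mk0, e]
    ring
  funext l
  have h1 := congrArg (fun g => Polynomial.coeff g (M + l)) hg
  simp only [g, Polynomial.finsetSum_coeff, Polynomial.coeff_C_mul, Polynomial.coeff_add,
    Polynomial.coeff_X_pow, Polynomial.coeff_zero] at h1
  rw [Finset.sum_eq_single l] at h1
  · rw [if_pos rfl] at h1
    rcases mul_eq_zero.1 h1 with h1 | h1
    · exact h1
    · split_ifs at h1 <;> norm_num at h1
  · intro j _ hj
    have : (j : ℕ) ≠ l := fun e => hj (Fin.ext e)
    rw [if_neg (by omega), if_neg (by omega)]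
    simp
  · simp

/-- By duality: a functional killing all truncated power vectors is zero by `powerVec_independent`,
so they span. -/
theorem exists_linearCombination (M : ℕ) (x : ℕ → ℂ) :
    ∃ c : ℂˣ →₀ ℂ, ∀ l ≤ M, Finsupp.linearCombination ℂ powerVec c l = x l := by
  let ρ : (ℕ → ℂ) →ₗ[ℂ] (Fin (M + 1) → ℂ) := LinearMap.funLeft ℂ ℂ fun l : Fin (M + 1) => (l : ℕ)
  have htop : LinearMap.range (ρ ∘ₗ Finsupp.linearCombination ℂ powerVec) = ⊤ := by
    by_contra hne
    obtain ⟨φ, hφ, hle⟩ := Submodule.exists_le_ker_of_lt_top _ (lt_top_iff_ne_top.2 hne)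
    apply hφ
    have h0 := powerVec_independent (fun l => φ fun j => if l = j then 1 else 0) fun ξ => by
      have h1 : φ (ρ (powerVec ξ)) = 0 :=
        hle ⟨Finsupp.single ξ 1, by simp [Finsupp.linearCombination_single]⟩
      rw [LinearMap.pi_apply_eq_sum_univ φ] at h1
      exact (Finset.sum_congr rfl fun l _ => mul_comm _ _).trans h1
    refine LinearMap.ext fun y => ?_
    rw [LinearMap.pi_apply_eq_sum_univ φ]
    refine Finset.sum_eq_zero fun l _ => ?_
    rw [show (φ fun j => if l = j then 1 else 0) = 0 from congrFun h0 l, smul_zero]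
  obtain ⟨c, hc⟩ : ρ x ∈ LinearMap.range (ρ ∘ₗ Finsupp.linearCombination ℂ powerVec) := by
    rw [htop]; trivial
  exact ⟨c, fun l hl => congrFun hc ⟨l, by omega⟩⟩

/-- The specializations to finitely many variables are jointly injective. -/
theorem eq_zero_of_phi {f : LambdaBar} (hf : ∀ N, phi N f = 0) : f = 0 := by
  refine MvPolynomial.funext fun x => ?_
  obtain ⟨c, hc⟩ := exists_linearCombination (f.vars.sup id) x
  rw [map_zero, ← eval_linearCombination_eq_zero hf c]
  exact MvPolynomial.eval₂Hom_congr' rfl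
    (fun l hl _ => (hc l (Finset.le_sup (f := id) hl)).symm) rfl

theorem cmsInf_commute (k p q : ℂ) (r s : ℕ) : Commute (cmsInf k p q r) (cmsInf k p q s) := by
  refine LinearMap.ext fun f => sub_eq_zero.1 (eq_zero_of_phi fun N => ?_)
  rw [map_sub, sub_eq_zero]
  exact phi_cmsInf_commute k p q r s f

end Injectivity

/-! ### The explicit form of the second order operator -/

section SecondOrder

local notation "𝐓" => (LaurentPolynomial.T : ℤ → LambdaBarX)
local notation "𝐂" => (LaurentPolynomial.C : LambdaBar → LambdaBarX)

theorem pgen_neg (j : ℤ) : pgen (-j) = pgen j := by rw [pgen, pgen, Int.natAbs_neg]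

theorem traceE_T (l : ℤ) : traceE (𝐓 l) = pgen l := by
  have := onPowers_single pgen l 1
  rw [one_smul] at this
  exact this

theorem traceE_C_mul (c : LambdaBar) (F : LambdaBarX) : traceE (𝐂 c * F) = c * traceE F := by
  rw [← LaurentPolynomial.smul_eq_C_mul, map_smul, smul_eq_mul]

theorem onPowers_C_mul {M : Type} [AddCommGroup M] [Module LambdaBar M] (g : ℤ → M) (l : ℤ)
    (c : LambdaBar) : onPowers g (𝐂 c * 𝐓 l) = c • g l := by
  rw [← LaurentPolynomial.single_eq_C_mul_T, onPowers_single]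

theorem pderiv_comm (a b : ℕ) (f : LambdaBar) :
    MvPolynomial.pderiv a (MvPolynomial.pderiv b f) =
      MvPolynomial.pderiv b (MvPolynomial.pderiv a f) := by
  have h : ⁅(MvPolynomial.pderiv a : Derivation ℂ LambdaBar LambdaBar),
      (MvPolynomial.pderiv b : Derivation ℂ LambdaBar LambdaBar)⁆ = 0 := by
    refine MvPolynomial.derivation_ext fun l => ?_
    rw [Derivation.commutator_apply, MvPolynomial.pderiv_X, MvPolynomial.pderiv_X]
    simp [Pi.single_apply, apply_ite]
  have := DFunLike.congr_fun h f
  rw [Derivation.commutator_apply] at this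
  exact sub_eq_zero.1 this

theorem partialP_comm (a b : ℕ) (f : LambdaBar) :
    partialP a (partialP b f) = partialP b (partialP a f) := by
  simp only [partialP, Derivation.map_smul]
  rw [pderiv_comm, smul_comm]

/-- The difference `x ^ a - x ^ (-a)`. -/
def oddT (a : ℕ) : LambdaBarX := 𝐓 a - 𝐓 (-a)

theorem derivP_eq {f : LambdaBar} {M : ℕ} (h : ∀ a, M < a → partialP a f = 0) :
    derivP f = ∑ a ∈ Finset.Icc 1 M, partialP a f • oddT a := by
  -- Comparing derivations on generators needs a range containing all variables of `f`; the extra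
  -- terms vanish by hypothesis. Index 0 may be left out because `∂ p_0 = 0`.
  let M' := max M (f.vars.sup id)
  let d : Derivation ℂ LambdaBar LambdaBarX := ∑ a ∈ Finset.Icc 1 M',
    (a : ℂ) • (LinearMap.toSpanSingleton LambdaBar LambdaBarX (oddT a)).compDer
      (MvPolynomial.pderiv a)
  have hd (g : LambdaBar) : d g = ∑ a ∈ Finset.Icc 1 M', partialP a g • oddT a := by
    simp only [d]
    rw [← Derivation.coeFnAddMonoidHom_apply, map_sum, Finset.sum_apply]
    refine Finset.sum_congr rfl fun a _ => ?_
    rw [partialP, smul_assoc]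
    rfl
  have h1 : derivP f = d f := by
    refine MvPolynomial.derivation_eq_of_forall_mem_vars fun l hl => ?_
    have hl' : l ≤ M' := le_max_of_le_right (Finset.le_sup (f := id) hl)
    rw [hd, derivP, MvPolynomial.mkDerivation_X]
    have e (a : ℕ) : partialP a (MvPolynomial.X l) • oddT a =
        if a = l then (l : ℂ) • oddT l else 0 := by
      rw [partialP, MvPolynomial.pderiv_X]
      by_cases hal : a = l
      · subst hal; rw [Pi.single_eq_same, if_pos rfl, smul_assoc, one_smul]
      · rw [Pi.single_eq_of_ne (Ne.symm hal), if_neg hal, smul_zero, zero_smul]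
    simp only [e, Finset.sum_ite_eq']
    rw [oddT]
    split_ifs with hm
    · rfl
    · have : l = 0 := by
        rw [Finset.mem_Icc] at hm; omega
      subst this
      simp
  rw [h1, hd]
  symm
  refine Finset.sum_subset (Finset.Icc_subset_Icc_right (le_max_left _ _)) fun a ha ha' => ?_
  rw [Finset.mem_Icc] at ha ha'
  rw [h a (by omega), zero_smul]

theorem dunklInf_C (k p q : ℂ) (f : LambdaBar) : dunklInf k p q (𝐂 f) = derivP f := by
  have h {M : Type} [AddCommGroup M] [Module LambdaBar M] (g : ℤ → M) (hg : g 0 = 0) :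
      onPowers g (𝐂 f) = 0 := by
    have := onPowers_C_mul g 0 f
    rwa [LaurentPolynomial.T_zero, mul_one, hg, smul_zero] at this
  have h1 : derivInf (𝐂 f) = derivP f := by
    change derivLin (AddMonoidAlgebra.single 0 f) = _
    rw [derivLin_single]; simp
  have h2 : Delta (𝐂 f) = 0 := h _ (by simp)
  have h3 : reflOne (𝐂 f) = 0 := h _ (by simp)
  have h4 : reflTwo (𝐂 f) = 0 := h _ (by simp)
  change derivInf (𝐂 f) - (k / 2) • Delta (𝐂 f) - (p / 2) • reflOne (𝐂 f) - q • reflTwo (𝐂 f) = _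
  rw [h1, h2, h3, h4, smul_zero, smul_zero, smul_zero, sub_zero, sub_zero, sub_zero]

theorem onPowers_T {M : Type} [AddCommGroup M] [Module LambdaBar M] (g : ℤ → M) (l : ℤ) :
    onPowers g (𝐓 l) = g l := by
  have := onPowers_single g l 1
  rwa [one_smul] at this

theorem traceE_invert (F : LambdaBarX) : traceE (LaurentPolynomial.invert F) = traceE F := by
  induction F using AddMonoidAlgebra.induction_linear with
  | zero => simp
  | add F G hF hG => rw [map_add, map_add, map_add, hF, hG]
  | single l c =>
    rw [LaurentPolynomial.single_eq_C_mul_T, map_mul, LaurentPolynomial.invert_C,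
      LaurentPolynomial.invert_T, traceE_C_mul, traceE_C_mul, traceE_T, traceE_T, pgen_neg]

/-- `Δ` takes opposite values on inverse powers up to inversion, and `E` does not see the inversion,
so the two halves add up instead of cancelling. -/
theorem traceE_Delta_oddT {a : ℕ} (ha : 0 < a) :
    traceE (Delta (oddT a)) = 2 * ((pgen 0 - 2 * (a : LambdaBar) - 1) * pgen a
      - 2 * ∑ j ∈ Finset.Ico 1 a, pgen ((a : ℤ) - 2 * j) - pgen a
      + 2 * ∑ j ∈ Finset.Ico 1 a, pgen j * pgen ((a : ℤ) - j) + pgen a * pgen 0) := by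
  have h1 : Delta (𝐓 a) = deltaPos a := by
    rw [Delta, onPowers_T, if_pos (by omega), Int.natAbs_natCast]
  have h2 : Delta (𝐓 (-a)) = deltaNeg a := by
    rw [Delta, onPowers_T, if_neg (by omega), if_pos (by omega), Int.natAbs_neg,
      Int.natAbs_natCast]
  have h3 : traceE (deltaPos a) = (pgen 0 - 2 * (a : LambdaBar) - 1) * pgen a
      - 2 * ∑ j ∈ Finset.Ico 1 a, pgen ((a : ℤ) - 2 * j) - pgen a
      + 2 * ∑ j ∈ Finset.Ico 1 a, pgen j * pgen ((a : ℤ) - j) + pgen a * pgen 0 := by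
    have e (F : LambdaBarX) : traceE (2 * F) = 2 * traceE F := by
      rw [two_mul, map_add, two_mul]
    have e' (c : LambdaBar) : traceE (𝐂 c) = c * pgen 0 := by
      rw [← mul_one (𝐂 c), ← LaurentPolynomial.T_zero, traceE_C_mul, traceE_T]
    rw [deltaPos]
    simp only [map_add (traceE), map_sub (traceE), map_sum (traceE), e, traceE_C_mul, traceE_T,
      e', pgen_neg]
  rw [oddT, map_sub, h1, h2, deltaNeg_eq, sub_neg_eq_add, map_add, traceE_invert, h3]
  ring

theorem traceE_reflOne_oddT {a : ℕ} (ha : 0 < a) :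
    traceE (reflOne (oddT a)) =
      2 * (2 * pgen a + 2 * ∑ j ∈ Finset.Ico 1 (2 * a), pgen ((a : ℤ) - j)) := by
  have e' (F G : LambdaBarX) : ((1 : ℤ) : LambdaBarX) * F - ((-1 : ℤ) : LambdaBarX) * G =
      F + G := by
    push_cast; ring
  have e (F : LambdaBarX) : traceE (2 * F) = 2 * traceE F := by
    rw [two_mul, map_add, two_mul]
  rw [oddT, map_sub, reflOne, onPowers_T, onPowers_T, Int.sign_neg,
    Int.sign_eq_one_of_pos (by omega), Int.natAbs_neg, Int.natAbs_natCast, e', neg_neg]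
  simp only [map_add, map_sum, e, traceE_T, pgen_neg]
  ring

theorem traceE_reflTwo_oddT {a : ℕ} (ha : 0 < a) :
    traceE (reflTwo (oddT a)) =
      2 * (2 * pgen a + 2 * ∑ j ∈ Finset.Ico 1 a, pgen ((a : ℤ) - 2 * j)) := by
  have e' (F G : LambdaBarX) : ((1 : ℤ) : LambdaBarX) * F - ((-1 : ℤ) : LambdaBarX) * G =
      F + G := by
    push_cast; ring
  have e (F : LambdaBarX) : traceE (2 * F) = 2 * traceE F := by
    rw [two_mul, map_add, two_mul]
  rw [oddT, map_sub, reflTwo, onPowers_T, onPowers_T, Int.sign_neg,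
    Int.sign_eq_one_of_pos (by omega), Int.natAbs_neg, Int.natAbs_natCast, e', neg_neg]
  simp only [map_add, map_sum, e, traceE_T, pgen_neg]
  ring

theorem traceE_derivInf_oddT (c : LambdaBar) (a : ℕ) :
    traceE (derivInf (c • oddT a)) =
      traceE (derivP c * oddT a) + c * ((2 * a : LambdaBar) * pgen a) := by
  have h (l : ℤ) : derivInf (𝐂 c * 𝐓 l) = derivP c * 𝐓 l + (l : ℂ) • (𝐂 c * 𝐓 l) := by
    rw [← LaurentPolynomial.single_eq_C_mul_T]
    change derivLin _ = _
    rw [derivLin_single, LaurentPolynomial.single_eq_C_mul_T, add_mul, smul_mul_assoc]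
  have e (z : ℂ) (F : LambdaBarX) : traceE (z • F) = z • traceE F :=
    (traceE.restrictScalars ℂ).map_smul z F
  rw [oddT, LaurentPolynomial.smul_eq_C_mul, mul_sub, map_sub, h, h, mul_sub, map_sub, map_add,
    map_add, map_sub, e, e, traceE_C_mul, traceE_C_mul, traceE_T, traceE_T, pgen_neg]
  push_cast
  simp only [MvPolynomial.smul_eq_C_mul, map_neg, map_natCast]
  ring

theorem traceE_oddT_mul (a b : ℕ) :
    traceE (oddT b * oddT a) = 2 * (pgen ((a : ℤ) + b) - pgen ((a : ℤ) - b)) := by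
  have e : oddT b * oddT a = 𝐓 (a + b) - 𝐓 (a - b) - 𝐓 (-(a - b)) + 𝐓 (-(a + b)) := by
    simp only [oddT, sub_mul, mul_sub, ← LaurentPolynomial.T_add]
    rw [show (b : ℤ) + a = a + b by ring, show (b : ℤ) + -a = -(a - b) by ring,
      show -(b : ℤ) + a = a - b by ring, show -(b : ℤ) + -a = -(a + b) by ring]
    ring
  rw [e, map_add, map_sub, map_sub]
  simp only [traceE_T, pgen_neg]
  ring

theorem cmsInf_apply (k p q : ℂ) (r : ℕ) (f : LambdaBar) :
    cmsInf k p q r f = traceE ((dunklInf k p q ^ (2 * r)) (𝐂 f)) := rfl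

/-- All reflection parts kill `Λ̄`, so the first application of `D` is `∂`. In the second, `∂`
acting on the coefficients gives the second order part, and everything else acts on `x^a - x^(-a)`
with coefficient `∂_a f`. -/
theorem cmsInf_one (k p q : ℂ) (f : LambdaBar) (M : ℕ) (hM : ∀ a ∈ f.vars, a ≤ M) :
    cmsInf k p q 1 f =
      2 * ∑ a ∈ Finset.Icc 1 M, ∑ b ∈ Finset.Icc 1 M,
          (pgen ((a : ℤ) + b) - pgen ((a : ℤ) - b)) * partialP a (partialP b f)
      + 2 * ∑ a ∈ Finset.Icc 1 M,
          (MvPolynomial.C (a * k + a + k - p - 2 * q) - MvPolynomial.C k * pgen 0) *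
            pgen a * partialP a f
      + MvPolynomial.C (2 * (k - 2 * q)) * ∑ a ∈ Finset.Icc 1 M,
          (∑ j ∈ Finset.Ico 1 a, pgen ((a : ℤ) - 2 * j)) * partialP a f
      - MvPolynomial.C (2 * p) * ∑ a ∈ Finset.Icc 1 M,
          (∑ j ∈ Finset.Ico 1 (2 * a), pgen ((a : ℤ) - j)) * partialP a f
      - MvPolynomial.C (2 * k) * ∑ a ∈ Finset.Icc 1 M,
          (∑ j ∈ Finset.Ico 1 a, pgen j * pgen ((a : ℤ) - j)) * partialP a f := by
  have h0 (a : ℕ) (ha : M < a) : partialP a f = 0 := by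
    rw [partialP, MvPolynomial.pderiv_eq_zero_of_notMem_vars fun h => absurd (hM a h) (by omega),
      smul_zero]
  have h1 (b a : ℕ) (ha : M < a) : partialP a (partialP b f) = 0 := by
    rw [partialP_comm, h0 a ha, partialP, map_zero, smul_zero]
  have e (z : ℂ) (F : LambdaBarX) : traceE (z • F) = z • traceE F :=
    (traceE.restrictScalars ℂ).map_smul z F
  have h2 : ∀ a ∈ Finset.Icc 1 M, traceE (dunklInf k p q (partialP a f • oddT a)) =
      ∑ b ∈ Finset.Icc 1 M,
          2 * ((pgen ((a : ℤ) + b) - pgen ((a : ℤ) - b)) * partialP a (partialP b f))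
      + 2 * ((MvPolynomial.C (a * k + a + k - p - 2 * q) - MvPolynomial.C k * pgen 0) *
            pgen a * partialP a f)
      + MvPolynomial.C (2 * (k - 2 * q)) *
          ((∑ j ∈ Finset.Ico 1 a, pgen ((a : ℤ) - 2 * j)) * partialP a f)
      - MvPolynomial.C (2 * p) *
          ((∑ j ∈ Finset.Ico 1 (2 * a), pgen ((a : ℤ) - j)) * partialP a f)
      - MvPolynomial.C (2 * k) *
          ((∑ j ∈ Finset.Ico 1 a, pgen j * pgen ((a : ℤ) - j)) * partialP a f) := by
    intro a ha
    have ha : 0 < a := (Finset.mem_Icc.1 ha).1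
    change traceE (derivInf _ - (k / 2) • Delta _ - (p / 2) • reflOne _ - q • reflTwo _) = _
    have h3 : traceE (derivP (partialP a f) * oddT a) = ∑ b ∈ Finset.Icc 1 M,
        2 * ((pgen ((a : ℤ) + b) - pgen ((a : ℤ) - b)) * partialP a (partialP b f)) := by
      rw [derivP_eq (h1 a), Finset.sum_mul, map_sum]
      refine Finset.sum_congr rfl fun b _ => ?_
      rw [smul_mul_assoc, map_smul, traceE_oddT_mul, partialP_comm, smul_eq_mul]
      ring
    rw [map_sub, map_sub, map_sub, e, e, e, traceE_derivInf_oddT, h3, map_smul Delta,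
      map_smul reflOne, map_smul reflTwo, map_smul traceE, map_smul traceE, map_smul traceE,
      traceE_Delta_oddT ha, traceE_reflOne_oddT ha, traceE_reflTwo_oddT ha]
    have c2 : (MvPolynomial.C 2 : LambdaBar) = 2 := map_ofNat _ 2
    have hk (z : ℂ) : (MvPolynomial.C z : LambdaBar) = 2 * MvPolynomial.C (z / 2) := by
      rw [← c2, ← map_mul]; congr 1; ring
    generalize (∑ b ∈ Finset.Icc 1 M, 2 * ((pgen ((a : ℤ) + b) - pgen ((a : ℤ) - b)) *
      partialP a (partialP b f)) : LambdaBar) = S0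
    generalize (∑ j ∈ Finset.Ico 1 a, pgen ((a : ℤ) - 2 * j) : LambdaBar) = S1
    generalize (∑ j ∈ Finset.Ico 1 (2 * a), pgen ((a : ℤ) - j) : LambdaBar) = S2
    generalize (∑ j ∈ Finset.Ico 1 a, pgen j * pgen ((a : ℤ) - j) : LambdaBar) = S3
    generalize partialP a f = g
    generalize pgen a = P
    generalize pgen 0 = P0
    simp only [smul_eq_mul, MvPolynomial.smul_eq_C_mul, map_mul, map_add, map_sub, map_natCast, c2]
    rw [hk k, hk p]
    generalize (MvPolynomial.C (k / 2) : LambdaBar) = K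
    generalize (MvPolynomial.C (p / 2) : LambdaBar) = P'
    generalize (MvPolynomial.C q : LambdaBar) = Q
    ring
  have h3 : cmsInf k p q 1 f = ∑ a ∈ Finset.Icc 1 M,
      traceE (dunklInf k p q (partialP a f • oddT a)) := by
    rw [← map_sum, ← map_sum, ← derivP_eq h0, ← dunklInf_C k p q]
    rw [cmsInf_apply, mul_one, sq, Module.End.mul_apply]
  rw [h3, Finset.sum_congr rfl h2]
  simp only [Finset.sum_add_distrib, Finset.sum_sub_distrib, ← Finset.mul_sum]

end SecondOrder
end BCCMS

end

theorem mainTheorem9 :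
    (∀ k p q : ℂ,
      -- the operator at infinity restricts to the `BC_N` Dunkl–Heckman operators
      (∀ (N : ℕ) (i : Fin N) (F : BCCMS.LambdaBarX),
        BCCMS.phiX N i (BCCMS.dunklInf k p q F) =
          BCCMS.dunkl N k p q i (BCCMS.phiX N i F)) ∧
      -- `𝓛^(2r)` restricts to twice Heckman's integral of the `BC_N` system
      (∀ (N r : ℕ) (f : BCCMS.LambdaBar),
        BCCMS.phi N f ∈ BCCMS.invariants N ∧
        BCCMS.phi N (BCCMS.cmsInf k p q r f) =
          2 * BCCMS.heckman N k p q r (BCCMS.phi N f)) ∧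
      -- the first of Heckman's integrals is the `BC_N` CMS operator
      (∀ (N : ℕ), ∀ g ∈ BCCMS.invariants N,
        BCCMS.heckman N k p q 1 g = BCCMS.gaugedCMS N k p q g) ∧
      -- the integrals at infinity commute
      (∀ r s : ℕ, Commute (BCCMS.cmsInf k p q r) (BCCMS.cmsInf k p q s)) ∧
      -- the explicit form of `𝓛^(2)`; `M` bounds the indices of the generators occurring in `f`
      (∀ (f : BCCMS.LambdaBar) (M : ℕ), (∀ a ∈ f.vars, a ≤ M) →
        BCCMS.cmsInf k p q 1 f =
          2 * ∑ a ∈ Finset.Icc 1 M, ∑ b ∈ Finset.Icc 1 M,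
              (BCCMS.pgen ((a : ℤ) + b) - BCCMS.pgen ((a : ℤ) - b)) *
                BCCMS.partialP a (BCCMS.partialP b f)
          + 2 * ∑ a ∈ Finset.Icc 1 M,
              (MvPolynomial.C (a * k + a + k - p - 2 * q) - MvPolynomial.C k * BCCMS.pgen 0) *
                BCCMS.pgen a * BCCMS.partialP a f
          + MvPolynomial.C (2 * (k - 2 * q)) * ∑ a ∈ Finset.Icc 1 M,
              (∑ j ∈ Finset.Ico 1 a, BCCMS.pgen ((a : ℤ) - 2 * j)) * BCCMS.partialP a f
          - MvPolynomial.C (2 * p) * ∑ a ∈ Finset.Icc 1 M,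
              (∑ j ∈ Finset.Ico 1 (2 * a), BCCMS.pgen ((a : ℤ) - j)) * BCCMS.partialP a f
          - MvPolynomial.C (2 * k) * ∑ a ∈ Finset.Icc 1 M,
              (∑ j ∈ Finset.Ico 1 a, BCCMS.pgen j * BCCMS.pgen ((a : ℤ) - j)) *
                BCCMS.partialP a f)) ∧
    -- the deformed system
    (∀ (n m : ℕ) (k p q r s : ℂ), k ≠ 0 → p = k * r → 2 * q + 1 = k * (2 * s + 1) →
      (∀ l : ℕ, Commute (BCCMS.deformedIntegral n m k p q r s l)
        (BCCMS.deformedCMS n m k p q r s)) ∧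
      (∀ l l' : ℕ, Commute (BCCMS.deformedIntegral n m k p q r s l)
        (BCCMS.deformedIntegral n m k p q r s l'))) := by
  refine ⟨fun k p q => ⟨fun N i F => BCCMS.phiAt_dunklInf_inl k p q i F,
    fun N r f => ⟨BCCMS.phi_mem_invariants f, BCCMS.phi_cmsInf_eq_heckman k p q r f⟩,
    fun N g hg => BCCMS.heckman_one k p q g hg,
    fun r s => BCCMS.cmsInf_commute k p q r s,
    fun f M hM => BCCMS.cmsInf_one k p q f M hM⟩, fun n m k p q r s hk hp hq =>
    ⟨fun l => BCCMS.deformedIntegral_commute_deformedCMS hk hp hq l,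
      fun l l' => BCCMS.deformedIntegral_commute hk hp hq l l'⟩⟩
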